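/- **Theorem 2.** Let $y_i=X_i\beta^*+r_i$, $i=1,2,\dots$, where $y_i\in\mathbb R^{n_i}$, $X_i$ is a deterministic $n_i\times p$ matrix, and the errors $r_i$ are independent with $E r_i=0$ and $\operatorname{var}(r_i)=H_i(\theta^*)=\sum_{q=1}^d\theta^*_q\Phi_{iq}$ for deterministic positive semidefinite matrices $\Phi_{iq}$ and $\theta^*\in[0,\infty)^d$. Let $\theta_1^*=\theta_1^0\ge 0$, and let $\theta^*_2,\dots,\theta^*_d>0$. *Statistics.* From the first $n$ subjects let $\hat\beta=(X^TX)^{-1}X^Ty$ be the least-squares estimator ($X$ and $y$ are the stacked $X_i$ and $y_i$), $\hat r_i=y_i-X_i\hat\beta$, $\hat R_i=\hat r_i\hat r_i^T$, $\Xi=\big(\sum_{i=1}^n\operatorname{tr}(\Phi_{ik}\Phi_{il})\big)_{k,l=1}^d$, $\hat\Upsilon_k=\sum_{i=1}^n\operatorname{tr}(\Phi_{ik}\hat R_i)$. Let $\hat\theta_q=(\Xi^{-1}\hat\Upsilon)_q$ for $q=2,\dots,d$, and $$\hat Z_i(\theta_1)=\operatorname{tr}\Big\{\Phi_{i1}\Big(\hat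 R_i-\theta_1\Phi_{i1}-\sum_{q=2}^d\hat\theta_q\Phi_{iq}\Big)\Big\}.$$ Let $Z_i(\theta_1)$ be defined in the same way with $\hat R_i$ replaced by $R_i=r_ir_i^T$ everywhere. Put $$L(\theta_1)=\max\Big\{\prod_{i=1}^np_i:\ p_i\ge0,\ \sum_{i=1}^n p_i=1,\ \sum_{i=1}^n p_i\hat Z_i(\theta_1)=0\Big\},\qquad \mathrm{ELR}(\theta_1^0)=\frac{L(\theta_1^0)}{\max_{\theta_1\ge0}L(\theta_1)}$$ (a maximum over the empty set is $0$). Let $v_n=\operatorname{var}\{n^{-1/2}\sum_{i=1}^n\hat Z_i(\theta_1^0)\}$, $\hat\nu_{2n}^2=n^{-1}\sum_{i=1}^n\hat Z_i(\theta_1^0)^2$, let $\hat\nu_{1n}^2$ be any random variables with $\hat\nu_{1n}^2-v_n\to0$ in probability, and put $\hat c_n(\theta_1^0)=\hat\nu_{2n}^2/\hat\nu_{1n}^2$. *Assumptions.* (a) $\sup_iE\|r_i\|_2^{4+\gamma}<\infty$ for some $\gamma>0$. (b) $P\big(0\in\operatorname{ch}\{Z_1(\theta_1^0),\dots,Z_n(\theta_1^0)\}\big)\to1$,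 where $\operatorname{ch}$ is the convex hull. (c) $X^TX$ is invertible for all large $n$, $\sup_{i,q}\|\Phi_{iq}\|_F<\infty$, and the smallest eigenvalue of $n^{-1}\Xi$ is bounded away from $0$ for all large $n$. (d) $n^{-1}\sum_{i=1}^n\operatorname{var}\{\operatorname{tr}(\Phi_{i1}R_i)\}$ and $v_n$ are bounded away from $0$ for all large $n$. *Conclusion.* As $n\to\infty$, $P(\mathrm{ELR}(\theta_1^0)>0)\to1$, and: - if $\theta_1^0>0$, then $\hat c_n(\theta_1^0)\{-2\log\mathrm{ELR}(\theta_1^0)\}\to\chi^2_1$ in distribution; - if $\theta_1^0=0$, then $\hat c_n(0)\{-2\log\mathrm{ELR}(0)\}\to U_+^2$ in distribution, where $U\sim N(0,1)$ and $U_+=\max(U,0)$. -/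

import Mathlib

open MeasureTheory ProbabilityTheory Filter Topology
open scoped Matrix

noncomputable section

/-- The fixed (non-random) part of the linear mixed model, for an infinite sequence of subjects
`i = 0, 1, 2, …`; the sample of size `n` consists of the subjects `i < n`.
There are `p` fixed effects and `d + 1` variance components; the component of interest has index
`0`, and the `d` nuisance components are those with index `q.succ`, `q : Fin d`. -/
structure MixedDesign (p d : ℕ) where
  /-- number of repeated measures of subject `i` -/
  size : ℕ → ℕ
  /-- design matrix of the fixed effects -/
  X : ∀ i, Matrix (Fin (size i)) (Fin p) ℝ
  /-- design matrices of the variance components -/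
  Φ : ∀ i, Fin (d + 1) → Matrix (Fin (size i)) (Fin (size i)) ℝ
  /-- the `Φ i q` are symmetric positive semidefinite -/
  Φ_posSemidef : ∀ i q, (Φ i q).PosSemidef

namespace MixedDesign

variable {p d : ℕ} (D : MixedDesign p d)

/-- A response (or error) vector for every subject. -/
abbrev Obs : Type := ∀ i, Fin (D.size i) → ℝ

/-- A square matrix for every subject, such as `R i = r i (r i)ᵀ`. -/
abbrev SqMat : Type := ∀ i, Matrix (Fin (D.size i)) (Fin (D.size i)) ℝ

/-- The covariance matrix `H_i(θ) = ∑_q θ_q Φ_{iq}`. -/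
def H (θ : Fin (d + 1) → ℝ) (i : ℕ) : Matrix (Fin (D.size i)) (Fin (D.size i)) ℝ :=
  ∑ q, θ q • D.Φ i q

/-- The design matrices of the first `n` subjects, stacked. -/
def stackX (n : ℕ) : Matrix (Σ i : Fin n, Fin (D.size i)) (Fin p) ℝ :=
  Matrix.of fun a k => D.X a.1 a.2 k

/-- The response vectors of the first `n` subjects, stacked. -/
def stackY (n : ℕ) (y : D.Obs) : (Σ i : Fin n, Fin (D.size i)) → ℝ :=
  fun a => y a.1 a.2

/-- The least-squares estimator `(XᵀX)⁻¹ Xᵀ y` from the first `n` subjects. -/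
def betaHat (n : ℕ) (y : D.Obs) : Fin p → ℝ :=
  ((D.stackX n)ᵀ * D.stackX n)⁻¹ *ᵥ ((D.stackX n)ᵀ *ᵥ D.stackY n y)

/-- `R_i = r_i r_iᵀ`. -/
def outer (r : D.Obs) : D.SqMat :=
  fun i => Matrix.vecMulVec (r i) (r i)

/-- The least-squares residuals `y_i - X_i β̂`. -/
def residual (n : ℕ) (y : D.Obs) : D.Obs :=
  fun i => y i - D.X i *ᵥ D.betaHat n y

/-- `R̂_i = r̂_i r̂_iᵀ`, with the residuals of the first `n` subjects. -/
def RHat (n : ℕ) (y : D.Obs) : D.SqMat :=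
  D.outer (D.residual n y)

/-- The matrix `Ξ`, with entries `∑_{i<n} tr(Φ_{ik} Φ_{il})`. -/
def Xi (n : ℕ) : Matrix (Fin (d + 1)) (Fin (d + 1)) ℝ :=
  Matrix.of fun k l => ∑ i : Fin n, (D.Φ i k * D.Φ i l).trace

/-- The vector with entries `∑_{i<n} tr(Φ_{ik} R_i)`. -/
def Upsilon (n : ℕ) (R : D.SqMat) : Fin (d + 1) → ℝ :=
  fun k => ∑ i : Fin n, (D.Φ i k * R i).trace

/-- The estimator `((Ξ⁻¹)_{-1})ᵀ Υ` of the nuisance components, where `(Ξ⁻¹)_{-1}` is `Ξ⁻¹` without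
its first column. -/
def nuisance (n : ℕ) (R : D.SqMat) : Fin d → ℝ :=
  ((D.Xi n)⁻¹.submatrix id Fin.succ)ᵀ *ᵥ D.Upsilon n R

/-- `tr{Φ_{i1} (R_i - Φ_{i1} θ₁ - ∑_{q≥2} θ̂_q Φ_{iq})}`, where `θ̂` is computed from the `R_i` of the
first `n` subjects. -/
def Z (n : ℕ) (R : D.SqMat) (θ₁ : ℝ) (i : Fin n) : ℝ :=
  (D.Φ i 0 * (R i - θ₁ • D.Φ i 0 - ∑ q : Fin d, D.nuisance n R q • D.Φ i q.succ)).trace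

/-- The empirical likelihood of the constraint `∑ p_i z_i = 0`: the maximum of `∏ p_i` over
probability weights with that constraint (`0` if there are none). -/
def empLik {n : ℕ} (z : Fin n → ℝ) : ℝ :=
  sSup {l | ∃ w : Fin n → ℝ,
    (∀ i, 0 ≤ w i) ∧ ∑ i, w i = 1 ∧ ∑ i, w i * z i = 0 ∧ l = ∏ i, w i}

/-- The nonparametric likelihood `L(θ₁)`. -/
def lik (n : ℕ) (R : D.SqMat) (θ₁ : ℝ) : ℝ :=
  empLik (D.Z n R θ₁)

/-- The empirical likelihood ratio `L(θ₁⁰) / max_{θ₁ ≥ 0} L(θ₁)`. -/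
def elr (n : ℕ) (R : D.SqMat) (θ₁ : ℝ) : ℝ :=
  D.lik n R θ₁ / sSup (D.lik n R '' Set.Ici 0)

/-- `n^{-1/2} ∑_{i<n} Z_i(θ₁)`. -/
def normSum (n : ℕ) (R : D.SqMat) (θ₁ : ℝ) : ℝ :=
  (Real.sqrt n)⁻¹ * ∑ i, D.Z n R θ₁ i

/-- `ν₂² = n^{-1} ∑_{i<n} Z_i(θ₁)²`. -/
def nu2sq (n : ℕ) (R : D.SqMat) (θ₁ : ℝ) : ℝ :=
  (n : ℝ)⁻¹ * ∑ i, D.Z n R θ₁ i ^ 2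

end MixedDesign

end

/-!
The argument has a deterministic and a stochastic half, which meet in the normalized sum
`S = n^{-1/2} ∑ Ẑ_i` and the empirical second moment `V = n⁻¹ ∑ Ẑ_i²`.

*Deterministic half.* If `|Ẑ_i| ≤ M √n` with `M |S|` small compared with `V`, then the logarithm of
`nⁿ ∏ p_i`, maximized under the constraint `∑ p_i Ẑ_i = 0`, is `-S² / (2 V)` up to a relative error
of order `M |S| / V` (`MixedDesign.empLik_quadratic_bound`). The upper bound is Lagrange duality
with a multiplier of order `S / V`; the lower bound comes from explicit feasible weights. Since
`Ẑ_i(θ₁)` is affine in `θ₁` with slope `-tr(Φ_{i1}²)`, the sum `∑ Ẑ_i(θ)` vanishes at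
`θ = θ₁ + √n S / Ξ₁₁`, where the uniform weights are feasible and the likelihood is `n⁻ⁿ`. If this
point is nonnegative, then `-2 log ELR ≈ S² / V`. If `θ₁ = 0` and `S < 0`, then a larger `θ` only
makes the constraint harder, the maximum is attained at `0`, and the ratio is `1`. So
`-2 log ELR ≈ f(S) / V` with `f x = x ^ 2` in the interior and `f x = (max x 0) ^ 2` at the boundary.

*Stochastic half.* By the normal equations of the moment estimator, `∑ Ẑ_i = Ξ₁₁ (θ̂₁ - θ₁)`, so
that `S` is a linear combination of the centred statistics `Υ̂_k - (Ξ θ)_k` with bounded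
coefficients. Replacing the errors by residuals changes each `Υ_k` by an amount that is bounded in
`L²`, because the projection on the column space of the stacked design has rank at most `p`
(`MixedDesign.ErrorModel.exists_residual_bound`). Hence `S` is within `O(n^{-1/2})` in `L²` of a sum
of independent variables, its variance is that of this sum up to `o(1)`, and Lyapunov's central
limit theorem gives `S / √var S → N(0, 1)` (`MixedDesign.FittedModel.tendstoInDistribution_normSum`).
Moments of order `4 + γ` make `max |Ẑ_i|` of order `o_P(√n)`, and a weak law of large numbers keeps
`V` away from zero. The factor `V / ν₁²` replaces `f(S) / V` by `f(S) / ν₁²`, which has the same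
limit as `f(S / √var S)`, as `f` is homogeneous of degree two.
-/

/-! ### Stochastic order symbols -/

section StochasticOrder

variable {Ω : Type*} [MeasurableSpace Ω] {P : Measure Ω}

/-- The events `A n` have probability tending to one; stated through (outer) measures of the
complements, so that no measurability is needed. -/
def WithHighProb (P : Measure Ω) (A : ℕ → Set Ω) : Prop :=
  Tendsto (fun n => P (A n)ᶜ) atTop (𝓝 0)

/-- `Y n = O_P(1)`. -/
def BddInProb (P : Measure Ω) (Y : ℕ → Ω → ℝ) : Prop :=
  ∀ ε : ENNReal, 0 < ε → ∃ K : ℝ, ∀ᶠ n in atTop, P {ω | K < |Y n ω|} ≤ ε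

/-- `Y n = o_P(1)`. -/
def NullInProb (P : Measure Ω) (Y : ℕ → Ω → ℝ) : Prop :=
  ∀ ε : ℝ, 0 < ε → Tendsto (fun n => P {ω | ε ≤ |Y n ω|}) atTop (𝓝 0)

lemma tendsto_measure_zero_of_le {A B : ℕ → Set Ω} (hB : Tendsto (fun n => P (B n)) atTop (𝓝 0))
    (h : ∀ᶠ n in atTop, A n ⊆ B n) : Tendsto (fun n => P (A n)) atTop (𝓝 0) :=
  tendsto_of_tendsto_of_tendsto_of_le_of_le' tendsto_const_nhds hB
    (Eventually.of_forall fun _ => zero_le) (h.mono fun _ hn => measure_mono hn)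

lemma tendsto_measure_zero_union {A B : ℕ → Set Ω} (hA : Tendsto (fun n => P (A n)) atTop (𝓝 0))
    (hB : Tendsto (fun n => P (B n)) atTop (𝓝 0)) :
    Tendsto (fun n => P (A n ∪ B n)) atTop (𝓝 0) :=
  tendsto_of_tendsto_of_tendsto_of_le_of_le tendsto_const_nhds
    (by simpa using hA.add hB) (fun _ => zero_le) (fun _ => measure_union_le _ _)

namespace WithHighProb

lemma mono {A B : ℕ → Set Ω} (hA : WithHighProb P A) (h : ∀ᶠ n in atTop, A n ⊆ B n) :
    WithHighProb P B :=
  tendsto_measure_zero_of_le hA (h.mono fun _ hn => Set.compl_subset_compl.2 hn)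

lemma inter {A B : ℕ → Set Ω} (hA : WithHighProb P A) (hB : WithHighProb P B) :
    WithHighProb P (fun n => A n ∩ B n) := by
  unfold WithHighProb
  simp only [Set.compl_inter]
  exact tendsto_measure_zero_union hA hB

lemma of_eventually {A : ℕ → Set Ω} (h : ∀ᶠ n in atTop, A n = Set.univ) : WithHighProb P A := by
  refine tendsto_measure_zero_of_le (B := fun _ => ∅) (by simp) ?_
  filter_upwards [h] with n hn
  simp [hn]

lemma tendsto_one [IsProbabilityMeasure P] {A : ℕ → Set Ω} (hA : WithHighProb P A) :
    Tendsto (fun n => P (A n)) atTop (𝓝 1) := by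
  have h1 : Tendsto (fun n => 1 - P (A n)ᶜ) atTop (𝓝 1) := by
    have := ENNReal.Tendsto.sub (tendsto_const_nhds (x := (1 : ENNReal)) (f := atTop (α := ℕ))) hA
      (Or.inl ENNReal.one_ne_top)
    simpa using this
  refine tendsto_of_tendsto_of_tendsto_of_le_of_le h1 tendsto_const_nhds ?_
    (fun _ => prob_le_one)
  intro n
  have : (1 : ENNReal) ≤ P (A n) + P (A n)ᶜ := by
    rw [← measure_univ (μ := P), ← Set.union_compl_self (A n)]
    exact measure_union_le _ _
  exact tsub_le_iff_right.2 this

end WithHighProb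

namespace NullInProb

lemma whp_lt {Y : ℕ → Ω → ℝ} (hY : NullInProb P Y) {ε : ℝ} (hε : 0 < ε) :
    WithHighProb P (fun n => {ω | |Y n ω| < ε}) := by
  refine tendsto_measure_zero_of_le (hY ε hε) (Eventually.of_forall fun n ω hω => ?_)
  simpa using hω

lemma of_le {X Y : ℕ → Ω → ℝ} {A : ℕ → Set Ω} (hY : NullInProb P Y) (hA : WithHighProb P A)
    (h : ∀ᶠ n in atTop, ∀ ω ∈ A n, |X n ω| ≤ |Y n ω|) : NullInProb P X := by
  intro ε hε
  refine tendsto_measure_zero_of_le (tendsto_measure_zero_union (hY ε hε) hA) ?_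
  filter_upwards [h] with n hn ω hω
  by_cases hωA : ω ∈ A n
  · exact Or.inl (le_trans (show ε ≤ |X n ω| from hω) (hn ω hωA))
  · exact Or.inr hωA

lemma of_abs_le {X Y : ℕ → Ω → ℝ} (hY : NullInProb P Y)
    (h : ∀ᶠ n in atTop, ∀ ω, |X n ω| ≤ |Y n ω|) : NullInProb P X :=
  hY.of_le (A := fun _ => Set.univ) (WithHighProb.of_eventually (by simp))
    (h.mono fun _ hn ω _ => hn ω)

lemma add {X Y : ℕ → Ω → ℝ} (hX : NullInProb P X) (hY : NullInProb P Y) :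
    NullInProb P (fun n ω => X n ω + Y n ω) := by
  intro ε hε
  refine tendsto_measure_zero_of_le
    (tendsto_measure_zero_union (hX (ε / 2) (half_pos hε)) (hY (ε / 2) (half_pos hε)))
    (Eventually.of_forall fun n ω hω => ?_)
  by_contra hcon
  simp only [Set.mem_union, Set.mem_ofPred_eq, not_or, not_le] at hcon hω
  linarith [abs_add_le (X n ω) (Y n ω)]

lemma bddInProb {Y : ℕ → Ω → ℝ} (hY : NullInProb P Y) : BddInProb P Y := by
  intro ε hε
  refine ⟨1, ?_⟩
  filter_upwards [(hY 1 one_pos).eventually (gt_mem_nhds hε)] with n hn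
  exact (measure_mono fun ω (hω : 1 < |Y n ω|) => hω.le).trans hn.le

lemma mul_bdd {X Y : ℕ → Ω → ℝ} (hX : NullInProb P X) (hY : BddInProb P Y) :
    NullInProb P (fun n ω => X n ω * Y n ω) := by
  intro ε hε
  rw [ENNReal.tendsto_nhds_zero]
  intro η hη
  obtain ⟨K, hK⟩ := hY (η / 2) (ENNReal.half_pos hη.ne')
  have hK' : 0 < ε / (|K| + 1) := by positivity
  filter_upwards [hK, (ENNReal.tendsto_nhds_zero.1 (hX _ hK')) (η / 2) (ENNReal.half_pos hη.ne')]
    with n h1 h2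
  calc P {ω | ε ≤ |X n ω * Y n ω|}
      ≤ P ({ω | ε / (|K| + 1) ≤ |X n ω|} ∪ {ω | K < |Y n ω|}) := by
        refine measure_mono fun ω hω => ?_
        by_contra hcon
        simp only [Set.mem_union, Set.mem_ofPred_eq, not_or, not_le, not_lt] at hcon hω
        have h3 : |Y n ω| < |K| + 1 := by linarith [le_abs_self K]
        have h4 : |X n ω| * |Y n ω| ≤ |X n ω| * (|K| + 1) := by gcongr
        have h5 : |X n ω| * (|K| + 1) < ε := (lt_div_iff₀ (by positivity)).1 hcon.1
        rw [abs_mul] at hω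
        linarith
    _ ≤ _ := measure_union_le _ _
    _ ≤ η / 2 + η / 2 := add_le_add h2 h1
    _ = η := ENNReal.add_halves η

lemma bdd_mul {X Y : ℕ → Ω → ℝ} (hX : BddInProb P X) (hY : NullInProb P Y) :
    NullInProb P (fun n ω => X n ω * Y n ω) := by
  simpa only [mul_comm] using hY.mul_bdd hX

lemma of_tendsto {a : ℕ → ℝ} (ha : Tendsto a atTop (𝓝 0)) :
    NullInProb P (fun n _ => a n) := by
  intro ε hε
  refine tendsto_measure_zero_of_le (B := fun _ => ∅) (by simp) ?_
  have := (tendsto_order.1 (by simpa using ha.abs)).2 ε hε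
  filter_upwards [this] with n hn ω hω
  exact absurd hn (not_lt.2 hω)

lemma sum {ι : Type*} (s : Finset ι) {X : ι → ℕ → Ω → ℝ} (h : ∀ i ∈ s, NullInProb P (X i)) :
    NullInProb P (fun n ω => ∑ i ∈ s, X i n ω) := by
  classical
  induction s using Finset.induction_on with
  | empty => simpa using of_tendsto (P := P) (tendsto_const_nhds (x := (0 : ℝ)))
  | insert a s ha ih =>
    simp only [Finset.sum_insert ha]
    exact (h a (Finset.mem_insert_self a s)).add
      (ih fun i hi => h i (Finset.mem_insert_of_mem hi))

lemma tendstoInMeasure {Y : ℕ → Ω → ℝ} (h : NullInProb P Y) :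
    TendstoInMeasure P Y atTop (fun _ => 0) := by
  rw [tendstoInMeasure_iff_norm]
  simpa [NullInProb] using h

lemma of_tendstoInMeasure {Y : ℕ → Ω → ℝ} (h : TendstoInMeasure P Y atTop (fun _ => 0)) :
    NullInProb P Y := by
  rw [tendstoInMeasure_iff_norm] at h
  simpa [NullInProb] using h

end NullInProb

namespace BddInProb

lemma of_le {X Y : ℕ → Ω → ℝ} {A : ℕ → Set Ω} (hY : BddInProb P Y) (hA : WithHighProb P A)
    (h : ∀ᶠ n in atTop, ∀ ω ∈ A n, |X n ω| ≤ |Y n ω|) : BddInProb P X := by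
  intro ε hε
  obtain ⟨K, hK⟩ := hY (ε / 2) (ENNReal.half_pos hε.ne')
  refine ⟨K, ?_⟩
  filter_upwards [hK, h, (ENNReal.tendsto_nhds_zero.1 hA) (ε / 2) (ENNReal.half_pos hε.ne')]
    with n h1 h2 h3
  calc P {ω | K < |X n ω|} ≤ P ({ω | K < |Y n ω|} ∪ (A n)ᶜ) := by
        refine measure_mono fun ω hω => ?_
        by_cases hωA : ω ∈ A n
        · exact Or.inl (lt_of_lt_of_le (show K < |X n ω| from hω) (h2 ω hωA))
        · exact Or.inr hωA
    _ ≤ _ := measure_union_le _ _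
    _ ≤ ε / 2 + ε / 2 := add_le_add h1 h3
    _ = ε := ENNReal.add_halves ε

lemma of_abs_le {X Y : ℕ → Ω → ℝ} (hY : BddInProb P Y)
    (h : ∀ᶠ n in atTop, ∀ ω, |X n ω| ≤ |Y n ω|) : BddInProb P X :=
  hY.of_le (A := fun _ => Set.univ) (WithHighProb.of_eventually (by simp))
    (h.mono fun _ hn ω _ => hn ω)

lemma const (C : ℝ) : BddInProb P (fun _ _ => C : ℕ → Ω → ℝ) := by
  intro ε _
  exact ⟨|C|, by simp⟩

lemma add {X Y : ℕ → Ω → ℝ} (hX : BddInProb P X) (hY : BddInProb P Y) :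
    BddInProb P (fun n ω => X n ω + Y n ω) := by
  intro ε hε
  obtain ⟨K, hK⟩ := hX (ε / 2) (ENNReal.half_pos hε.ne')
  obtain ⟨L, hL⟩ := hY (ε / 2) (ENNReal.half_pos hε.ne')
  refine ⟨K + L, ?_⟩
  filter_upwards [hK, hL] with n h1 h2
  calc P {ω | K + L < |X n ω + Y n ω|} ≤ P ({ω | K < |X n ω|} ∪ {ω | L < |Y n ω|}) := by
        refine measure_mono fun ω hω => ?_
        by_contra hcon
        simp only [Set.mem_union, Set.mem_ofPred_eq, not_or, not_lt] at hcon hω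
        linarith [abs_add_le (X n ω) (Y n ω)]
    _ ≤ _ := measure_union_le _ _
    _ ≤ ε / 2 + ε / 2 := add_le_add h1 h2
    _ = ε := ENNReal.add_halves ε

lemma mul {X Y : ℕ → Ω → ℝ} (hX : BddInProb P X) (hY : BddInProb P Y) :
    BddInProb P (fun n ω => X n ω * Y n ω) := by
  intro ε hε
  obtain ⟨K, hK⟩ := hX (ε / 2) (ENNReal.half_pos hε.ne')
  obtain ⟨L, hL⟩ := hY (ε / 2) (ENNReal.half_pos hε.ne')
  refine ⟨|K| * |L|, ?_⟩
  filter_upwards [hK, hL] with n h1 h2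
  calc P {ω | |K| * |L| < |X n ω * Y n ω|} ≤ P ({ω | K < |X n ω|} ∪ {ω | L < |Y n ω|}) := by
        refine measure_mono fun ω hω => ?_
        by_contra hcon
        simp only [Set.mem_union, Set.mem_ofPred_eq, not_or, not_lt] at hcon hω
        rw [abs_mul] at hω
        have : |X n ω| * |Y n ω| ≤ |K| * |L| :=
          mul_le_mul (hcon.1.trans (le_abs_self K)) (hcon.2.trans (le_abs_self L))
            (abs_nonneg _) (abs_nonneg _)
        linarith
    _ ≤ _ := measure_union_le _ _
    _ ≤ ε / 2 + ε / 2 := add_le_add h1 h2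
    _ = ε := ENNReal.add_halves ε

lemma sum {ι : Type*} (s : Finset ι) {X : ι → ℕ → Ω → ℝ} (h : ∀ i ∈ s, BddInProb P (X i)) :
    BddInProb P (fun n ω => ∑ i ∈ s, X i n ω) := by
  classical
  induction s using Finset.induction_on with
  | empty => simpa using const (P := P) 0
  | insert a s ha ih =>
    simp only [Finset.sum_insert ha]
    exact (h a (Finset.mem_insert_self a s)).add
      (ih fun i hi => h i (Finset.mem_insert_of_mem hi))

end BddInProb

/-- Markov's inequality in the form used throughout. -/
lemma measure_le_of_integral_le {Y : Ω → ℝ} (hY : Integrable Y P) (h0 : ∀ ω, 0 ≤ Y ω) {K c : ℝ}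
    (hK : ∫ ω, Y ω ∂P ≤ K) (hc : 0 < c) : P {ω | c ≤ Y ω} ≤ ENNReal.ofReal (K / c) := by
  have h1 := meas_ge_le_lintegral_div (μ := P) (f := fun ω => ENNReal.ofReal (Y ω))
    hY.aestronglyMeasurable.aemeasurable.ennreal_ofReal (ε := ENNReal.ofReal c)
    (by simpa using hc) ENNReal.ofReal_ne_top
  rw [← ofReal_integral_eq_lintegral_ofReal hY (Eventually.of_forall h0),
    ← ENNReal.ofReal_div_of_pos hc] at h1
  calc P {ω | c ≤ Y ω} ≤ P {ω | ENNReal.ofReal c ≤ ENNReal.ofReal (Y ω)} :=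
        measure_mono fun ω hω => ENNReal.ofReal_le_ofReal hω
    _ ≤ _ := h1
    _ ≤ _ := by gcongr

lemma BddInProb.of_integral_le {Y : ℕ → Ω → ℝ} {K : ℝ}
    (h : ∀ᶠ n in atTop, Integrable (Y n) P ∧ ∫ ω, Y n ω ∂P ≤ K) (h0 : ∀ n ω, 0 ≤ Y n ω) :
    BddInProb P Y := by
  intro ε hε
  obtain ⟨c, hc, hc'⟩ : ∃ c : ℝ, 0 < c ∧ ENNReal.ofReal (K / c) ≤ ε := by
    have h1 : Tendsto (fun c : ℝ => ENNReal.ofReal (K / c)) atTop (𝓝 0) := by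
      have := (tendsto_const_nhds (x := K)).div_atTop (tendsto_id (α := ℝ) (x := atTop))
      simpa using ENNReal.tendsto_ofReal this
    obtain ⟨c, h2, h3⟩ := ((ENNReal.tendsto_nhds_zero.1 h1 ε hε).and (eventually_gt_atTop 0)).exists
    exact ⟨c, h3, h2⟩
  refine ⟨c, ?_⟩
  filter_upwards [h] with n hn
  refine le_trans (measure_mono fun ω hω => ?_)
    ((measure_le_of_integral_le hn.1 (h0 n) hn.2 hc).trans hc')
  have : c < |Y n ω| := hω
  rw [abs_of_nonneg (h0 n ω)] at this
  exact this.le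

lemma NullInProb.of_integral_le {Y : ℕ → Ω → ℝ} {a : ℕ → ℝ} (ha : Tendsto a atTop (𝓝 0))
    (h : ∀ᶠ n in atTop, Integrable (Y n) P ∧ ∫ ω, Y n ω ∂P ≤ a n) (h0 : ∀ n ω, 0 ≤ Y n ω) :
    NullInProb P Y := by
  intro ε hε
  have h1 : Tendsto (fun n => ENNReal.ofReal (a n / ε)) atTop (𝓝 0) := by
    simpa using ENNReal.tendsto_ofReal (ha.div_const ε)
  refine tendsto_of_tendsto_of_tendsto_of_le_of_le' tendsto_const_nhds h1
    (Eventually.of_forall fun _ => zero_le) ?_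
  filter_upwards [h] with n hn
  simp only [abs_of_nonneg (h0 n _)]
  exact measure_le_of_integral_le hn.1 (h0 n) hn.2 hε

/-- `Y² = O_P(1)` implies `Y = O_P(1)`. -/
lemma BddInProb.of_sq {Y : ℕ → Ω → ℝ} (h : BddInProb P (fun n ω => Y n ω ^ 2)) :
    BddInProb P Y := by
  refine (h.add (const 1)).of_abs_le (Eventually.of_forall fun n ω => ?_)
  have h1 : |Y n ω| ≤ Y n ω ^ 2 + 1 := by
    rw [← sq_abs]
    nlinarith [sq_nonneg (|Y n ω| - 1), abs_nonneg (Y n ω)]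
  exact h1.trans (le_abs_self _)

/-- `Y² = o_P(1)` implies `Y = o_P(1)`. -/
lemma NullInProb.of_sq {Y : ℕ → Ω → ℝ} (h : NullInProb P (fun n ω => Y n ω ^ 2)) :
    NullInProb P Y := by
  intro ε hε
  refine tendsto_measure_zero_of_le (h (ε ^ 2) (by positivity))
    (Eventually.of_forall fun n ω hω => ?_)
  have hω' : ε ≤ |Y n ω| := hω
  simp only [Set.mem_ofPred_eq, abs_pow]
  gcongr

end StochasticOrder

/-! ### Deterministic bounds on the empirical likelihood -/

namespace MixedDesign

variable {n : ℕ}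

/-- The weights over which the empirical likelihood is maximized. -/
def FeasibleWeights (z w : Fin n → ℝ) : Prop :=
  (∀ i, 0 ≤ w i) ∧ ∑ i, w i = 1 ∧ ∑ i, w i * z i = 0

lemma FeasibleWeights.pos {z w : Fin n → ℝ} (hw : FeasibleWeights z w) : 0 < n := by
  rcases Nat.eq_zero_or_pos n with rfl | h
  · simpa using hw.2.1
  · exact h

/-- Weak duality: every multiplier `l` bounds the likelihood of feasible weights, because
`t ≤ exp (t - 1)` for `t = n w_i (1 + l z_i)`. -/
lemma FeasibleWeights.prod_mul_le {z w : Fin n → ℝ} (hw : FeasibleWeights z w) (l : ℝ)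
    (hl : ∀ i, 0 ≤ 1 + l * z i) : (n : ℝ) ^ n * (∏ i, w i) * ∏ i, (1 + l * z i) ≤ 1 := by
  have h1 : (n : ℝ) ^ n * (∏ i, w i) * ∏ i, (1 + l * z i) = ∏ i, (n * w i * (1 + l * z i)) := by
    simp [Finset.prod_mul_distrib]
  have h2 : ∑ i, (n * w i * (1 + l * z i) - 1) = 0 := by
    have : ∀ i, n * w i * (1 + l * z i) - 1 = n * w i + n * l * (w i * z i) - 1 := fun i => by ring
    simp only [this, Finset.sum_sub_distrib, Finset.sum_add_distrib, ← Finset.mul_sum, hw.2.1,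
      hw.2.2]
    simp
  calc (n : ℝ) ^ n * (∏ i, w i) * ∏ i, (1 + l * z i) = ∏ i, (n * w i * (1 + l * z i)) := h1
    _ ≤ ∏ i, Real.exp (n * w i * (1 + l * z i) - 1) := by
        refine Finset.prod_le_prod (fun i _ => ?_) fun i _ => ?_
        · exact mul_nonneg (mul_nonneg n.cast_nonneg (hw.1 i)) (hl i)
        · linarith [Real.add_one_le_exp (n * w i * (1 + l * z i) - 1)]
    _ = 1 := by rw [← Real.exp_sum, h2, Real.exp_zero]

lemma FeasibleWeights.prod_le {z w : Fin n → ℝ} (hw : FeasibleWeights z w) :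
    ∏ i, w i ≤ ((n : ℝ) ^ n)⁻¹ := by
  have h := hw.prod_mul_le 0 (by simp)
  have hn : (0 : ℝ) < (n : ℝ) ^ n := pow_pos (by exact_mod_cast hw.pos) n
  simp only [zero_mul, add_zero, Finset.prod_const_one, mul_one] at h
  rwa [← one_div, le_div_iff₀ hn, mul_comm]

lemma empLik_eq (z : Fin n → ℝ) :
    empLik z = sSup {l | ∃ w, FeasibleWeights z w ∧ l = ∏ i, w i} := by
  simp only [empLik, FeasibleWeights, and_assoc]

lemma bddAbove_feasible (z : Fin n → ℝ) :
    BddAbove {l | ∃ w, FeasibleWeights z w ∧ l = ∏ i, w i} :=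
  ⟨_, by rintro _ ⟨w, hw, rfl⟩; exact hw.prod_le⟩

lemma empLik_nonneg (z : Fin n → ℝ) : 0 ≤ empLik z := by
  rw [empLik_eq]
  refine Real.sSup_nonneg ?_
  rintro _ ⟨w, hw, rfl⟩
  exact Finset.prod_nonneg fun i _ => hw.1 i

lemma empLik_le_of_forall {z : Fin n → ℝ} {C : ℝ} (hC : 0 ≤ C)
    (h : ∀ w, FeasibleWeights z w → ∏ i, w i ≤ C) : empLik z ≤ C := by
  rw [empLik_eq]
  refine Real.sSup_le ?_ hC
  rintro _ ⟨w, hw, rfl⟩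
  exact h w hw

lemma FeasibleWeights.prod_le_empLik {z w : Fin n → ℝ} (hw : FeasibleWeights z w) :
    ∏ i, w i ≤ empLik z := by
  rw [empLik_eq]
  exact le_csSup (bddAbove_feasible z) ⟨w, hw, rfl⟩

lemma empLik_le (z : Fin n → ℝ) : empLik z ≤ ((n : ℝ) ^ n)⁻¹ :=
  empLik_le_of_forall (by positivity) fun _ hw => hw.prod_le

lemma bddAbove_image_empLik {α : Type*} (z : α → Fin n → ℝ) (s : Set α) :
    BddAbove ((fun θ => empLik (z θ)) '' s) :=
  ⟨_, by rintro _ ⟨θ, _, rfl⟩; exact empLik_le _⟩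

lemma empLik_of_sum_eq_zero (hn : 0 < n) {z : Fin n → ℝ} (hz : ∑ i, z i = 0) :
    empLik z = ((n : ℝ) ^ n)⁻¹ := by
  refine le_antisymm (empLik_le z) ?_
  have hn' : (n : ℝ) ≠ 0 := by exact_mod_cast hn.ne'
  have hw : FeasibleWeights z fun _ => (n : ℝ)⁻¹ := by
    refine ⟨fun _ => by positivity, by simp [hn'], ?_⟩
    rw [← Finset.mul_sum, hz, mul_zero]
  simpa using hw.prod_le_empLik

/-- The unrestricted maximum `n⁻ⁿ` is reached when some admissible parameter centres the
estimating functions. -/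
lemma sSup_empLik_of_exists (hn : 0 < n) {z : ℝ → Fin n → ℝ} {θ : ℝ} (hθ : 0 ≤ θ)
    (hz : ∑ i, z θ i = 0) :
    sSup ((fun θ => empLik (z θ)) '' Set.Ici 0) = ((n : ℝ) ^ n)⁻¹ := by
  refine le_antisymm (csSup_le ⟨_, θ, hθ, rfl⟩ ?_) ?_
  · rintro _ ⟨θ, _, rfl⟩
    exact empLik_le _
  · exact le_csSup (bddAbove_image_empLik z _) ⟨θ, hθ, empLik_of_sum_eq_zero hn hz⟩

/-- Mixing weights with the uniform weights increases their product. -/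
lemma prod_le_prod_mix_uniform {w : Fin n → ℝ} (hw0 : ∀ i, 0 ≤ w i)
    (hw : ∏ i, w i ≤ ((n : ℝ) ^ n)⁻¹) {t : ℝ} (ht0 : 0 ≤ t) (ht1 : t ≤ 1) :
    ∏ i, w i ≤ ∏ i, ((1 - t) * w i + t * (n : ℝ)⁻¹) := by
  have hP : 0 ≤ ∏ i, w i := Finset.prod_nonneg fun i _ => hw0 i
  calc ∏ i, w i = (∏ i, w i) ^ (1 - t) * (∏ i, w i) ^ t := by
        rw [← Real.rpow_add' hP (by simp)]
        simp
    _ ≤ (∏ i, w i) ^ (1 - t) * (((n : ℝ) ^ n)⁻¹) ^ t := by gcongr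
    _ = ∏ i, (w i ^ (1 - t) * ((n : ℝ)⁻¹) ^ t) := by
        rw [Finset.prod_mul_distrib, Real.finsetProd_rpow _ _ (fun i _ => hw0 i),
          Real.finsetProd_rpow _ _ (fun i _ => by positivity)]
        simp
    _ ≤ _ := by
        refine Finset.prod_le_prod (fun i _ => ?_) fun i _ => ?_
        · exact mul_nonneg (Real.rpow_nonneg (hw0 i) _) (Real.rpow_nonneg (by positivity) _)
        · exact Real.geom_mean_le_arith_mean2_weighted (by linarith) ht0 (hw0 i) (by positivity)
            (by ring)

/-- If the estimating functions have negative mean at the boundary point `0`, then the likelihood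
over the half-line is maximal there. -/
lemma sSup_empLik_of_sum_neg {a b : Fin n → ℝ} (ha : ∑ i, a i < 0) (hb : ∀ i, 0 ≤ b i) :
    sSup ((fun θ : ℝ => empLik (fun i => a i - θ * b i)) '' Set.Ici 0) = empLik a := by
  refine le_antisymm (csSup_le ⟨_, 0, Set.self_mem_Ici, rfl⟩ ?_) ?_
  · rintro _ ⟨θ, hθ, rfl⟩
    refine empLik_le_of_forall (empLik_nonneg a) fun w hw => ?_
    have hn : (0 : ℝ) < n := by exact_mod_cast hw.pos
    have hA : 0 ≤ ∑ i, w i * a i := by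
      have h1 : ∑ i, w i * a i = θ * ∑ i, w i * b i := by
        have h2 := hw.2.2
        simp only [mul_sub, Finset.sum_sub_distrib] at h2
        rw [Finset.mul_sum]
        rw [sub_eq_zero] at h2
        rw [h2]
        exact Finset.sum_congr rfl fun i _ => by ring
      rw [h1]
      exact mul_nonneg hθ (Finset.sum_nonneg fun i _ => mul_nonneg (hw.1 i) (hb i))
    set A := ∑ i, w i * a i with hAdef
    set B := -((n : ℝ)⁻¹ * ∑ i, a i) with hBdef
    have hB : 0 < B := by
      have : 0 < (n : ℝ)⁻¹ * -∑ i, a i := mul_pos (inv_pos.2 hn) (by linarith)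
      rw [hBdef]; linarith
    -- the mixture that puts the mean of `a` back to zero
    have ht0 : 0 ≤ A / (A + B) := by positivity
    have ht1 : A / (A + B) ≤ 1 := div_le_one_of_le₀ (by linarith) (by linarith)
    refine (prod_le_prod_mix_uniform hw.1 hw.prod_le ht0 ht1).trans
      (FeasibleWeights.prod_le_empLik ⟨fun i => ?_, ?_, ?_⟩)
    · exact add_nonneg (mul_nonneg (by linarith) (hw.1 i)) (by positivity)
    · rw [Finset.sum_add_distrib, ← Finset.mul_sum, hw.2.1]
      simp only [Finset.sum_const, Finset.card_univ, Fintype.card_fin, nsmul_eq_mul]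
      field_simp
      ring
    · have h3 : ∀ i, ((1 - A / (A + B)) * w i + A / (A + B) * (n : ℝ)⁻¹) * a i
          = (1 - A / (A + B)) * (w i * a i) + A / (A + B) * ((n : ℝ)⁻¹ * a i) := fun i => by ring
      simp only [h3, Finset.sum_add_distrib, ← Finset.mul_sum]
      rw [← hAdef, show (n : ℝ)⁻¹ * ∑ i, a i = -B by rw [hBdef, neg_neg]]
      have : A + B ≠ 0 := by positivity
      field_simp
      ring
  · exact le_csSup (bddAbove_image_empLik _ _) ⟨0, Set.self_mem_Ici, by simp⟩

/-- Second-order Taylor bound for the logarithm. -/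
lemma log_one_add_ge {x : ℝ} (hx : |x| ≤ 1 / 2) :
    x - x ^ 2 / 2 - 2 * |x| ^ 3 ≤ Real.log (1 + x) := by
  have h := Real.abs_log_sub_add_sum_range_le (x := -x) (by rw [abs_neg]; linarith) 2
  simp only [Finset.sum_range_succ, Finset.sum_range_zero, abs_neg] at h
  norm_num at h
  have h2 : |x| ^ 3 / (1 - |x|) ≤ 2 * |x| ^ 3 := by
    rw [div_le_iff₀ (by linarith)]
    nlinarith [pow_nonneg (abs_nonneg x) 3]
  have h3 := (abs_le.1 (h.trans h2)).1
  linarith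

lemma exp_sum_le_prod_one_add {x : Fin n → ℝ} {ρ : ℝ} (hρ : ρ ≤ 1 / 2) (hx : ∀ i, |x i| ≤ ρ) :
    Real.exp (∑ i, x i - (1 / 2 + 2 * ρ) * ∑ i, x i ^ 2) ≤ ∏ i, (1 + x i) := by
  have hpos : ∀ i, 0 < 1 + x i := fun i => by linarith [(abs_le.1 (hx i)).1]
  have : ∏ i, (1 + x i) = Real.exp (∑ i, Real.log (1 + x i)) := by
    rw [Real.exp_sum]
    exact Finset.prod_congr rfl fun i _ => (Real.exp_log (hpos i)).symm
  rw [this, Real.exp_le_exp, Finset.mul_sum, ← Finset.sum_sub_distrib]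
  refine Finset.sum_le_sum fun i _ => ?_
  have h1 := log_one_add_ge ((hx i).trans hρ)
  have h2 : |x i| ^ 3 ≤ ρ * x i ^ 2 := by
    rw [pow_succ', sq_abs]
    exact mul_le_mul_of_nonneg_right (hx i) (sq_nonneg _)
  linarith

/-- Upper half of the quadratic approximation: weak duality with the approximate multiplier
`S / (V √n)`. -/
lemma pow_mul_empLik_le {n : ℕ} (hn : 0 < n) {z : Fin n → ℝ} {M S V : ℝ}
    (hS : S = (√(n : ℝ))⁻¹ * ∑ i, z i) (hV : V = (n : ℝ)⁻¹ * ∑ i, z i ^ 2) (hVpos : 0 < V)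
    (hM : ∀ i, |z i| ≤ M * √n) (hMS : M * |S| ≤ V / 8) :
    (n : ℝ) ^ n * empLik z ≤ Real.exp (-((1 / 2 - 2 * (M * |S| / V)) * (S ^ 2 / V))) := by
  have hn0 : (0 : ℝ) < n := by exact_mod_cast hn
  have hs : 0 < √(n : ℝ) := Real.sqrt_pos.2 hn0
  have hs2 : √(n : ℝ) ^ 2 = n := Real.sq_sqrt hn0.le
  have hnn : (0 : ℝ) < (n : ℝ) ^ n := pow_pos hn0 n
  set s := √(n : ℝ)
  have hz1 : ∑ i, z i = s * S := by rw [hS, mul_inv_cancel_left₀ hs.ne']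
  have hz2 : ∑ i, z i ^ 2 = n * V := by rw [hV, mul_inv_cancel_left₀ hn0.ne']
  have hM0 : 0 ≤ M := by
    have := (abs_nonneg _).trans (hM ⟨0, hn⟩)
    exact nonneg_of_mul_nonneg_left this hs
  set ρ := M * |S| / V with hρdef
  have hρV : ρ * V = M * |S| := div_mul_cancel₀ _ hVpos.ne'
  have hρ0 : 0 ≤ ρ := by positivity
  have hρ1 : ρ ≤ 1 / 8 := by rw [hρdef, div_le_iff₀ hVpos]; linarith
  set T := S ^ 2 / V with hTdef
  have hT0 : 0 ≤ T := by positivity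
  have hx : ∀ i, |S / (V * s) * z i| ≤ ρ := fun i => by
    rw [abs_mul, abs_div, abs_of_pos (mul_pos hVpos hs)]
    calc |S| / (V * s) * |z i| ≤ |S| / (V * s) * (M * s) := by gcongr; exact hM i
      _ = ρ := by rw [hρdef]; field_simp
  have h1 := exp_sum_le_prod_one_add (by linarith) hx
  have h2 : ∑ i, S / (V * s) * z i = T := by
    rw [← Finset.mul_sum, hz1, hTdef]; field_simp
  have h3 : ∑ i, (S / (V * s) * z i) ^ 2 = T := by
    simp only [mul_pow]
    rw [← Finset.mul_sum, hz2, hTdef, ← hs2]; field_simp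
  rw [h2, h3] at h1
  rw [Real.exp_neg, mul_comm, ← le_div_iff₀ hnn]
  refine empLik_le_of_forall (by positivity) fun w hw => ?_
  rw [le_div_iff₀ hnn, ← one_div, le_div_iff₀ (Real.exp_pos _)]
  have h4 := hw.prod_mul_le (S / (V * s)) fun i => by linarith [(abs_le.1 (hx i)).1]
  refine le_trans ?_ h4
  rw [mul_comm (∏ i, w i)]
  refine mul_le_mul_of_nonneg_left ?_ (mul_nonneg hnn.le (Finset.prod_nonneg fun i _ => hw.1 i))
  refine le_trans (le_of_eq ?_) h1
  ring_nf

/-- Lower half of the quadratic approximation: the explicit weights `(1 - l (z_i - m)) / n`, where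
`m` is the mean of the `z_i` and `l` is `m` divided by their variance, are feasible. -/
lemma le_pow_mul_empLik {n : ℕ} (hn : 0 < n) {z : Fin n → ℝ} {M S V : ℝ}
    (hS : S = (√(n : ℝ))⁻¹ * ∑ i, z i) (hV : V = (n : ℝ)⁻¹ * ∑ i, z i ^ 2) (hVpos : 0 < V)
    (hM : ∀ i, |z i| ≤ M * √n) (hMS : M * |S| ≤ V / 8) :
    Real.exp (-((1 / 2 + 8 * (M * |S| / V)) * (S ^ 2 / V))) ≤ (n : ℝ) ^ n * empLik z := by
  have hn0 : (0 : ℝ) < n := by exact_mod_cast hn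
  have hs : 0 < √(n : ℝ) := Real.sqrt_pos.2 hn0
  have hs2 : √(n : ℝ) ^ 2 = n := Real.sq_sqrt hn0.le
  have hnn : (0 : ℝ) < (n : ℝ) ^ n := pow_pos hn0 n
  set s := √(n : ℝ)
  have hz1 : ∑ i, z i = s * S := by rw [hS, mul_inv_cancel_left₀ hs.ne']
  have hz2 : ∑ i, z i ^ 2 = n * V := by rw [hV, mul_inv_cancel_left₀ hn0.ne']
  have hM0 : 0 ≤ M := by
    have := (abs_nonneg _).trans (hM ⟨0, hn⟩)
    exact nonneg_of_mul_nonneg_left this hs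
  set ρ := M * |S| / V with hρdef
  have hρV : ρ * V = M * |S| := div_mul_cancel₀ _ hVpos.ne'
  have hρ0 : 0 ≤ ρ := by positivity
  have hρ1 : ρ ≤ 1 / 8 := by rw [hρdef, div_le_iff₀ hVpos]; linarith
  set T := S ^ 2 / V with hTdef
  have hT0 : 0 ≤ T := by positivity
  set m := S / s with hmdef
  have hms : m * s = S := div_mul_cancel₀ _ hs.ne'
  have hm : |m| ≤ M * s := by
    have h1 : |∑ i, z i| ≤ n * (M * s) :=
      (Finset.abs_sum_le_sum_abs _ _).trans ((Finset.sum_le_sum fun i _ => hM i).trans (by simp))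
    rw [hz1, ← hms, abs_mul, abs_mul, abs_of_pos hs, ← hs2] at h1
    have h2 : s ^ 2 * |m| ≤ s ^ 2 * (M * s) := by linarith
    exact le_of_mul_le_mul_left h2 (by positivity)
  have hm2 : m ^ 2 ≤ ρ * V := by
    rw [hρV, ← hms, abs_mul, abs_of_pos hs, ← sq_abs, pow_two]
    nlinarith [abs_nonneg m]
  set σ := V - m ^ 2 with hσdef
  have hσ : (1 - ρ) * V ≤ σ := by linarith
  have hσ1 : 7 / 8 * V ≤ σ := le_trans (by gcongr; linarith) hσ
  have hσ0 : 0 < σ := by linarith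
  have hy : ∀ i, |-(m / σ) * (z i - m)| ≤ 3 * ρ := fun i => by
    rw [abs_mul, abs_neg, abs_div, abs_of_pos hσ0, div_mul_eq_mul_div, div_le_iff₀ hσ0]
    have h1 : |z i - m| ≤ 2 * (M * s) := by
      have := abs_sub (z i) m
      linarith [hM i]
    calc |m| * |z i - m| ≤ |m| * (2 * (M * s)) := by gcongr
      _ = 2 * (ρ * V) := by rw [hρV, ← hms, abs_mul, abs_of_pos hs]; ring
      _ ≤ 3 * ρ * σ := by nlinarith
  have h1 := exp_sum_le_prod_one_add (by linarith) hy
  have h2 : ∑ i, -(m / σ) * (z i - m) = 0 := by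
    rw [← Finset.mul_sum, Finset.sum_sub_distrib, hz1, ← hms]
    simp only [Finset.sum_const, Finset.card_univ, Fintype.card_fin, nsmul_eq_mul]
    rw [← hs2]; ring
  have h3 : ∑ i, (-(m / σ) * (z i - m)) ^ 2 = S ^ 2 / σ := by
    have : ∀ i, (-(m / σ) * (z i - m)) ^ 2
        = (m / σ) ^ 2 * (z i ^ 2 - 2 * m * z i + m ^ 2) := fun i => by ring
    simp only [this]
    rw [← Finset.mul_sum, Finset.sum_add_distrib, Finset.sum_sub_distrib, ← Finset.mul_sum, hz1,
      hz2, ← hms]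
    simp only [Finset.sum_const, Finset.card_univ, Fintype.card_fin, nsmul_eq_mul]
    rw [← hs2]
    have : s ^ 2 * V - 2 * m * (s * (m * s)) + s ^ 2 * m ^ 2 = s ^ 2 * σ := by rw [hσdef]; ring
    rw [this]
    field_simp
  rw [h2, h3] at h1
  have hw : FeasibleWeights z fun i => (n : ℝ)⁻¹ * (1 + -(m / σ) * (z i - m)) := by
    refine ⟨fun i => ?_, ?_, ?_⟩
    · exact mul_nonneg (by positivity) (by linarith [(abs_le.1 (hy i)).1])
    · rw [← Finset.mul_sum, Finset.sum_add_distrib, h2]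
      simp [hn0.ne']
    · have : ∀ i, (n : ℝ)⁻¹ * (1 + -(m / σ) * (z i - m)) * z i
          = (n : ℝ)⁻¹ * (z i - m / σ * (z i ^ 2 - m * z i)) := fun i => by ring
      simp only [this]
      rw [← Finset.mul_sum, Finset.sum_sub_distrib, ← Finset.mul_sum, Finset.sum_sub_distrib,
        ← Finset.mul_sum, hz1, hz2, ← hms, ← hs2]
      have : s ^ 2 * V - m * (s * (m * s)) = s ^ 2 * σ := by rw [hσdef]; ring
      rw [this]
      field_simp
      ring
  have h4 := hw.prod_le_empLik
  rw [Finset.prod_mul_distrib] at h4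
  simp only [Finset.prod_const, Finset.card_univ, Fintype.card_fin, inv_pow] at h4
  rw [inv_mul_le_iff₀ hnn] at h4
  refine le_trans ?_ (h1.trans h4)
  rw [Real.exp_le_exp]
  have h5 : S ^ 2 / σ ≤ (1 + 8 / 7 * ρ) * T := by
    have : S ^ 2 = T * V := (div_mul_cancel₀ _ hVpos.ne').symm
    rw [div_le_iff₀ hσ0, this]
    have h6 : V ≤ (1 + 8 / 7 * ρ) * σ := by nlinarith
    calc T * V ≤ T * ((1 + 8 / 7 * ρ) * σ) := by gcongr
      _ = _ := by ring
  have h6 : (1 / 2 + 2 * (3 * ρ)) * (S ^ 2 / σ) ≤ (1 / 2 + 8 * ρ) * T := by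
    calc (1 / 2 + 2 * (3 * ρ)) * (S ^ 2 / σ)
        ≤ (1 / 2 + 2 * (3 * ρ)) * ((1 + 8 / 7 * ρ) * T) := by gcongr
      _ = ((1 / 2 + 2 * (3 * ρ)) * (1 + 8 / 7 * ρ)) * T := by ring
      _ ≤ _ := by
        refine mul_le_mul_of_nonneg_right ?_ hT0
        nlinarith
  linarith

/-- The empirical log-likelihood ratio of the constraint `∑ p_i z_i = 0` is quadratic up to an
explicit error. -/
theorem empLik_quadratic_bound {n : ℕ} (hn : 0 < n) {z : Fin n → ℝ} {M S V : ℝ}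
    (hS : S = (√(n : ℝ))⁻¹ * ∑ i, z i) (hV : V = (n : ℝ)⁻¹ * ∑ i, z i ^ 2) (hVpos : 0 < V)
    (hM : ∀ i, |z i| ≤ M * √n) (hMS : M * |S| ≤ V / 8) :
    0 < empLik z ∧
      |-2 * Real.log (empLik z / ((n : ℝ) ^ n)⁻¹) - S ^ 2 / V|
        ≤ 16 * (M * |S| / V) * (S ^ 2 / V) := by
  have hupper := pow_mul_empLik_le hn hS hV hVpos hM hMS
  have hlower := le_pow_mul_empLik hn hS hV hVpos hM hMS
  have hnn : (0 : ℝ) < (n : ℝ) ^ n := pow_pos (by exact_mod_cast hn) n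
  have hM0 : 0 ≤ M := nonneg_of_mul_nonneg_left ((abs_nonneg _).trans (hM ⟨0, hn⟩))
    (Real.sqrt_pos.2 (by exact_mod_cast hn))
  have hρT : 0 ≤ (M * |S| / V) * (S ^ 2 / V) := by positivity
  have hpos : 0 < empLik z := pos_of_mul_pos_right (lt_of_lt_of_le (Real.exp_pos _) hlower) hnn.le
  refine ⟨hpos, ?_⟩
  rw [div_inv_eq_mul, mul_comm (empLik z)]
  have hp : 0 < (n : ℝ) ^ n * empLik z := mul_pos hnn hpos
  have h1 := (Real.log_le_iff_le_exp hp).2 hupper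
  have h2 := (Real.le_log_iff_exp_le hp).2 hlower
  rw [abs_le]
  constructor <;> linarith

end MixedDesign

/-! ### Measurability of the likelihood ratio -/

namespace MixedDesign

/-- The superlevel sets of the profile likelihood are countable unions of projections of closed
sets along compact sets of parameters and weights, hence countable unions of closed sets. -/
lemma measurable_sSup_empLik {n : ℕ} (b : Fin n → ℝ) :
    Measurable fun a : Fin n → ℝ =>
      sSup ((fun θ : ℝ => empLik (fun i => a i - θ * b i)) '' Set.Ici 0) := by
  refine measurable_of_Ioi fun c => ?_
  rcases lt_or_ge c 0 with hc | hc
  · convert MeasurableSet.univ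
    ext a
    simp only [Set.mem_preimage, Set.mem_Ioi, Set.mem_univ, iff_true]
    refine hc.trans_le (Real.sSup_nonneg ?_)
    rintro _ ⟨θ, _, rfl⟩
    exact empLik_nonneg _
  · let K : ℕ → ℕ → Set (ℝ × (Fin n → ℝ)) := fun N k =>
      (Set.Icc (0 : ℝ) N ×ˢ stdSimplex ℝ (Fin n)) ∩ {x | c + 1 / ((k : ℝ) + 1) ≤ ∏ i, x.2 i}
    have hK : ∀ N k, IsCompact (K N k) := fun N k =>
      (isCompact_Icc.prod (isCompact_stdSimplex ℝ (Fin n))).inter_right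
        (isClosed_le continuous_const (by fun_prop))
    have hclosed : ∀ N k, IsClosed {a : Fin n → ℝ |
        ∃ x ∈ K N k, ∑ i, x.2 i * (a i - x.1 * b i) = 0} := fun N k => by
      have := isCompact_iff_compactSpace.1 (hK N k)
      have h1 : IsClosed {q : (Fin n → ℝ) × K N k |
          ∑ i, q.2.1.2 i * (q.1 i - q.2.1.1 * b i) = 0} :=
        isClosed_eq (by fun_prop) continuous_const
      have h2 := isClosedMap_fst_of_compactSpace _ h1
      convert h2 using 1
      ext a
      simp
    have hset : ((fun a : Fin n → ℝ =>
        sSup ((fun θ : ℝ => empLik (fun i => a i - θ * b i)) '' Set.Ici 0)) ⁻¹' Set.Ioi c)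
        = ⋃ N, ⋃ k, {a : Fin n → ℝ | ∃ x ∈ K N k, ∑ i, x.2 i * (a i - x.1 * b i) = 0} := by
      ext a
      simp only [Set.mem_preimage, Set.mem_Ioi, Set.mem_iUnion, Set.mem_ofPred_eq]
      constructor
      · intro h
        obtain ⟨_, ⟨θ, hθ, rfl⟩, h⟩ := exists_lt_of_lt_csSup (Set.nonempty_Ici.image _) h
        have hne : {l | ∃ w, FeasibleWeights (fun i => a i - θ * b i) w ∧
            l = ∏ i, w i}.Nonempty := by
          by_contra hne
          rw [Set.not_nonempty_iff_eq_empty] at hne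
          simp only [empLik_eq, hne, Real.sSup_empty] at h
          linarith
        simp only [empLik_eq] at h
        obtain ⟨_, ⟨w, hw, rfl⟩, h⟩ := exists_lt_of_lt_csSup hne h
        obtain ⟨N, hN⟩ := exists_nat_ge θ
        obtain ⟨k, hk⟩ := exists_nat_one_div_lt (sub_pos.2 h)
        exact ⟨N, k, (θ, w), ⟨⟨⟨hθ, hN⟩, hw.1, hw.2.1⟩, by
          simp only [Set.mem_ofPred_eq]; linarith⟩, hw.2.2⟩
      · rintro ⟨N, k, ⟨θ, w⟩, ⟨⟨hθ, hw⟩, hc'⟩, h0⟩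
        have hfw : FeasibleWeights (fun i => a i - θ * b i) w := ⟨hw.1, hw.2, h0⟩
        have h1 : c < ∏ i, w i := lt_of_lt_of_le (by simp; positivity) hc'
        exact h1.trans_le (hfw.prod_le_empLik.trans
          (le_csSup (bddAbove_image_empLik _ _) ⟨θ, hθ.1, rfl⟩))
    rw [hset]
    exact MeasurableSet.iUnion fun N => MeasurableSet.iUnion fun k => (hclosed N k).measurableSet

lemma measurable_empLik {n : ℕ} : Measurable (empLik : (Fin n → ℝ) → ℝ) := by
  have h := measurable_sSup_empLik (n := n) 0
  simpa [Set.nonempty_Ici.image_const] using h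

variable {p d : ℕ} (D : MixedDesign p d)

/-- The estimating functions are affine in the parameter of interest. -/
lemma Z_eq_sub (n : ℕ) (R : D.SqMat) (θ₀ θ₁ : ℝ) (i : Fin n) :
    D.Z n R θ₁ i = D.Z n R θ₀ i - (θ₁ - θ₀) * (D.Φ i 0 * D.Φ i 0).trace := by
  simp only [Z, Matrix.mul_sub, Matrix.trace_sub, Matrix.mul_smul, Matrix.trace_smul, smul_eq_mul]
  ring

variable {Ω : Type*} [MeasurableSpace Ω]

lemma measurable_residual (n : ℕ) {y : Ω → D.Obs} (hy : ∀ i, Measurable fun ω => y ω i) (i : ℕ)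
    (j : Fin (D.size i)) : Measurable fun ω => D.residual n (y ω) i j := by
  have hy' : ∀ i j, Measurable fun ω => y ω i j := fun i j => (measurable_pi_iff.1 (hy i)) j
  simp only [residual, betaHat, stackY, Matrix.mulVec, dotProduct, Pi.sub_apply]
  fun_prop

lemma measurable_Z (n : ℕ) {R : Ω → D.SqMat} (hR : ∀ i j k, Measurable fun ω => R ω i j k)
    (θ₁ : ℝ) (i : Fin n) : Measurable fun ω => D.Z n (R ω) θ₁ i := by
  simp only [Z, nuisance, Upsilon, Matrix.mulVec, dotProduct, Matrix.trace, Matrix.diag,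
    Matrix.mul_apply, Matrix.sub_apply, Matrix.sum_apply, Matrix.smul_apply, smul_eq_mul]
  fun_prop

lemma measurable_elr (n : ℕ) {R : Ω → D.SqMat} (hR : ∀ i j k, Measurable fun ω => R ω i j k)
    (θ₁ : ℝ) : Measurable fun ω => D.elr n (R ω) θ₁ := by
  refine Measurable.div ?_ ?_
  · exact measurable_empLik.comp (measurable_pi_lambda _ fun i => D.measurable_Z n hR θ₁ i)
  · have h := (measurable_sSup_empLik fun i : Fin n => (D.Φ i 0 * D.Φ i 0).trace).comp
      (measurable_pi_lambda _ fun i => D.measurable_Z n hR 0 i)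
    have hlik : ∀ ω, D.lik n (R ω) = fun θ : ℝ => empLik fun i : Fin n =>
        D.Z n (R ω) 0 i - θ * (D.Φ i 0 * D.Φ i 0).trace := fun ω => by
      funext θ
      simp only [lik]
      congr 1
      funext i
      rw [D.Z_eq_sub n (R ω) 0 θ i, sub_zero]
    simpa only [hlik, Function.comp_def] using h

lemma measurable_RHat (n : ℕ) {y : Ω → D.Obs} (hy : ∀ i, Measurable fun ω => y ω i) (i : ℕ)
    (j k : Fin (D.size i)) : Measurable fun ω => D.RHat n (y ω) i j k := by
  simp only [RHat, outer, Matrix.vecMulVec_apply]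
  exact (D.measurable_residual n hy i j).mul (D.measurable_residual n hy i k)

end MixedDesign

/-! ### A central limit theorem for triangular arrays -/

/-- Second-order Taylor bound for the complex exponential on the imaginary axis, with a remainder
of any order between two and three. -/
lemma norm_exp_mul_I_sub_le {δ : ℝ} (hδ0 : 0 ≤ δ) (hδ1 : δ ≤ 1) (u : ℝ) :
    ‖Complex.exp (u * Complex.I) - (1 + u * Complex.I - (u : ℂ) ^ 2 / 2)‖ ≤ 4 * |u| ^ (2 + δ) := by
  have hI : ‖(u : ℂ) * Complex.I‖ = |u| := by simp
  rcases le_total |u| 1 with hu | hu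
  · have h := Complex.exp_bound (x := (u : ℂ) * Complex.I) (by rw [hI]; exact hu) (n := 3)
      (by norm_num)
    have h2 : ∑ m ∈ Finset.range 3, ((u : ℂ) * Complex.I) ^ m / (m.factorial : ℂ)
        = 1 + u * Complex.I - (u : ℂ) ^ 2 / 2 := by
      simp [Finset.sum_range_succ, mul_pow, Nat.factorial]
      ring
    rw [h2, hI] at h
    refine h.trans ?_
    have h3 : |u| ^ 3 ≤ |u| ^ (2 + δ) := by
      rcases eq_or_lt_of_le (abs_nonneg u) with h0 | h0
      · rw [← h0, Real.zero_rpow (by linarith)]; simp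
      · rw [← Real.rpow_natCast]
        exact Real.rpow_le_rpow_of_exponent_ge h0 hu (by norm_num; linarith)
    have h4 : 0 ≤ |u| ^ 3 := by positivity
    norm_num [Nat.factorial]
    linarith
  · have h3 : |u| ^ 2 ≤ |u| ^ (2 + δ) := by
      rw [← Real.rpow_natCast]
      exact Real.rpow_le_rpow_of_exponent_le hu (by norm_num; linarith)
    calc ‖Complex.exp (u * Complex.I) - (1 + u * Complex.I - (u : ℂ) ^ 2 / 2)‖
        ≤ ‖Complex.exp (u * Complex.I)‖ + (‖(1 : ℂ)‖ + ‖(u : ℂ) * Complex.I‖ + ‖(u : ℂ) ^ 2 / 2‖) :=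
          (norm_sub_le _ _).trans (add_le_add le_rfl ((norm_sub_le _ _).trans
            (add_le_add (norm_add_le _ _) le_rfl)))
      _ = 1 + (1 + |u| + |u| ^ 2 / 2) := by
          rw [Complex.norm_exp_ofReal_mul_I, hI]
          simp
      _ ≤ 4 * |u| ^ 2 := by nlinarith
      _ ≤ _ := by linarith

lemma norm_prod_sub_prod_le {ι : Type*} (s : Finset ι) {a b : ι → ℂ} (ha : ∀ i ∈ s, ‖a i‖ ≤ 1)
    (hb : ∀ i ∈ s, ‖b i‖ ≤ 1) : ‖∏ i ∈ s, a i - ∏ i ∈ s, b i‖ ≤ ∑ i ∈ s, ‖a i - b i‖ := by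
  classical
  induction s using Finset.induction_on with
  | empty => simp
  | insert j s hj ih =>
    rw [Finset.prod_insert hj, Finset.prod_insert hj, Finset.sum_insert hj]
    have ih' := ih (fun i hi => ha i (Finset.mem_insert_of_mem hi))
      (fun i hi => hb i (Finset.mem_insert_of_mem hi))
    have hA : ‖∏ i ∈ s, a i‖ ≤ 1 := by
      rw [norm_prod]
      exact Finset.prod_le_one (fun _ _ => norm_nonneg _)
        fun i hi => ha i (Finset.mem_insert_of_mem hi)
    have : a j * ∏ i ∈ s, a i - b j * ∏ i ∈ s, b i
        = (a j - b j) * ∏ i ∈ s, a i + b j * (∏ i ∈ s, a i - ∏ i ∈ s, b i) := by ring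
    rw [this]
    refine (norm_add_le _ _).trans (add_le_add ?_ ?_)
    · rw [norm_mul]
      exact mul_le_of_le_one_right (norm_nonneg _) hA
    · rw [norm_mul]
      exact (mul_le_of_le_one_left (norm_nonneg _) (hb j (Finset.mem_insert_self j s))).trans ih'

section CLT

variable {Ω : Type*} [MeasurableSpace Ω] {P : Measure Ω} [IsProbabilityMeasure P]

/-- The characteristic function of a centred variable is close to that of a normal variable with
the same variance. -/
lemma norm_charFun_sub_exp_le {δ : ℝ} (hδ0 : 0 ≤ δ) (hδ1 : δ ≤ 1) {X : Ω → ℝ} (hX : MemLp X 2 P)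
    (hX0 : ∫ ω, X ω ∂P = 0) (hXδ : Integrable (fun ω => |X ω| ^ (2 + δ)) P) (t : ℝ) :
    ‖charFun (P.map X) t - Complex.exp ((-(Var[X; P] * t ^ 2 / 2) : ℝ) : ℂ)‖
      ≤ 4 * |t| ^ (2 + δ) * ∫ ω, |X ω| ^ (2 + δ) ∂P + (Var[X; P] * t ^ 2) ^ 2 := by
  have hXm : AEMeasurable X P := hX.aestronglyMeasurable.aemeasurable
  have hX1 : Integrable X P := hX.integrable one_le_two
  have hX2 : Integrable (fun ω => X ω ^ 2) P := hX.integrable_sq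
  have hvar : Var[X; P] = ∫ ω, X ω ^ 2 ∂P := by
    rw [variance_of_integral_eq_zero hXm hX0]
  set v := Var[X; P] with hv
  have hv0 : 0 ≤ v := variance_nonneg _ _
  have h1 : ‖charFun (P.map X) t - (1 - ((v * t ^ 2 / 2 : ℝ) : ℂ))‖
      ≤ 4 * |t| ^ (2 + δ) * ∫ ω, |X ω| ^ (2 + δ) ∂P := by
    have hcf : charFun (P.map X) t = ∫ ω, Complex.exp (((t * X ω : ℝ) : ℂ) * Complex.I) ∂P := by
      rw [charFun_apply_real, integral_map hXm (by fun_prop)]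
      simp
    have hiexp : Integrable (fun ω => Complex.exp (((t * X ω : ℝ) : ℂ) * Complex.I)) P := by
      refine Integrable.of_bound (C := 1) ?_ (Eventually.of_forall fun ω => ?_)
      · exact (Complex.measurable_exp.comp_aemeasurable
          ((Complex.measurable_ofReal.comp_aemeasurable (hXm.const_mul t)).mul_const
            _)).aestronglyMeasurable
      · rw [Complex.norm_exp_ofReal_mul_I]
    have hi1 : Integrable (fun ω => ((t * X ω : ℝ) : ℂ) * Complex.I) P :=
      ((hX1.const_mul t).ofReal).mul_const _
    have hi2 : Integrable (fun ω => ((t * X ω : ℝ) : ℂ) ^ 2 / 2) P := by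
      have := ((hX2.const_mul (t ^ 2 / 2)).ofReal (𝕜 := ℂ))
      refine this.congr (Eventually.of_forall fun ω => ?_)
      simp
      ring
    have hi01 : Integrable (fun ω => 1 + ((t * X ω : ℝ) : ℂ) * Complex.I) P :=
      (integrable_const _).add hi1
    have hi012 : Integrable (fun ω => 1 + ((t * X ω : ℝ) : ℂ) * Complex.I
        - ((t * X ω : ℝ) : ℂ) ^ 2 / 2) P := hi01.sub hi2
    have hint : ∫ ω, (1 + ((t * X ω : ℝ) : ℂ) * Complex.I - ((t * X ω : ℝ) : ℂ) ^ 2 / 2) ∂P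
        = 1 - ((v * t ^ 2 / 2 : ℝ) : ℂ) := by
      rw [integral_sub hi01 hi2, integral_add (integrable_const _) hi1,
        integral_mul_const, integral_complex_ofReal, integral_const_mul, hX0]
      have : ∫ ω, ((t * X ω : ℝ) : ℂ) ^ 2 / 2 ∂P = ∫ ω, ((t ^ 2 / 2 * X ω ^ 2 : ℝ) : ℂ) ∂P := by
        congr 1
        funext ω
        push_cast
        ring
      rw [this, integral_complex_ofReal, integral_const_mul, ← hvar]
      simp
      ring
    rw [hcf, ← hint, ← integral_sub hiexp hi012]
    calc _ ≤ ∫ ω, 4 * |t| ^ (2 + δ) * |X ω| ^ (2 + δ) ∂P := by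
          refine norm_integral_le_of_norm_le (hXδ.const_mul _) (Eventually.of_forall fun ω => ?_)
          have := norm_exp_mul_I_sub_le hδ0 hδ1 (t * X ω)
          rwa [abs_mul, Real.mul_rpow (abs_nonneg _) (abs_nonneg _), ← mul_assoc] at this
      _ = _ := integral_const_mul _ _
  have h2 : ‖(1 - ((v * t ^ 2 / 2 : ℝ) : ℂ)) - Complex.exp ((-(v * t ^ 2 / 2) : ℝ) : ℂ)‖
      ≤ (v * t ^ 2) ^ 2 := by
    set x := v * t ^ 2 / 2 with hx
    have hx0 : 0 ≤ x := by positivity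
    have : (1 - (x : ℂ)) - Complex.exp ((-x : ℝ) : ℂ) = ((1 - x - Real.exp (-x) : ℝ) : ℂ) := by
      push_cast; ring
    rw [this, Complex.norm_real, Real.norm_eq_abs, show v * t ^ 2 = 2 * x by rw [hx]; ring]
    have hlow : 1 - x ≤ Real.exp (-x) := by linarith [Real.add_one_le_exp (-x)]
    have hup : Real.exp (-x) ≤ 1 - x + x ^ 2 := by
      rcases le_total x 1 with h | h
      · have := Real.abs_exp_sub_one_sub_id_le (x := -x)
            (by rw [abs_neg, abs_of_nonneg hx0]; exact h)
        have := (abs_le.1 this).2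
        nlinarith
      · have : Real.exp (-x) ≤ 1 := Real.exp_le_one_iff.2 (by linarith)
        nlinarith
    rw [abs_le]
    constructor <;> nlinarith [sq_nonneg x]
  calc _ = ‖(charFun (P.map X) t - (1 - ((v * t ^ 2 / 2 : ℝ) : ℂ)))
        + ((1 - ((v * t ^ 2 / 2 : ℝ) : ℂ)) - Complex.exp ((-(v * t ^ 2 / 2) : ℝ) : ℂ))‖ := by
        congr 1; ring
    _ ≤ _ := (norm_add_le _ _).trans (add_le_add h1 h2)

/-- **Lyapunov's central limit theorem** for a triangular array with row `n` of length `n`. The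
condition that `|X_{n,i}|^{2+δ}` has expectation at most `K n^{-1-δ/2}` is the one satisfied by
arrays `n^{-1/2} f_{n,i}` with uniformly bounded moments of `f`. -/
theorem tendstoInDistribution_sum_of_lyapunov {δ K : ℝ} (hδ0 : 0 < δ) (hδ1 : δ ≤ 1)
    {X : ℕ → ℕ → Ω → ℝ} (hm : ∀ n i, Measurable (X n i))
    (hindep : ∀ᶠ n in atTop, iIndepFun (X n) P)
    (hmem : ∀ᶠ n in atTop, ∀ i < n, MemLp (X n i) 2 P)
    (hmean : ∀ᶠ n in atTop, ∀ i < n, ∫ ω, X n i ω ∂P = 0)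
    (hmom : ∀ᶠ n : ℕ in atTop, ∀ i < n, Integrable (fun ω => |X n i ω| ^ (2 + δ)) P ∧
      ∫ ω, |X n i ω| ^ (2 + δ) ∂P ≤ K * (n : ℝ) ^ (-(1 + δ / 2)))
    (hvar1 : ∀ᶠ n : ℕ in atTop, ∀ i < n, Var[X n i; P] ≤ K * (n : ℝ)⁻¹)
    (hvar : Tendsto (fun n => ∑ i ∈ Finset.range n, Var[X n i; P]) atTop (𝓝 1)) :
    TendstoInDistribution (fun n ω => ∑ i ∈ Finset.range n, X n i ω) atTop (fun u : ℝ => u)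
      (fun _ => P) (gaussianReal 0 1) where
  forall_aemeasurable n := (Finset.measurable_sum _ fun i _ => hm n i).aemeasurable
  tendsto := by
    refine ProbabilityMeasure.tendsto_iff_tendsto_charFun.2 fun t => ?_
    have hlim : Tendsto (fun n => Complex.exp
        ((-((∑ i ∈ Finset.range n, Var[X n i; P]) * t ^ 2 / 2) : ℝ) : ℂ)) atTop
        (𝓝 (Complex.exp ((-(1 * t ^ 2 / 2) : ℝ) : ℂ))) := by
      refine (Complex.continuous_exp.tendsto _).comp ((Complex.continuous_ofReal.tendsto _).comp ?_)
      exact (((hvar.mul_const _).div_const _).neg)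
    have herr : Tendsto (fun n : ℕ => 4 * |t| ^ (2 + δ) * K * (n : ℝ) ^ (-(δ / 2))
        + K ^ 2 * t ^ 4 * (n : ℝ)⁻¹) atTop (𝓝 0) := by
      have h1 : Tendsto (fun n : ℕ => (n : ℝ) ^ (-(δ / 2))) atTop (𝓝 0) :=
        (tendsto_rpow_neg_atTop (half_pos hδ0)).comp tendsto_natCast_atTop_atTop
      have h2 : Tendsto (fun n : ℕ => (n : ℝ)⁻¹) atTop (𝓝 0) :=
        tendsto_inv_atTop_zero.comp tendsto_natCast_atTop_atTop
      simpa using (h1.const_mul (4 * |t| ^ (2 + δ) * K)).add (h2.const_mul (K ^ 2 * t ^ 4))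
    have hdiff : Tendsto (fun n => charFun (P.map fun ω => ∑ i ∈ Finset.range n, X n i ω) t
        - Complex.exp ((-((∑ i ∈ Finset.range n, Var[X n i; P]) * t ^ 2 / 2) : ℝ) : ℂ)) atTop
        (𝓝 0) := by
      refine squeeze_zero_norm' ?_ herr
      filter_upwards [hindep, hmem, hmean, hmom, hvar1, eventually_gt_atTop 0]
        with n h1 h2 h3 h4 h5 hn
      have hn0 : (0 : ℝ) < n := by exact_mod_cast hn
      rw [(h1.restrict _).charFun_map_fun_finsetSum_eq_prod (fun i _ => (hm n i).aemeasurable),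
        Finset.prod_apply]
      have hexp : Complex.exp ((-((∑ i ∈ Finset.range n, Var[X n i; P]) * t ^ 2 / 2) : ℝ) : ℂ)
          = ∏ i ∈ Finset.range n, Complex.exp ((-(Var[X n i; P] * t ^ 2 / 2) : ℝ) : ℂ) := by
        rw [← Complex.exp_sum, ← Complex.ofReal_sum]
        congr 2
        rw [Finset.sum_neg_distrib, ← Finset.sum_div, ← Finset.sum_mul]
      rw [hexp]
      have : ∀ i, IsProbabilityMeasure (P.map (X n i)) := fun i =>
        Measure.isProbabilityMeasure_map (hm n i).aemeasurable
      refine (norm_prod_sub_prod_le _ (fun i _ => norm_charFun_le_one t) fun i _ => ?_).trans ?_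
      · rw [← Complex.ofReal_exp, Complex.norm_real, Real.norm_eq_abs, abs_of_pos (Real.exp_pos _)]
        refine Real.exp_le_one_iff.2 ?_
        have : 0 ≤ Var[X n i; P] := variance_nonneg _ _
        have : 0 ≤ Var[X n i; P] * t ^ 2 / 2 := by positivity
        linarith
      · have hterm : ∀ i ∈ Finset.range n, ‖charFun (P.map (X n i)) t
            - Complex.exp ((-(Var[X n i; P] * t ^ 2 / 2) : ℝ) : ℂ)‖
            ≤ 4 * |t| ^ (2 + δ) * (K * (n : ℝ) ^ (-(1 + δ / 2))) + (K * (n : ℝ)⁻¹ * t ^ 2) ^ 2 := by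
          intro i hi
          have hi' := Finset.mem_range.1 hi
          have hv : 0 ≤ Var[X n i; P] := variance_nonneg _ _
          refine (norm_charFun_sub_exp_le hδ0.le hδ1 (h2 i hi') (h3 i hi') (h4 i hi').1 t).trans ?_
          have := (h4 i hi').2
          have := h5 i hi'
          gcongr
        refine (Finset.sum_le_sum hterm).trans (le_of_eq ?_)
        rw [Finset.sum_const, Finset.card_range, nsmul_eq_mul]
        have hpow : (n : ℝ) ^ (-(1 + δ / 2)) = (n : ℝ)⁻¹ * (n : ℝ) ^ (-(δ / 2)) := by
          rw [← Real.rpow_neg_one, ← Real.rpow_add hn0]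
          congr 1; ring
        rw [hpow]
        field_simp
    have := hdiff.add hlim
    simp only [sub_add_cancel, zero_add] at this
    have hg : charFun (gaussianReal 0 1) t = Complex.exp ((-(1 * t ^ 2 / 2) : ℝ) : ℂ) := by
      rw [charFun_gaussianReal]
      simp
    rw [← hg] at this
    simpa using this

end CLT

/-! ### Moments of sums of independent variables -/

section Moments

variable {Ω : Type*} [MeasurableSpace Ω] {P : Measure Ω} [IsProbabilityMeasure P]

lemma integrable_pow_of_integrable_pow_four {X : Ω → ℝ} (hX : Measurable X)
    (h4 : Integrable (fun ω => X ω ^ 4) P) {k : ℕ} (hk : k ≤ 4) :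
    Integrable (fun ω => X ω ^ k) P := by
  refine ((integrable_const (1 : ℝ)).add h4).mono' (hX.pow_const k).aestronglyMeasurable
    (Eventually.of_forall fun ω => ?_)
  have h0 : X ω ^ 4 = |X ω| ^ 4 := by rw [pow_abs, abs_of_nonneg (by positivity)]
  simp only [Real.norm_eq_abs, abs_pow, Pi.add_apply]
  rw [h0]
  rcases le_total |X ω| 1 with h | h
  · exact (pow_le_one₀ (abs_nonneg _) h).trans (by linarith [pow_nonneg (abs_nonneg (X ω)) 4])
  · exact (pow_le_pow_right₀ h hk).trans (by linarith)

/-- Second and fourth moments of a sum of two independent centred variables. -/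
lemma integral_add_pow_of_indepFun {X Y : Ω → ℝ} (hXY : IndepFun X Y P) (hX : Measurable X)
    (hY : Measurable Y) (hX4 : Integrable (fun ω => X ω ^ 4) P)
    (hY4 : Integrable (fun ω => Y ω ^ 4) P) (hX0 : ∫ ω, X ω ∂P = 0) (hY0 : ∫ ω, Y ω ∂P = 0) :
    Integrable (fun ω => (X ω + Y ω) ^ 4) P ∧
    ∫ ω, (X ω + Y ω) ^ 2 ∂P = ∫ ω, X ω ^ 2 ∂P + ∫ ω, Y ω ^ 2 ∂P ∧
    ∫ ω, (X ω + Y ω) ^ 4 ∂P =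
      ∫ ω, X ω ^ 4 ∂P + 6 * (∫ ω, X ω ^ 2 ∂P) * (∫ ω, Y ω ^ 2 ∂P) + ∫ ω, Y ω ^ 4 ∂P := by
  have hXi : ∀ {k : ℕ}, k ≤ 4 → Integrable (fun ω => X ω ^ k) P :=
    fun hk => integrable_pow_of_integrable_pow_four hX hX4 hk
  have hYi : ∀ {k : ℕ}, k ≤ 4 → Integrable (fun ω => Y ω ^ k) P :=
    fun hk => integrable_pow_of_integrable_pow_four hY hY4 hk
  have hind : ∀ k l : ℕ, IndepFun (fun ω => X ω ^ k) (fun ω => Y ω ^ l) P := fun k l =>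
    hXY.comp (φ := fun x => x ^ k) (ψ := fun x => x ^ l) (by fun_prop) (by fun_prop)
  have hi : ∀ {k l : ℕ}, k ≤ 4 → l ≤ 4 → Integrable (fun ω => X ω ^ k * Y ω ^ l) P :=
    fun hk hl => (hind _ _).integrable_mul (hXi hk) (hYi hl)
  have hprod : ∀ k l : ℕ, ∫ ω, X ω ^ k * Y ω ^ l ∂P = (∫ ω, X ω ^ k ∂P) * ∫ ω, Y ω ^ l ∂P :=
    fun k l => (hind k l).integral_mul_eq_mul_integral (hX.pow_const k).aestronglyMeasurable
      (hY.pow_const l).aestronglyMeasurable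
  have e4 : (fun ω => (X ω + Y ω) ^ 4) = fun ω => X ω ^ 4 + (4 * (X ω ^ 3 * Y ω ^ 1)
      + (6 * (X ω ^ 2 * Y ω ^ 2) + (4 * (X ω ^ 1 * Y ω ^ 3) + Y ω ^ 4))) := by
    funext ω; ring
  have e2 : (fun ω => (X ω + Y ω) ^ 2)
      = fun ω => X ω ^ 2 + (2 * (X ω ^ 1 * Y ω ^ 1) + Y ω ^ 2) := by
    funext ω; ring
  have i1 : Integrable (fun ω => 4 * (X ω ^ 1 * Y ω ^ 3) + Y ω ^ 4) P :=
    ((hi (by norm_num) (by norm_num)).const_mul 4).add hY4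
  have i2 : Integrable (fun ω => 6 * (X ω ^ 2 * Y ω ^ 2) + (4 * (X ω ^ 1 * Y ω ^ 3) + Y ω ^ 4)) P :=
    ((hi (by norm_num) (by norm_num)).const_mul 6).add i1
  have i3 : Integrable (fun ω => 4 * (X ω ^ 3 * Y ω ^ 1)
      + (6 * (X ω ^ 2 * Y ω ^ 2) + (4 * (X ω ^ 1 * Y ω ^ 3) + Y ω ^ 4))) P :=
    ((hi (by norm_num) (by norm_num)).const_mul 4).add i2
  have j1 : Integrable (fun ω => 2 * (X ω ^ 1 * Y ω ^ 1) + Y ω ^ 2) P :=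
    ((hi (by norm_num) (by norm_num)).const_mul 2).add (hYi (by norm_num))
  refine ⟨?_, ?_, ?_⟩
  · rw [e4]
    exact hX4.add i3
  · rw [e2, integral_add (hXi (by norm_num)) j1,
      integral_add ((hi (by norm_num) (by norm_num)).const_mul 2) (hYi (by norm_num)),
      integral_const_mul, hprod]
    simp [hX0]
  · rw [e4, integral_add hX4 i3, integral_add ((hi (by norm_num) (by norm_num)).const_mul 4) i2,
      integral_add ((hi (by norm_num) (by norm_num)).const_mul 6) i1,
      integral_add ((hi (by norm_num) (by norm_num)).const_mul 4) hY4]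
    simp only [integral_const_mul, hprod]
    simp [hX0, hY0]
    ring

/-- Fourth moment of a sum of independent centred variables whose second and fourth moments are
controlled by `s i` and `s i ^ 2`. -/
lemma integral_sum_pow_four_le {X : ℕ → Ω → ℝ} (hindep : iIndepFun X P) (hX : ∀ i, Measurable (X i))
    (h0 : ∀ i, ∫ ω, X i ω ∂P = 0) (h4 : ∀ i, Integrable (fun ω => X i ω ^ 4) P) {B : ℝ}
    (hB : 0 ≤ B) {s : ℕ → ℝ} (hs : ∀ i, 0 ≤ s i) (hm2 : ∀ i, ∫ ω, X i ω ^ 2 ∂P ≤ B * s i)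
    (hm4 : ∀ i, ∫ ω, X i ω ^ 4 ∂P ≤ (B * s i) ^ 2) (n : ℕ) :
    Integrable (fun ω => (∑ i ∈ Finset.range n, X i ω) ^ 4) P ∧
      ∫ ω, (∑ i ∈ Finset.range n, X i ω) ^ 4 ∂P ≤ 3 * (B * ∑ i ∈ Finset.range n, s i) ^ 2 := by
  suffices H : Integrable (fun ω => (∑ i ∈ Finset.range n, X i ω) ^ 4) P ∧
      ∫ ω, (∑ i ∈ Finset.range n, X i ω) ^ 2 ∂P ≤ B * ∑ i ∈ Finset.range n, s i ∧
      ∫ ω, (∑ i ∈ Finset.range n, X i ω) ^ 4 ∂P ≤ 3 * (B * ∑ i ∈ Finset.range n, s i) ^ 2 from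
    ⟨H.1, H.2.2⟩
  induction n with
  | zero => simp
  | succ n ih =>
    obtain ⟨ih1, ih2, ih3⟩ := ih
    have hind : IndepFun (fun ω => ∑ i ∈ Finset.range n, X i ω) (X n) P := by
      have := hindep.indepFun_finsetSum_of_notMem hX (s := Finset.range n) (i := n) (by simp)
      convert this using 1
      funext ω
      simp
    have hm : Measurable fun ω => ∑ i ∈ Finset.range n, X i ω :=
      Finset.measurable_sum _ fun i _ => hX i
    have hzero : ∫ ω, ∑ i ∈ Finset.range n, X i ω ∂P = 0 := by
      rw [integral_finsetSum]
      · simp [h0]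
      · intro i _
        simpa using integrable_pow_of_integrable_pow_four (hX i) (h4 i) (k := 1) (by norm_num)
    obtain ⟨k1, k2, k3⟩ := integral_add_pow_of_indepFun hind hm (hX n) ih1 (h4 n) hzero (h0 n)
    simp only [Finset.sum_range_succ]
    have hS : 0 ≤ ∑ i ∈ Finset.range n, s i := Finset.sum_nonneg fun i _ => hs i
    refine ⟨k1, ?_, ?_⟩
    · rw [k2]
      linarith [hm2 n]
    · rw [k3]
      have h6 : (∫ ω, (∑ i ∈ Finset.range n, X i ω) ^ 2 ∂P) * (∫ ω, X n ω ^ 2 ∂P)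
          ≤ (B * ∑ i ∈ Finset.range n, s i) * (B * s n) :=
        mul_le_mul ih2 (hm2 n) (integral_nonneg fun ω => sq_nonneg _) (by positivity)
      nlinarith [hm4 n, sq_nonneg (B * s n)]

/-- A one-sided law of large numbers for nonnegative independent variables with uniformly bounded
moments of some order larger than one, by truncation and Chebyshev's inequality. -/
lemma whp_le_average {δ K c : ℝ} (hδ : 0 < δ) (hc : 0 < c) {W : ℕ → Ω → ℝ}
    (hindep : iIndepFun W P) (hW : ∀ i, Measurable (W i)) (hW0 : ∀ i ω, 0 ≤ W i ω)
    (hmom : ∀ i, Integrable (fun ω => W i ω ^ (1 + δ)) P ∧ ∫ ω, W i ω ^ (1 + δ) ∂P ≤ K)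
    (hint : ∀ i, Integrable (W i) P)
    (hmean : ∀ᶠ n : ℕ in atTop, c ≤ (n : ℝ)⁻¹ * ∑ i ∈ Finset.range n, ∫ ω, W i ω ∂P) :
    WithHighProb P (fun n => {ω | c / 2 ≤ (n : ℝ)⁻¹ * ∑ i ∈ Finset.range n, W i ω}) := by
  obtain ⟨M, hM0, hM⟩ : ∃ M : ℝ, 0 < M ∧ K * M ^ (-δ) ≤ c / 4 := by
    have h1 : Tendsto (fun M : ℝ => K * M ^ (-δ)) atTop (𝓝 0) := by
      simpa using (tendsto_rpow_neg_atTop hδ).const_mul K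
    obtain ⟨M, h2, h3⟩ := (((tendsto_order.1 h1).2 (c / 4) (by positivity)).and
      (eventually_gt_atTop 0)).exists
    exact ⟨M, h3, h2.le⟩
  let T : ℕ → Ω → ℝ := fun i ω => min (W i ω) M
  have hTm : ∀ i, Measurable (T i) := fun i => (hW i).min measurable_const
  have hT0 : ∀ i ω, 0 ≤ T i ω := fun i ω => le_min (hW0 i ω) hM0.le
  have hTL : ∀ i, MemLp (T i) 2 P := fun i =>
    MemLp.of_bound (hTm i).aestronglyMeasurable M (Eventually.of_forall fun ω => by
      rw [Real.norm_eq_abs, abs_of_nonneg (hT0 i ω)]; exact min_le_right _ _)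
  have hTi : iIndepFun T P := hindep.comp (fun _ x => min x M) fun _ => by fun_prop
  have hTmean : ∀ i, ∫ ω, W i ω ∂P - c / 4 ≤ ∫ ω, T i ω ∂P := fun i => by
    have h1 : ∀ ω, W i ω - T i ω ≤ M ^ (-δ) * W i ω ^ (1 + δ) := fun ω => by
      rcases le_total (W i ω) M with h | h
      · simp only [T, min_eq_left h, sub_self]
        exact mul_nonneg (Real.rpow_nonneg hM0.le _) (Real.rpow_nonneg (hW0 i ω) _)
      · have hWpos : 0 < W i ω := hM0.trans_le h
        have h2 : M ^ δ ≤ W i ω ^ δ := Real.rpow_le_rpow hM0.le h hδ.le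
        have h3 : W i ω ≤ M ^ (-δ) * W i ω ^ (1 + δ) := by
          rw [Real.rpow_neg hM0.le, ← div_eq_inv_mul, le_div_iff₀ (Real.rpow_pos_of_pos hM0 _),
            Real.rpow_add hWpos, Real.rpow_one]
          gcongr
        have h4 : 0 ≤ T i ω := hT0 i ω
        linarith
    have h2 : ∫ ω, (W i ω - T i ω) ∂P ≤ M ^ (-δ) * ∫ ω, W i ω ^ (1 + δ) ∂P := by
      rw [← integral_const_mul]
      exact integral_mono ((hint i).sub ((hTL i).integrable one_le_two))
        ((hmom i).1.const_mul _) h1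
    rw [integral_sub (hint i) ((hTL i).integrable one_le_two)] at h2
    have h3 : M ^ (-δ) * ∫ ω, W i ω ^ (1 + δ) ∂P ≤ M ^ (-δ) * K :=
      mul_le_mul_of_nonneg_left (hmom i).2 (Real.rpow_nonneg hM0.le _)
    linarith [mul_comm K (M ^ (-δ))]
  let A : ℕ → Ω → ℝ := fun n ω => (n : ℝ)⁻¹ * ∑ i ∈ Finset.range n, T i ω
  have hAL : ∀ n, MemLp (A n) 2 P := fun n =>
    (memLp_finsetSum (Finset.range n) fun i _ => hTL i).const_mul _
  have hAvar : ∀ n : ℕ, Var[A n; P] ≤ M ^ 2 * (n : ℝ)⁻¹ := fun n => by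
    rw [show A n = fun ω => (n : ℝ)⁻¹ * (∑ i ∈ Finset.range n, T i) ω by
        funext ω; simp [A], variance_const_mul,
      IndepFun.variance_sum (fun i _ => hTL i) fun i _ j _ hij => hTi.indepFun hij]
    have : ∀ i ∈ Finset.range n, Var[T i; P] ≤ M ^ 2 := fun i _ => by
      refine (variance_le_sq_of_bounded (a := 0) (b := M)
        (Eventually.of_forall fun ω => ⟨hT0 i ω, min_le_right _ _⟩) (hTm i).aemeasurable).trans ?_
      nlinarith
    have hsum := Finset.sum_le_sum this
    rw [Finset.sum_const, Finset.card_range, nsmul_eq_mul] at hsum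
    rcases Nat.eq_zero_or_pos n with rfl | hn
    · simp
    · have hn0 : (0 : ℝ) < n := by exact_mod_cast hn
      calc ((n : ℝ)⁻¹) ^ 2 * ∑ i ∈ Finset.range n, Var[T i; P]
          ≤ ((n : ℝ)⁻¹) ^ 2 * (n * M ^ 2) := by gcongr
        _ = _ := by field_simp
  have hlim : Tendsto (fun n : ℕ => ENNReal.ofReal (M ^ 2 * (n : ℝ)⁻¹ / (c / 8) ^ 2)) atTop
      (𝓝 0) := by
    have h1 : Tendsto (fun n : ℕ => M ^ 2 * (n : ℝ)⁻¹ / (c / 8) ^ 2) atTop (𝓝 0) := by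
      simpa using (((tendsto_inv_atTop_zero.comp
        (tendsto_natCast_atTop_atTop (R := ℝ))).const_mul (M ^ 2)).div_const ((c / 8) ^ 2))
    simpa using ENNReal.tendsto_ofReal h1
  refine tendsto_of_tendsto_of_tendsto_of_le_of_le' tendsto_const_nhds hlim
    (Eventually.of_forall fun _ => zero_le) ?_
  filter_upwards [hmean, eventually_gt_atTop 0] with n hn hn1
  have hn0 : (0 : ℝ) < n := by exact_mod_cast hn1
  have hA : c * (3 / 4) ≤ ∫ ω, A n ω ∂P := by
    simp only [A]
    rw [integral_const_mul, integral_finsetSum _ fun i _ => (hTL i).integrable one_le_two]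
    have := Finset.sum_le_sum fun i (_ : i ∈ Finset.range n) => hTmean i
    rw [Finset.sum_sub_distrib, Finset.sum_const, Finset.card_range, nsmul_eq_mul] at this
    have h2 := mul_le_mul_of_nonneg_left this (inv_pos.2 hn0).le
    rw [mul_sub, inv_mul_cancel_left₀ hn0.ne'] at h2
    linarith
  calc P {ω | c / 2 ≤ (n : ℝ)⁻¹ * ∑ i ∈ Finset.range n, W i ω}ᶜ
      ≤ P {ω | c / 8 ≤ |A n ω - ∫ ω, A n ω ∂P|} := by
        refine measure_mono fun ω hω => ?_
        simp only [Set.mem_compl_iff, Set.mem_ofPred_eq, not_le] at hω ⊢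
        have h1 : A n ω ≤ (n : ℝ)⁻¹ * ∑ i ∈ Finset.range n, W i ω := by
          simp only [A]
          gcongr with i _
          exact min_le_left _ _
        rw [abs_sub_comm]
        refine le_trans ?_ (le_abs_self _)
        linarith
    _ ≤ ENNReal.ofReal (Var[A n; P] / (c / 8) ^ 2) :=
        meas_ge_le_variance_div_sq (hAL n) (by positivity)
    _ ≤ _ := by
        gcongr
        exact hAvar n

/-- The variance is continuous along `L²`-small perturbations. -/
lemma abs_variance_sub_le {X Y : Ω → ℝ} (hX : MemLp X 2 P) (hY : MemLp Y 2 P) {η : ℝ}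
    (hη : 0 < η) :
    |Var[Y; P] - Var[X; P]| ≤ η * Var[X; P] + (1 + η⁻¹) * ∫ ω, (Y ω - X ω) ^ 2 ∂P := by
  have hD : MemLp (fun ω => Y ω - X ω) 2 P := hY.sub hX
  set D : Ω → ℝ := fun ω => Y ω - X ω with hDdef
  have hYX : Y = fun ω => X ω + D ω := by funext ω; simp [D]
  have h1 : Var[Y; P] = Var[X; P] + 2 * cov[X, D; P] + Var[D; P] := by
    rw [hYX, variance_fun_add hX hD]
  have hDv : Var[D; P] ≤ ∫ ω, (Y ω - X ω) ^ 2 ∂P := by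
    simpa using variance_le_expectation_sq hD.aestronglyMeasurable
  have hcs : ∀ s : ℝ, s ^ 2 = 1 → s * (2 * cov[X, D; P]) ≤ η * Var[X; P] + η⁻¹ * Var[D; P] := by
    intro s hs
    have h2 : 0 ≤ Var[fun ω => η * X ω + (-s) * D ω; P] := variance_nonneg _ _
    rw [variance_fun_add (hX.const_mul η) (hD.const_mul (-s)), variance_const_mul,
      variance_const_mul, covariance_const_mul_left, covariance_const_mul_right, neg_sq, hs] at h2
    have h3 : 0 ≤ η⁻¹ * (η ^ 2 * Var[X; P] + 2 * (η * (-s * cov[X, D; P])) + 1 * Var[D; P]) :=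
      mul_nonneg (inv_pos.2 hη).le h2
    have h4 : η⁻¹ * (η ^ 2 * Var[X; P] + 2 * (η * (-s * cov[X, D; P])) + 1 * Var[D; P])
        = η * Var[X; P] - s * (2 * cov[X, D; P]) + η⁻¹ * Var[D; P] := by
      field_simp
      ring
    linarith
  have h5 := hcs 1 (by norm_num)
  have h6 := hcs (-1) (by norm_num)
  have h7 : 0 ≤ Var[D; P] := variance_nonneg _ _
  have h8 : η⁻¹ * Var[D; P] ≤ η⁻¹ * ∫ ω, (Y ω - X ω) ^ 2 ∂P :=
    mul_le_mul_of_nonneg_left hDv (inv_pos.2 hη).le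
  rw [h1, abs_le]
  constructor <;> linarith

end Moments

/-! ### Quadratic forms, the residual projection and the normal equations -/

section LinearAlgebra

lemma dotProduct_sq_le {m : Type*} [Fintype m] (a b : m → ℝ) :
    (a ⬝ᵥ b) ^ 2 ≤ (a ⬝ᵥ a) * (b ⬝ᵥ b) := by
  have h := Finset.sum_mul_sq_le_sq_mul_sq Finset.univ a b
  simpa only [dotProduct, pow_two] using h

lemma dotProduct_self_nonneg_real {m : Type*} [Fintype m] (a : m → ℝ) : 0 ≤ a ⬝ᵥ a :=
  Finset.sum_nonneg fun i _ => mul_self_nonneg (a i)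

lemma trace_transpose_mul_self_eq {m : Type*} [Fintype m] (A : Matrix m m ℝ) :
    (Aᵀ * A).trace = ∑ i, ∑ j, A i j ^ 2 := by
  simp only [Matrix.trace, Matrix.diag, Matrix.mul_apply, Matrix.transpose_apply, pow_two]
  exact Finset.sum_comm

lemma mulVec_dotProduct_self_le {m : Type*} [Fintype m] (A : Matrix m m ℝ) (v : m → ℝ) :
    (A *ᵥ v) ⬝ᵥ (A *ᵥ v) ≤ (Aᵀ * A).trace * (v ⬝ᵥ v) := by
  rw [trace_transpose_mul_self_eq, Finset.sum_mul]
  refine Finset.sum_le_sum fun i _ => ?_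
  have h := dotProduct_sq_le (A i) v
  simp only [dotProduct, ← pow_two] at h
  simpa only [Matrix.mulVec, dotProduct, ← pow_two] using h

lemma abs_dotProduct_mulVec_le {m : Type*} [Fintype m] {A : Matrix m m ℝ} {F : ℝ} (hF : 0 ≤ F)
    (hA : (Aᵀ * A).trace ≤ F ^ 2) (a b : m → ℝ) :
    |a ⬝ᵥ (A *ᵥ b)| ≤ F * (√(a ⬝ᵥ a) * √(b ⬝ᵥ b)) := by
  refine abs_le_of_sq_le_sq ?_ (by positivity)
  rw [mul_pow, mul_pow, Real.sq_sqrt (dotProduct_self_nonneg_real a),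
    Real.sq_sqrt (dotProduct_self_nonneg_real b)]
  calc (a ⬝ᵥ (A *ᵥ b)) ^ 2 ≤ (a ⬝ᵥ a) * ((A *ᵥ b) ⬝ᵥ (A *ᵥ b)) := dotProduct_sq_le _ _
    _ ≤ (a ⬝ᵥ a) * (F ^ 2 * (b ⬝ᵥ b)) := by
        refine mul_le_mul_of_nonneg_left ?_ (dotProduct_self_nonneg_real a)
        exact (mulVec_dotProduct_self_le A b).trans
          (mul_le_mul_of_nonneg_right hA (dotProduct_self_nonneg_real b))
    _ = _ := by ring

lemma abs_dotProduct_mulVec_self_le {m : Type*} [Fintype m] {A : Matrix m m ℝ} {F : ℝ}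
    (hF : 0 ≤ F) (hA : (Aᵀ * A).trace ≤ F ^ 2) (a : m → ℝ) :
    |a ⬝ᵥ (A *ᵥ a)| ≤ F * (a ⬝ᵥ a) := by
  have h := abs_dotProduct_mulVec_le hF hA a a
  rwa [Real.mul_self_sqrt (dotProduct_self_nonneg_real a)] at h

lemma abs_trace_mul_le {m : Type*} [Fintype m] {A B : Matrix m m ℝ} {F : ℝ}
    (hA : (Aᵀ * A).trace ≤ F ^ 2) (hB : (Bᵀ * B).trace ≤ F ^ 2) : |(A * B).trace| ≤ F ^ 2 := by
  refine abs_le_of_sq_le_sq ?_ (sq_nonneg F)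
  have h1 : (A * B).trace = ∑ x : m × m, A x.1 x.2 * B x.2 x.1 := by
    simp only [Matrix.trace, Matrix.diag, Matrix.mul_apply, Fintype.sum_prod_type]
  have h2 : ∑ x : m × m, A x.1 x.2 ^ 2 = (Aᵀ * A).trace := by
    rw [trace_transpose_mul_self_eq, Fintype.sum_prod_type]
  have h3 : ∑ x : m × m, B x.2 x.1 ^ 2 = (Bᵀ * B).trace := by
    rw [trace_transpose_mul_self_eq, Fintype.sum_prod_type]
    exact Finset.sum_comm
  rw [h1]
  refine (Finset.sum_mul_sq_le_sq_mul_sq _ _ _).trans ?_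
  rw [h2, h3, pow_two (F ^ 2)]
  refine mul_le_mul hA hB ?_ (sq_nonneg F)
  rw [← h3]
  positivity

lemma trace_mul_vecMulVec_self {m : Type*} [Fintype m] (A : Matrix m m ℝ) (v : m → ℝ) :
    (A * Matrix.vecMulVec v v).trace = v ⬝ᵥ (A *ᵥ v) := by
  rw [Matrix.mul_vecMulVec, Matrix.trace_vecMulVec, dotProduct_comm]

open scoped MatrixOrder Matrix.Norms.L2Operator in
/-- An invertible Gram matrix can be normalized: if `G = AᵀA` is invertible, then
`G⁻¹ = C Cᵀ` with `Cᵀ G C = 1`. -/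
lemma exists_inv_eq_mul_transpose {m k : Type*} [Fintype m] [Fintype k] [DecidableEq k]
    (A : Matrix m k ℝ) (h : IsUnit (Aᵀ * A)) :
    ∃ C : Matrix k k ℝ, (Aᵀ * A)⁻¹ = C * Cᵀ ∧ Cᵀ * (Aᵀ * A) * C = 1 := by
  have hG : (Aᵀ * A).PosSemidef := by
    simpa using Matrix.posSemidef_conjTranspose_mul_self A
  obtain ⟨B, hB⟩ := CStarAlgebra.nonneg_iff_eq_star_mul_self.mp hG.inv.nonneg
  have hB' : (Aᵀ * A)⁻¹ = Bᵀ * B := by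
    rw [hB, Matrix.star_eq_conjTranspose, Matrix.conjTranspose_eq_transpose_of_trivial]
  have hdet : IsUnit (Aᵀ * A).det := (Matrix.isUnit_iff_isUnit_det _).1 h
  refine ⟨Bᵀ, by rw [hB', Matrix.transpose_transpose], ?_⟩
  rw [Matrix.transpose_transpose]
  have h1 : B * (Aᵀ * A) * Bᵀ * B = B := by
    rw [Matrix.mul_assoc, ← hB', Matrix.mul_assoc, Matrix.mul_nonsing_inv _ hdet, Matrix.mul_one]
  have hBunit : IsUnit B.det := by
    have h2 : IsUnit (Bᵀ * B).det := by
      rw [← hB']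
      exact (Matrix.isUnit_nonsing_inv_det _ hdet)
    rw [Matrix.det_mul] at h2
    exact isUnit_of_mul_isUnit_right h2
  calc B * (Aᵀ * A) * Bᵀ = B * (Aᵀ * A) * Bᵀ * B * B⁻¹ := by
        rw [Matrix.mul_nonsing_inv_cancel_right _ _ hBunit]
    _ = 1 := by rw [h1, Matrix.mul_nonsing_inv _ hBunit]

end LinearAlgebra

namespace MixedDesign

variable {p d : ℕ} (D : MixedDesign p d)

/-- The inner product of the stacked vectors of the first `n` subjects. -/
noncomputable def obsInner (n : ℕ) (a b : D.Obs) : ℝ :=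
  ∑ i : Fin n, a i ⬝ᵥ b i

/-- The blockwise product with the design matrices of the `k`-th variance component. -/
noncomputable def applyΦ (k : Fin (d + 1)) (a : D.Obs) : D.Obs :=
  fun i => D.Φ i k *ᵥ a i

lemma dotProduct_stackY (n : ℕ) (a b : D.Obs) :
    D.stackY n a ⬝ᵥ D.stackY n b = D.obsInner n a b := by
  simp only [stackY, dotProduct, obsInner]
  rw [Fintype.sum_sigma]

/-- The least-squares residuals are the errors minus their projection on the column space of the
design: there is an orthonormal family `u` of `p` stacked vectors with
`r̂ = r - ∑ l, ⟨u l, r⟩ u l`. -/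
lemma exists_residual_eq (n : ℕ) (h : IsUnit ((D.stackX n)ᵀ * D.stackX n)) :
    ∃ u : Fin p → D.Obs,
      (∀ l m, D.obsInner n (u l) (u m) = if l = m then 1 else 0) ∧
      ∀ (β : Fin p → ℝ) (y r : D.Obs), (∀ i, y i = D.X i *ᵥ β + r i) →
        ∀ i, D.residual n y i = r i - ∑ l, D.obsInner n (u l) r • u l i := by
  obtain ⟨C, hC1, hC2⟩ := exists_inv_eq_mul_transpose (D.stackX n) h
  have hdet := (Matrix.isUnit_iff_isUnit_det _).1 h
  let u : Fin p → D.Obs := fun l i j => (D.X i * C) j l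
  have hu : ∀ l, D.stackY n (u l) = fun a => (D.stackX n * C) a l := fun l => by
    funext a
    simp [stackY, u, stackX, Matrix.mul_apply]
  have hT : ∀ (r : D.Obs) (l : Fin p),
      (Cᵀ *ᵥ ((D.stackX n)ᵀ *ᵥ D.stackY n r)) l = D.obsInner n (u l) r := fun r l => by
    rw [← dotProduct_stackY, hu, Matrix.mulVec_mulVec, ← Matrix.transpose_mul]
    rfl
  refine ⟨u, fun l m => ?_, fun β y r hy i => ?_⟩
  · rw [← dotProduct_stackY, hu, hu]
    have h1 : ((D.stackX n * C)ᵀ * (D.stackX n * C)) l m = (1 : Matrix (Fin p) (Fin p) ℝ) l m := by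
      rw [← hC2, Matrix.transpose_mul]
      simp only [Matrix.mul_assoc]
    rw [Matrix.mul_apply, Matrix.one_apply] at h1
    exact h1
  · have hstack : D.stackY n y = D.stackX n *ᵥ β + D.stackY n r := by
      funext a
      simp only [stackY, hy, Pi.add_apply]
      rfl
    have hbeta : D.betaHat n y = β + C *ᵥ (Cᵀ *ᵥ ((D.stackX n)ᵀ *ᵥ D.stackY n r)) := by
      rw [betaHat, hstack, Matrix.mulVec_add, Matrix.mulVec_add, Matrix.mulVec_mulVec,
        Matrix.mulVec_mulVec, Matrix.mul_assoc, Matrix.nonsing_inv_mul _ hdet, Matrix.one_mulVec,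
        hC1,
        Matrix.mulVec_mulVec (v := (D.stackX n)ᵀ *ᵥ D.stackY n r)]
    have hfun : Cᵀ *ᵥ ((D.stackX n)ᵀ *ᵥ D.stackY n r) = fun l => D.obsInner n (u l) r :=
      funext (hT r)
    rw [residual, hbeta, hfun, hy, Matrix.mulVec_add, Matrix.mulVec_mulVec]
    funext j
    simp only [Pi.sub_apply, Pi.add_apply, Matrix.mulVec, dotProduct, Finset.sum_apply,
      Pi.smul_apply, smul_eq_mul, u]
    have : ∀ l, (D.X i * C) j l * D.obsInner n (u l) r = D.obsInner n (u l) r * (D.X i * C) j l :=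
      fun l => mul_comm _ _
    simp only [u] at this
    rw [Finset.sum_congr rfl fun l _ => this l]
    ring

lemma trace_mul_outer (r : D.Obs) (i : ℕ) (k : Fin (d + 1)) :
    (D.Φ i k * D.outer r i).trace = r i ⬝ᵥ (D.Φ i k *ᵥ r i) :=
  trace_mul_vecMulVec_self _ _

lemma Φ_transpose (i : ℕ) (k : Fin (d + 1)) : (D.Φ i k)ᵀ = D.Φ i k := by
  have := (D.Φ_posSemidef i k).isHermitian
  rwa [Matrix.IsHermitian, Matrix.conjTranspose_eq_transpose_of_trivial] at this

lemma trace_mul_RHat_sub (n : ℕ) (y r g : D.Obs) (i : ℕ) (hg : D.residual n y i = r i - g i)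
    (k : Fin (d + 1)) :
    (D.Φ i k * D.RHat n y i).trace - (D.Φ i k * D.outer r i).trace
      = g i ⬝ᵥ (D.Φ i k *ᵥ g i) - 2 * (g i ⬝ᵥ (D.Φ i k *ᵥ r i)) := by
  rw [RHat, trace_mul_outer, trace_mul_outer, hg, Matrix.mulVec_sub, dotProduct_sub,
    sub_dotProduct, sub_dotProduct]
  have : r i ⬝ᵥ (D.Φ i k *ᵥ g i) = g i ⬝ᵥ (D.Φ i k *ᵥ r i) := by
    rw [Matrix.dotProduct_mulVec, ← Matrix.mulVec_transpose, Φ_transpose, dotProduct_comm]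
  rw [this]
  ring

/-- The estimator `Ξ⁻¹ Υ` of all the variance components. -/
noncomputable def thetaHat (n : ℕ) (R : D.SqMat) : Fin (d + 1) → ℝ :=
  (D.Xi n)⁻¹ *ᵥ D.Upsilon n R

lemma Xi_transpose (n : ℕ) : (D.Xi n)ᵀ = D.Xi n := by
  ext k l
  simp only [Xi, Matrix.transpose_apply, Matrix.of_apply]
  exact Finset.sum_congr rfl fun i _ => Matrix.trace_mul_comm _ _

lemma nuisance_eq (n : ℕ) (R : D.SqMat) (q : Fin d) :
    D.nuisance n R q = D.thetaHat n R q.succ := by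
  have h : ((D.Xi n)⁻¹)ᵀ = (D.Xi n)⁻¹ := by rw [Matrix.transpose_nonsing_inv, Xi_transpose]
  simp only [nuisance, thetaHat, Matrix.mulVec, dotProduct, Matrix.transpose_apply,
    Matrix.submatrix_apply, id]
  refine Finset.sum_congr rfl fun k _ => ?_
  rw [← Matrix.transpose_apply (D.Xi n)⁻¹, h]

lemma Z_eq (n : ℕ) (R : D.SqMat) (θ₁ : ℝ) (i : Fin n) :
    D.Z n R θ₁ i = (D.Φ i 0 * R i).trace - θ₁ * (D.Φ i 0 * D.Φ i 0).trace
      - ∑ q : Fin d, D.thetaHat n R q.succ * (D.Φ i 0 * D.Φ i q.succ).trace := by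
  simp only [Z, Matrix.mul_sub, Matrix.trace_sub, Matrix.mul_smul, Matrix.trace_smul, smul_eq_mul,
    Matrix.mul_sum, Matrix.trace_sum, nuisance_eq]

/-- By the first normal equation, the sum of the estimating functions is a multiple of the
estimation error of the component of interest. -/
lemma sum_Z (n : ℕ) (hXi : IsUnit (D.Xi n)) (R : D.SqMat) (θ₁ : ℝ) :
    ∑ i, D.Z n R θ₁ i = D.Xi n 0 0 * (D.thetaHat n R 0 - θ₁) := by
  have h1 : (D.Xi n *ᵥ D.thetaHat n R) 0 = D.Upsilon n R 0 := by
    rw [thetaHat, Matrix.mulVec_mulVec,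
      Matrix.mul_nonsing_inv _ ((Matrix.isUnit_iff_isUnit_det _).1 hXi), Matrix.one_mulVec]
  rw [Matrix.mulVec, dotProduct, Fin.sum_univ_succ] at h1
  have h2 : ∑ i : Fin n, D.Z n R θ₁ i = D.Upsilon n R 0 - θ₁ * D.Xi n 0 0
      - ∑ q : Fin d, D.Xi n 0 q.succ * D.thetaHat n R q.succ := by
    simp only [Z_eq, Finset.sum_sub_distrib, Upsilon, Xi, Matrix.of_apply, Finset.mul_sum,
      Finset.sum_mul]
    rw [Finset.sum_comm]
    congr 1
    refine Finset.sum_congr rfl fun q _ => Finset.sum_congr rfl fun i _ => mul_comm _ _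
  rw [h2, ← h1]
  ring

section Xi

variable {D} {n : ℕ} {c : ℝ}

lemma isUnit_Xi (hn : 0 < n) (hc : 0 < c)
    (h : ∀ x : Fin (d + 1) → ℝ, c * n * (x ⬝ᵥ x) ≤ x ⬝ᵥ (D.Xi n *ᵥ x)) : IsUnit (D.Xi n) := by
  rw [← Matrix.mulVec_injective_iff_isUnit]
  have hcn : 0 < c * n := mul_pos hc (by exact_mod_cast hn)
  intro x y hxy
  have h1 : D.Xi n *ᵥ (x - y) = 0 := by rw [Matrix.mulVec_sub]; exact sub_eq_zero.2 hxy
  have h2 := h (x - y)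
  rw [h1, dotProduct_zero] at h2
  have h3 : (x - y) ⬝ᵥ (x - y) = 0 :=
    le_antisymm (nonpos_of_mul_nonpos_right h2 hcn) (dotProduct_self_nonneg_real _)
  exact sub_eq_zero.1 (dotProduct_self_eq_zero.1 h3)

/-- The entries of `Ξ⁻¹` are of order `1 / n`. -/
lemma abs_Xi_inv_apply_le (hn : 0 < n) (hc : 0 < c)
    (h : ∀ x : Fin (d + 1) → ℝ, c * n * (x ⬝ᵥ x) ≤ x ⬝ᵥ (D.Xi n *ᵥ x)) (k l : Fin (d + 1)) :
    |(D.Xi n)⁻¹ k l| ≤ (c * n)⁻¹ := by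
  have hcn : 0 < c * n := mul_pos hc (by exact_mod_cast hn)
  have hu := (Matrix.isUnit_iff_isUnit_det _).1 (isUnit_Xi hn hc h)
  set x := (D.Xi n)⁻¹ *ᵥ Pi.single l 1 with hx
  have hxk : ∀ k, (D.Xi n)⁻¹ k l = x k := fun k => by rw [hx]; simp
  have h1 : D.Xi n *ᵥ x = Pi.single l 1 := by
    rw [hx, Matrix.mulVec_mulVec, Matrix.mul_nonsing_inv _ hu, Matrix.one_mulVec]
  have h2 := h x
  rw [h1, dotProduct_single, mul_one] at h2
  have h3 : ∀ k, x k ^ 2 ≤ x ⬝ᵥ x := fun k => by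
    rw [pow_two]
    exact Finset.single_le_sum (f := fun k => x k * x k) (fun i _ => mul_self_nonneg _)
      (Finset.mem_univ k)
  have h4 : |x l| ≤ (c * n)⁻¹ := by
    have h5 : c * n * |x l| ^ 2 ≤ |x l| := by
      rw [sq_abs]
      exact (mul_le_mul_of_nonneg_left (h3 l) hcn.le).trans (h2.trans (le_abs_self _))
    rcases eq_or_lt_of_le (abs_nonneg (x l)) with h0 | h0
    · rw [← h0]; positivity
    · rw [← one_div, le_div_iff₀ hcn]
      have : (|x l| * (c * n)) * |x l| ≤ 1 * |x l| := by linarith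
      exact le_of_mul_le_mul_right this h0
  rw [hxk]
  refine abs_le_of_sq_le_sq ?_ (by positivity)
  have h6 : x ⬝ᵥ x ≤ (c * n)⁻¹ * x l := by rwa [le_inv_mul_iff₀ hcn]
  calc x k ^ 2 ≤ (c * n)⁻¹ * x l := (h3 k).trans h6
    _ ≤ (c * n)⁻¹ * (c * n)⁻¹ := by
        refine mul_le_mul_of_nonneg_left ((le_abs_self _).trans h4) (by positivity)
    _ = _ := (pow_two _).symm

lemma abs_Xi_apply_le {F : ℝ} (hF : ∀ i k, ((D.Φ i k)ᵀ * D.Φ i k).trace ≤ F ^ 2)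
    (k l : Fin (d + 1)) : |D.Xi n k l| ≤ n * F ^ 2 := by
  rw [Xi, Matrix.of_apply]
  calc |∑ i : Fin n, (D.Φ i k * D.Φ i l).trace| ≤ ∑ i : Fin n, |(D.Φ i k * D.Φ i l).trace| :=
        Finset.abs_sum_le_sum_abs _ _
    _ ≤ ∑ _i : Fin n, F ^ 2 := Finset.sum_le_sum fun i _ => abs_trace_mul_le (hF i k) (hF i l)
    _ = _ := by simp

lemma le_Xi_zero_zero (h : ∀ x : Fin (d + 1) → ℝ, c * n * (x ⬝ᵥ x) ≤ x ⬝ᵥ (D.Xi n *ᵥ x)) :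
    c * n ≤ D.Xi n 0 0 := by
  simpa using h (Pi.single 0 1)

end Xi

end MixedDesign

/-! ### Moments of the errors and of their quadratic forms -/

lemma add_rpow_le_two_rpow_mul {x y s : ℝ} (hx : 0 ≤ x) (hy : 0 ≤ y) (hs : 0 ≤ s) :
    (x + y) ^ s ≤ 2 ^ s * (x ^ s + y ^ s) := by
  have hx' := Real.rpow_nonneg hx s
  have hy' := Real.rpow_nonneg hy s
  have h2 : (0 : ℝ) ≤ 2 ^ s := by positivity
  rcases le_total x y with h | h
  · calc (x + y) ^ s ≤ (2 * y) ^ s := Real.rpow_le_rpow (by linarith) (by linarith) hs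
      _ = 2 ^ s * y ^ s := Real.mul_rpow (by norm_num) hy
      _ ≤ _ := by gcongr; linarith
  · calc (x + y) ^ s ≤ (2 * x) ^ s := Real.rpow_le_rpow (by linarith) (by linarith) hs
      _ = 2 ^ s * x ^ s := Real.mul_rpow (by norm_num) hx
      _ ≤ _ := by gcongr; linarith

lemma rpow_le_one_add_rpow {x s t : ℝ} (hx : 0 ≤ x) (hs : 0 ≤ s) (hst : s ≤ t) :
    x ^ s ≤ 1 + x ^ t := by
  rcases le_total x 1 with h | h
  · linarith [Real.rpow_le_one hx h hs, Real.rpow_nonneg hx t]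
  · linarith [Real.rpow_le_rpow_of_exponent_le h hst]

namespace MixedDesign

variable {p d : ℕ} {D : MixedDesign p d}

lemma obsInner_sum_smul_left (n : ℕ) {ι : Type*} (s : Finset ι) (t : ι → ℝ) (a : ι → D.Obs)
    (b : D.Obs) :
    D.obsInner n (fun i => ∑ l ∈ s, t l • a l i) b = ∑ l ∈ s, t l * D.obsInner n (a l) b := by
  simp only [obsInner, sum_dotProduct, smul_dotProduct, smul_eq_mul, Finset.mul_sum]
  exact Finset.sum_comm

lemma obsInner_comm (n : ℕ) (a b : D.Obs) : D.obsInner n a b = D.obsInner n b a :=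
  Finset.sum_congr rfl fun _ _ => dotProduct_comm _ _

lemma obsInner_applyΦ (n : ℕ) (k : Fin (d + 1)) (a b : D.Obs) :
    D.obsInner n a (D.applyΦ k b) = D.obsInner n (D.applyΦ k a) b := by
  refine Finset.sum_congr rfl fun i _ => ?_
  rw [applyΦ, applyΦ, Matrix.dotProduct_mulVec, ← Matrix.mulVec_transpose, Φ_transpose]

/-- The effect of estimating the fixed effects is at most `Q`: the differences `g` between the
errors `r` and the residuals have `∑ ‖g_i‖² ≤ Q` and `|∑ g_i Φ_{ik} r_i| ≤ Q`. -/
def IsResidualBound (D : MixedDesign p d) (n : ℕ) (y r : D.Obs) (Q : ℝ) : Prop :=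
  ∃ g : D.Obs, (∀ i, D.residual n y i = r i - g i) ∧ D.obsInner n g g ≤ Q ∧
    ∀ k, |D.obsInner n g (D.applyΦ k r)| ≤ Q

/-- The standing assumptions on the errors `r` and on the matrices `Φ`: independence, the first two
moments of the model, moments of order `2 + δ` of the squared norms bounded by `C`, and Frobenius
norms bounded by `F`. -/
structure ErrorModel {Ω : Type*} [MeasurableSpace Ω] (D : MixedDesign p d) (P : Measure Ω)
    (r : Ω → D.Obs) (θ : Fin (d + 1) → ℝ) (δ C F : ℝ) : Prop where
  measurable : ∀ i, Measurable fun ω => r ω i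
  indep : iIndepFun (fun i ω => r ω i) P
  mean : ∀ i j, ∫ ω, r ω i j ∂P = 0
  cov : ∀ i j k, cov[fun ω => r ω i j, fun ω => r ω i k; P] = D.H θ i j k
  δ_pos : 0 < δ
  δ_le_one : δ ≤ 1
  moment : ∀ i, Integrable (fun ω => (r ω i ⬝ᵥ r ω i) ^ (2 + δ)) P ∧
    ∫ ω, (r ω i ⬝ᵥ r ω i) ^ (2 + δ) ∂P ≤ C
  F_nonneg : 0 ≤ F
  trace_le : ∀ i k, ((D.Φ i k)ᵀ * D.Φ i k).trace ≤ F ^ 2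

namespace ErrorModel

variable {Ω : Type*} [MeasurableSpace Ω] {P : Measure Ω} {r : Ω → D.Obs} {θ : Fin (d + 1) → ℝ}
  {δ C F : ℝ}

lemma C_nonneg (h : ErrorModel D P r θ δ C F) : 0 ≤ C :=
  (integral_nonneg fun ω => Real.rpow_nonneg (dotProduct_self_nonneg_real (r ω 0)) _).trans
    (h.moment 0).2

lemma measurable_apply (h : ErrorModel D P r θ δ C F) (i : ℕ) (j : Fin (D.size i)) :
    Measurable fun ω => r ω i j :=
  measurable_pi_iff.1 (h.measurable i) j

lemma measurable_sqNorm (h : ErrorModel D P r θ δ C F) (i : ℕ) :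
    Measurable fun ω => r ω i ⬝ᵥ r ω i := by
  have := h.measurable_apply i
  simp only [dotProduct]
  fun_prop

variable [IsProbabilityMeasure P]

lemma integrable_sqNorm_rpow (h : ErrorModel D P r θ δ C F) (i : ℕ) {s : ℝ} (hs : 0 ≤ s)
    (hs' : s ≤ 2 + δ) : Integrable (fun ω => (r ω i ⬝ᵥ r ω i) ^ s) P ∧
      ∫ ω, (r ω i ⬝ᵥ r ω i) ^ s ∂P ≤ 1 + C := by
  have hle : ∀ ω, (r ω i ⬝ᵥ r ω i) ^ s ≤ 1 + (r ω i ⬝ᵥ r ω i) ^ (2 + δ) := fun ω =>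
    rpow_le_one_add_rpow (dotProduct_self_nonneg_real _) hs hs'
  have hi : Integrable (fun ω => (r ω i ⬝ᵥ r ω i) ^ s) P := by
    refine ((integrable_const (1 : ℝ)).add (h.moment i).1).mono'
      ((h.measurable_sqNorm i).pow_const s).aestronglyMeasurable (Eventually.of_forall fun ω => ?_)
    rw [Real.norm_eq_abs, abs_of_nonneg (Real.rpow_nonneg (dotProduct_self_nonneg_real _) _)]
    exact hle ω
  refine ⟨hi, (integral_mono hi ((integrable_const (1 : ℝ)).add (h.moment i).1) hle).trans ?_⟩
  simp only [Pi.add_apply]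
  rw [integral_add (integrable_const _) (h.moment i).1]
  simpa using (h.moment i).2

lemma integrable_sqNorm (h : ErrorModel D P r θ δ C F) (i : ℕ) :
    Integrable (fun ω => r ω i ⬝ᵥ r ω i) P ∧ ∫ ω, r ω i ⬝ᵥ r ω i ∂P ≤ 1 + C := by
  simpa using h.integrable_sqNorm_rpow i zero_le_one (by linarith [h.δ_pos])

lemma integrable_sqNorm_sq (h : ErrorModel D P r θ δ C F) (i : ℕ) :
    Integrable (fun ω => (r ω i ⬝ᵥ r ω i) ^ 2) P ∧ ∫ ω, (r ω i ⬝ᵥ r ω i) ^ 2 ∂P ≤ 1 + C := by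
  simpa using h.integrable_sqNorm_rpow i zero_le_two (by linarith [h.δ_pos])

lemma memLp_apply (h : ErrorModel D P r θ δ C F) (i : ℕ) (j : Fin (D.size i)) :
    MemLp (fun ω => r ω i j) 2 P := by
  rw [memLp_two_iff_integrable_sq (h.measurable_apply i j).aestronglyMeasurable]
  refine (h.integrable_sqNorm i).1.mono' ((h.measurable_apply i j).pow_const 2).aestronglyMeasurable
    (Eventually.of_forall fun ω => ?_)
  rw [Real.norm_eq_abs, abs_of_nonneg (sq_nonneg _), pow_two]
  exact Finset.single_le_sum (f := fun j => r ω i j * r ω i j) (fun _ _ => mul_self_nonneg _)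
    (Finset.mem_univ j)

/-- Moments of a linear form of one error vector. -/
lemma linearForm (h : ErrorModel D P r θ δ C F) (i : ℕ) (a : Fin (D.size i) → ℝ) :
    Measurable (fun ω => a ⬝ᵥ r ω i) ∧ ∫ ω, a ⬝ᵥ r ω i ∂P = 0 ∧
      Integrable (fun ω => (a ⬝ᵥ r ω i) ^ 4) P ∧
      ∫ ω, (a ⬝ᵥ r ω i) ^ 2 ∂P ≤ (1 + C) * (a ⬝ᵥ a) ∧
      ∫ ω, (a ⬝ᵥ r ω i) ^ 4 ∂P ≤ ((1 + C) * (a ⬝ᵥ a)) ^ 2 := by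
  have hm : Measurable fun ω => a ⬝ᵥ r ω i := by
    have := h.measurable_apply i
    simp only [dotProduct]
    fun_prop
  have h2 : ∀ ω, (a ⬝ᵥ r ω i) ^ 2 ≤ (a ⬝ᵥ a) * (r ω i ⬝ᵥ r ω i) := fun ω => dotProduct_sq_le _ _
  have h4 : ∀ ω, (a ⬝ᵥ r ω i) ^ 4 ≤ (a ⬝ᵥ a) ^ 2 * (r ω i ⬝ᵥ r ω i) ^ 2 := fun ω => by
    have := pow_le_pow_left₀ (sq_nonneg _) (h2 ω) 2
    rwa [← pow_mul, mul_pow] at this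
  have ha := dotProduct_self_nonneg_real a
  have i2 : Integrable (fun ω => (a ⬝ᵥ r ω i) ^ 2) P :=
    ((h.integrable_sqNorm i).1.const_mul (a ⬝ᵥ a)).mono' (hm.pow_const 2).aestronglyMeasurable
      (Eventually.of_forall fun ω => by
        rw [Real.norm_eq_abs, abs_of_nonneg (sq_nonneg _)]; exact h2 ω)
  have i4 : Integrable (fun ω => (a ⬝ᵥ r ω i) ^ 4) P :=
    ((h.integrable_sqNorm_sq i).1.const_mul ((a ⬝ᵥ a) ^ 2)).mono'
      (hm.pow_const 4).aestronglyMeasurable (Eventually.of_forall fun ω => by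
        rw [Real.norm_eq_abs, abs_of_nonneg (by positivity)]; exact h4 ω)
  refine ⟨hm, ?_, i4, ?_, ?_⟩
  · simp only [dotProduct]
    rw [integral_finsetSum _ fun j _ =>
      ((h.memLp_apply i j).integrable one_le_two).const_mul (a j)]
    simp [integral_const_mul, h.mean]
  · refine (integral_mono i2 ((h.integrable_sqNorm i).1.const_mul _) h2).trans ?_
    rw [integral_const_mul, mul_comm]
    exact mul_le_mul_of_nonneg_right (h.integrable_sqNorm i).2 ha
  · refine (integral_mono i4 ((h.integrable_sqNorm_sq i).1.const_mul _) h4).trans ?_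
    rw [integral_const_mul, mul_pow, mul_comm]
    refine mul_le_mul_of_nonneg_right ((h.integrable_sqNorm_sq i).2.trans ?_) (sq_nonneg _)
    nlinarith [h.C_nonneg]

/-- Fourth moments of linear forms of the stacked error vector. -/
lemma integral_obsInner_pow_four_le (h : ErrorModel D P r θ δ C F) (n : ℕ) (a : D.Obs) :
    Integrable (fun ω => D.obsInner n a (r ω) ^ 4) P ∧
      ∫ ω, D.obsInner n a (r ω) ^ 4 ∂P ≤ 3 * ((1 + C) * D.obsInner n a a) ^ 2 := by
  have hind : iIndepFun (fun i ω => a i ⬝ᵥ r ω i) P :=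
    h.indep.comp (fun i x => a i ⬝ᵥ x) fun i => by simp only [dotProduct]; fun_prop
  have := integral_sum_pow_four_le hind (fun i => (h.linearForm i (a i)).1)
    (fun i => (h.linearForm i (a i)).2.1) (fun i => (h.linearForm i (a i)).2.2.1)
    (by linarith [h.C_nonneg] : 0 ≤ 1 + C) (fun i => dotProduct_self_nonneg_real (a i))
    (fun i => (h.linearForm i (a i)).2.2.2.1) (fun i => (h.linearForm i (a i)).2.2.2.2) n
  simpa only [obsInner, Finset.sum_range] using this

/-- The effect of estimating the fixed effects is bounded in `L²`. The bound `Q n` is the sum of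
the squares of finitely many linear forms of the errors, because the projection on the column space
of the design has rank at most `p`. -/
lemma exists_residual_bound (h : ErrorModel D P r θ δ C F)
    (hX : ∀ᶠ n in atTop, IsUnit ((D.stackX n)ᵀ * D.stackX n)) :
    ∃ (Q : ℕ → Ω → ℝ) (K : ℝ), (∀ n ω, 0 ≤ Q n ω) ∧ ∀ᶠ n in atTop,
      (Integrable (fun ω => Q n ω ^ 2) P ∧ ∫ ω, Q n ω ^ 2 ∂P ≤ K) ∧
      ∀ (β : Fin p → ℝ) (y : D.Obs) (ω : Ω), (∀ i, y i = D.X i *ᵥ β + r ω i) →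
        IsResidualBound D n y (r ω) (Q n ω) := by
  have hex : ∀ n, ∃ u : Fin p → D.Obs, IsUnit ((D.stackX n)ᵀ * D.stackX n) →
      (∀ l m, D.obsInner n (u l) (u m) = if l = m then 1 else 0) ∧
      ∀ (β : Fin p → ℝ) (y r : D.Obs), (∀ i, y i = D.X i *ᵥ β + r i) →
        ∀ i, D.residual n y i = r i - ∑ l, D.obsInner n (u l) r • u l i := fun n => by
    by_cases hn : IsUnit ((D.stackX n)ᵀ * D.stackX n)
    · obtain ⟨u, hu⟩ := D.exists_residual_eq n hn
      exact ⟨u, fun _ => hu⟩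
    · exact ⟨fun _ _ => 0, fun h => absurd h hn⟩
  choose u hu using hex
  let a : ℕ → Fin p × Option (Fin (d + 1)) → D.Obs := fun n x =>
    x.2.elim (u n x.1) fun k => D.applyΦ k (u n x.1)
  let Q : ℕ → Ω → ℝ := fun n ω => ∑ x, D.obsInner n (a n x) (r ω) ^ 2
  refine ⟨Q, Fintype.card (Fin p × Option (Fin (d + 1))) *
    ∑ _x : Fin p × Option (Fin (d + 1)), 3 * ((1 + C) * (1 + F ^ 2)) ^ 2,
    fun n ω => Finset.sum_nonneg fun _ _ => sq_nonneg _, ?_⟩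
  filter_upwards [hX] with n hn
  obtain ⟨hu1, hu2⟩ := hu n hn
  have hnorm : ∀ x, 0 ≤ D.obsInner n (a n x) (a n x) ∧
      D.obsInner n (a n x) (a n x) ≤ 1 + F ^ 2 := fun x => by
    refine ⟨Finset.sum_nonneg fun i _ => dotProduct_self_nonneg_real _, ?_⟩
    obtain ⟨l, o⟩ := x
    have h1 : D.obsInner n (u n l) (u n l) = 1 := by simp [hu1]
    rcases o with _ | k
    · simp only [a, Option.elim]
      rw [h1]
      linarith [sq_nonneg F]
    · have h2 : D.obsInner n (D.applyΦ k (u n l)) (D.applyΦ k (u n l))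
          ≤ F ^ 2 * D.obsInner n (u n l) (u n l) := by
        simp only [obsInner, Finset.mul_sum]
        refine Finset.sum_le_sum fun i _ => ?_
        exact (mulVec_dotProduct_self_le _ _).trans (mul_le_mul_of_nonneg_right
          (h.trace_le i k) (dotProduct_self_nonneg_real _))
      simp only [a, Option.elim]
      rw [h1] at h2
      linarith
  have hQ2 : ∀ ω, Q n ω ^ 2 ≤ Fintype.card (Fin p × Option (Fin (d + 1))) *
      ∑ x, D.obsInner n (a n x) (r ω) ^ 4 := fun ω => by
    have := sq_sum_le_card_mul_sum_sq (s := Finset.univ)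
      (f := fun x => D.obsInner n (a n x) (r ω) ^ 2)
    simpa only [← pow_mul, Finset.card_univ] using this
  have hi : Integrable (fun ω => (Fintype.card (Fin p × Option (Fin (d + 1))) : ℝ) *
      ∑ x, D.obsInner n (a n x) (r ω) ^ 4) P :=
    (integrable_finsetSum _ fun x _ => (h.integral_obsInner_pow_four_le n (a n x)).1).const_mul _
  have hQm : Measurable (Q n) := by
    have := h.measurable_apply
    simp only [Q, obsInner, dotProduct]
    fun_prop
  have hQi : Integrable (fun ω => Q n ω ^ 2) P :=
    hi.mono' (hQm.pow_const 2).aestronglyMeasurable (Eventually.of_forall fun ω => by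
      rw [Real.norm_eq_abs, abs_of_nonneg (sq_nonneg _)]; exact hQ2 ω)
  refine ⟨⟨hQi, (integral_mono hQi hi hQ2).trans ?_⟩, fun β y ω hy => ?_⟩
  · rw [integral_const_mul,
      integral_finsetSum _ fun x _ => (h.integral_obsInner_pow_four_le n (a n x)).1]
    refine mul_le_mul_of_nonneg_left (Finset.sum_le_sum fun x _ => ?_) (Nat.cast_nonneg _)
    refine (h.integral_obsInner_pow_four_le n (a n x)).2.trans ?_
    have h1 : 0 ≤ 1 + C := by linarith [h.C_nonneg]
    have h2 := (hnorm x).1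
    have h3 := (hnorm x).2
    gcongr
  · have hQeq : Q n ω = ∑ l, (D.obsInner n (u n l) (r ω) ^ 2
        + ∑ k, D.obsInner n (D.applyΦ k (u n l)) (r ω) ^ 2) := by
      simp only [Q, a, Fintype.sum_prod_type, Fintype.sum_option, Option.elim]
    refine ⟨fun i => ∑ l, D.obsInner n (u n l) (r ω) • u n l i, hu2 β y (r ω) hy, ?_, fun k => ?_⟩
    · rw [obsInner_sum_smul_left, hQeq]
      refine Finset.sum_le_sum fun l _ => ?_
      have hproj : D.obsInner n (u n l) (fun i => ∑ l, D.obsInner n (u n l) (r ω) • u n l i)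
          = D.obsInner n (u n l) (r ω) := by
        rw [obsInner_comm, obsInner_sum_smul_left]
        simp [hu1]
      rw [hproj, ← pow_two]
      exact le_add_of_nonneg_right (Finset.sum_nonneg fun _ _ => sq_nonneg _)
    · rw [obsInner_sum_smul_left, hQeq]
      refine (Finset.abs_sum_le_sum_abs _ _).trans (Finset.sum_le_sum fun l _ => ?_)
      rw [obsInner_applyΦ]
      have h1 : D.obsInner n (D.applyΦ k (u n l)) (r ω) ^ 2
          ≤ ∑ k, D.obsInner n (D.applyΦ k (u n l)) (r ω) ^ 2 :=
        Finset.single_le_sum (f := fun k => D.obsInner n (D.applyΦ k (u n l)) (r ω) ^ 2)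
          (fun _ _ => sq_nonneg _) (Finset.mem_univ k)
      rw [abs_mul]
      nlinarith [sq_nonneg (|D.obsInner n (u n l) (r ω)| -
        |D.obsInner n (D.applyΦ k (u n l)) (r ω)|), sq_abs (D.obsInner n (u n l) (r ω)),
        sq_abs (D.obsInner n (D.applyΦ k (u n l)) (r ω)), sq_nonneg (D.obsInner n (u n l) (r ω)),
        sq_nonneg (D.obsInner n (D.applyΦ k (u n l)) (r ω))]

end ErrorModel

/-- The centred quadratic form `∑ k, α k (tr(Φ_{ik} R_i) - E tr(Φ_{ik} R_i))`. -/
noncomputable def centredForm {Ω : Type*} [MeasurableSpace Ω] (D : MixedDesign p d) (P : Measure Ω)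
    (r : Ω → D.Obs) (α : Fin (d + 1) → ℝ) (i : ℕ) (ω : Ω) : ℝ :=
  ∑ k, α k * ((D.Φ i k * D.outer (r ω) i).trace - ∫ ω, (D.Φ i k * D.outer (r ω) i).trace ∂P)

namespace ErrorModel

variable {Ω : Type*} [MeasurableSpace Ω] {P : Measure Ω} {r : Ω → D.Obs} {θ : Fin (d + 1) → ℝ}
  {δ C F : ℝ}

lemma abs_trace_le (h : ErrorModel D P r θ δ C F) (i : ℕ) (k : Fin (d + 1)) (ω : Ω) :
    |(D.Φ i k * D.outer (r ω) i).trace| ≤ F * (r ω i ⬝ᵥ r ω i) := by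
  rw [trace_mul_outer]
  exact abs_dotProduct_mulVec_self_le h.F_nonneg (h.trace_le i k) _

lemma measurable_trace (h : ErrorModel D P r θ δ C F) (i : ℕ) (k : Fin (d + 1)) :
    Measurable fun ω => (D.Φ i k * D.outer (r ω) i).trace := by
  have := h.measurable_apply i
  simp only [trace_mul_outer, dotProduct, Matrix.mulVec]
  fun_prop

lemma measurable_centredForm (h : ErrorModel D P r θ δ C F) (α : Fin (d + 1) → ℝ) (i : ℕ) :
    Measurable (D.centredForm P r α i) := by
  have := h.measurable_trace i
  unfold centredForm
  fun_prop

lemma iIndepFun_centredForm (h : ErrorModel D P r θ δ C F) (α : Fin (d + 1) → ℝ) :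
    iIndepFun (D.centredForm P r α) P := by
  have := h.indep.comp (fun i x => ∑ k, α k * ((D.Φ i k * Matrix.vecMulVec x x).trace
    - ∫ ω, (D.Φ i k * D.outer (r ω) i).trace ∂P)) fun i => by
      simp only [trace_mul_vecMulVec_self, dotProduct, Matrix.mulVec]
      fun_prop
  exact this

variable [IsProbabilityMeasure P]

lemma integrable_trace (h : ErrorModel D P r θ δ C F) (i : ℕ) (k : Fin (d + 1)) :
    Integrable (fun ω => (D.Φ i k * D.outer (r ω) i).trace) P :=
  ((h.integrable_sqNorm i).1.const_mul F).mono' (h.measurable_trace i k).aestronglyMeasurable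
    (Eventually.of_forall fun ω => h.abs_trace_le i k ω)

lemma abs_integral_trace_le (h : ErrorModel D P r θ δ C F) (i : ℕ) (k : Fin (d + 1)) :
    |∫ ω, (D.Φ i k * D.outer (r ω) i).trace ∂P| ≤ F * (1 + C) := by
  refine (abs_integral_le_integral_abs).trans ((integral_mono (h.integrable_trace i k).abs
    ((h.integrable_sqNorm i).1.const_mul F) fun ω => h.abs_trace_le i k ω).trans ?_)
  rw [integral_const_mul]
  exact mul_le_mul_of_nonneg_left (h.integrable_sqNorm i).2 h.F_nonneg

lemma integral_trace (h : ErrorModel D P r θ δ C F) (i : ℕ) (k : Fin (d + 1)) :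
    ∫ ω, (D.Φ i k * D.outer (r ω) i).trace ∂P = ∑ l, (D.Φ i k * D.Φ i l).trace * θ l := by
  have hprod : ∀ j l, ∫ ω, r ω i l * r ω i j ∂P = D.H θ i l j := fun j l => by
    have h1 := h.cov i l j
    rw [covariance_eq_sub (h.memLp_apply i l) (h.memLp_apply i j), h.mean, h.mean] at h1
    simpa using h1
  have hint : ∀ j l, Integrable (fun ω => r ω i l * r ω i j) P := fun j l =>
    (h.memLp_apply i l).integrable_mul (h.memLp_apply i j)
  let e : Fin (D.size i) → Fin (D.size i) → ℝ := fun j l => D.Φ i k j l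
  have h1 : ∀ ω, (D.Φ i k * D.outer (r ω) i).trace
      = ∑ j, ∑ l, e j l * (r ω i l * r ω i j) := fun ω => by
    simp only [Matrix.trace, Matrix.diag, Matrix.mul_apply, outer, Matrix.vecMulVec_apply, e]
  simp only [h1]
  rw [integral_finsetSum _ fun j _ => integrable_finsetSum _ fun l _ => (hint j l).const_mul _]
  have h2 : ∀ j, ∫ ω, ∑ l, e j l * (r ω i l * r ω i j) ∂P
      = ∑ l, e j l * D.H θ i l j := fun j => by
    rw [integral_finsetSum _ fun l _ => (hint j l).const_mul _]
    simp only [integral_const_mul, hprod]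
  simp only [h2]
  have h3 : ∑ j, ∑ l, e j l * D.H θ i l j = (D.Φ i k * D.H θ i).trace := by
    simp only [Matrix.trace, Matrix.diag, Matrix.mul_apply, e]
  rw [h3, H, Matrix.mul_sum, Matrix.trace_sum]
  simp only [Matrix.mul_smul, Matrix.trace_smul, smul_eq_mul, mul_comm]

lemma sum_integral_trace (h : ErrorModel D P r θ δ C F) (n : ℕ) (k : Fin (d + 1)) :
    ∑ i : Fin n, ∫ ω, (D.Φ i k * D.outer (r ω) i).trace ∂P = (D.Xi n *ᵥ θ) k := by
  simp only [h.integral_trace, Matrix.mulVec, dotProduct, Xi, Matrix.of_apply, Finset.sum_mul]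
  exact Finset.sum_comm

section CentredForm

variable {α : Fin (d + 1) → ℝ} {A : ℝ}

lemma integral_centredForm (h : ErrorModel D P r θ δ C F) (α : Fin (d + 1) → ℝ) (i : ℕ) :
    ∫ ω, D.centredForm P r α i ω ∂P = 0 := by
  have hi : ∀ k, Integrable (fun ω => α k * ((D.Φ i k * D.outer (r ω) i).trace
      - ∫ ω, (D.Φ i k * D.outer (r ω) i).trace ∂P)) P := fun k =>
    ((h.integrable_trace i k).sub (integrable_const _)).const_mul (α k)
  unfold centredForm
  rw [integral_finsetSum _ fun k _ => hi k]
  refine Finset.sum_eq_zero fun k _ => ?_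
  rw [integral_const_mul, integral_sub (h.integrable_trace i k) (integrable_const _)]
  simp

lemma abs_centredForm_le (h : ErrorModel D P r θ δ C F) (hα : ∀ k, |α k| ≤ A) (i : ℕ) (ω : Ω) :
    |D.centredForm P r α i ω| ≤ (d + 1) * A * F * (r ω i ⬝ᵥ r ω i + (1 + C)) := by
  have hA : 0 ≤ A := (abs_nonneg _).trans (hα 0)
  have hterm : ∀ k, |α k * ((D.Φ i k * D.outer (r ω) i).trace
      - ∫ ω, (D.Φ i k * D.outer (r ω) i).trace ∂P)|
        ≤ A * (F * (r ω i ⬝ᵥ r ω i + (1 + C))) := fun k => by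
    rw [abs_mul]
    refine mul_le_mul (hα k) ((abs_sub _ _).trans ?_) (abs_nonneg _) hA
    linarith [h.abs_trace_le i k ω, h.abs_integral_trace_le i k]
  refine (Finset.abs_sum_le_sum_abs _ _).trans ((Finset.sum_le_sum fun k _ => hterm k).trans ?_)
  rw [Finset.sum_const, Finset.card_univ, Fintype.card_fin, nsmul_eq_mul]
  push_cast
  linarith

/-- The centred forms with bounded coefficients have uniformly bounded moments of order `2 + δ`. -/
lemma exists_moment_centredForm (h : ErrorModel D P r θ δ C F) (A : ℝ) :
    ∃ K : ℝ, 0 ≤ K ∧ ∀ α : Fin (d + 1) → ℝ, (∀ k, |α k| ≤ A) → ∀ i,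
      (Integrable (fun ω => |D.centredForm P r α i ω| ^ (2 + δ)) P ∧
        ∫ ω, |D.centredForm P r α i ω| ^ (2 + δ) ∂P ≤ K) ∧
      MemLp (D.centredForm P r α i) 2 P ∧ ∫ ω, D.centredForm P r α i ω ^ 2 ∂P ≤ K := by
  have hs : 0 ≤ 2 + δ := by linarith [h.δ_pos]
  have hC := h.C_nonneg
  set c := ((d + 1) * |A| * F) ^ (2 + δ) * 2 ^ (2 + δ) with hc
  have hF := h.F_nonneg
  have hc0 : 0 ≤ c := by positivity
  set K := c * (C + (1 + C) ^ (2 + δ)) with hK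
  have hK0 : 0 ≤ K := by positivity
  refine ⟨1 + K, by linarith, fun α hα i => ?_⟩
  have hm := h.measurable_centredForm α i
  have hb : ∀ ω, |D.centredForm P r α i ω| ^ (2 + δ)
      ≤ c * ((r ω i ⬝ᵥ r ω i) ^ (2 + δ) + (1 + C) ^ (2 + δ)) := fun ω => by
    have hq := dotProduct_self_nonneg_real (r ω i)
    calc |D.centredForm P r α i ω| ^ (2 + δ)
        ≤ ((d + 1) * |A| * F * (r ω i ⬝ᵥ r ω i + (1 + C))) ^ (2 + δ) :=
          Real.rpow_le_rpow (abs_nonneg _)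
            (h.abs_centredForm_le (fun k => (hα k).trans (le_abs_self A)) i ω) hs
      _ = ((d + 1) * |A| * F) ^ (2 + δ) * (r ω i ⬝ᵥ r ω i + (1 + C)) ^ (2 + δ) :=
          Real.mul_rpow (by positivity) (by positivity)
      _ ≤ ((d + 1) * |A| * F) ^ (2 + δ)
            * (2 ^ (2 + δ) * ((r ω i ⬝ᵥ r ω i) ^ (2 + δ) + (1 + C) ^ (2 + δ))) := by
          refine mul_le_mul_of_nonneg_left ?_ (by positivity)
          exact add_rpow_le_two_rpow_mul hq (by linarith) hs
      _ = _ := by rw [hc]; ring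
  have hbi : Integrable (fun ω => c * ((r ω i ⬝ᵥ r ω i) ^ (2 + δ) + (1 + C) ^ (2 + δ))) P :=
    ((h.moment i).1.add (integrable_const _)).const_mul c
  have hi : Integrable (fun ω => |D.centredForm P r α i ω| ^ (2 + δ)) P :=
    hbi.mono' ((hm.abs).pow_const _).aestronglyMeasurable (Eventually.of_forall fun ω => by
      rw [Real.norm_eq_abs, abs_of_nonneg (Real.rpow_nonneg (abs_nonneg _) _)]; exact hb ω)
  have hle : ∫ ω, |D.centredForm P r α i ω| ^ (2 + δ) ∂P ≤ K := by
    refine (integral_mono hi hbi hb).trans ?_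
    rw [integral_const_mul, integral_add (h.moment i).1 (integrable_const _), hK]
    refine mul_le_mul_of_nonneg_left ?_ hc0
    simpa using (h.moment i).2
  have hsq : ∀ ω, D.centredForm P r α i ω ^ 2 ≤ 1 + |D.centredForm P r α i ω| ^ (2 + δ) :=
      fun ω => by
    have := rpow_le_one_add_rpow (abs_nonneg (D.centredForm P r α i ω)) zero_le_two
      (show (2 : ℝ) ≤ 2 + δ by linarith [h.δ_pos])
    simpa using this
  have hsqi : Integrable (fun ω => D.centredForm P r α i ω ^ 2) P :=
    ((integrable_const (1 : ℝ)).add hi).mono' (hm.pow_const 2).aestronglyMeasurable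
      (Eventually.of_forall fun ω => by
        rw [Real.norm_eq_abs, abs_of_nonneg (sq_nonneg _)]; exact hsq ω)
  refine ⟨⟨hi, by linarith⟩, (memLp_two_iff_integrable_sq hm.aestronglyMeasurable).2 hsqi, ?_⟩
  refine (integral_mono hsqi ((integrable_const (1 : ℝ)).add hi) hsq).trans ?_
  simp only [Pi.add_apply]
  rw [integral_add (integrable_const _) hi]
  simpa using hle

/-- Sums of centred forms with bounded coefficients are of order `√n` in `L²`. -/
lemma exists_integral_sum_centredForm_sq_le (h : ErrorModel D P r θ δ C F) (A : ℝ) :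
    ∃ K : ℝ, 0 ≤ K ∧ ∀ α : Fin (d + 1) → ℝ, (∀ k, |α k| ≤ A) → ∀ n : ℕ,
      MemLp (fun ω => ∑ i ∈ Finset.range n, D.centredForm P r α i ω) 2 P ∧
      ∫ ω, ∑ i ∈ Finset.range n, D.centredForm P r α i ω ∂P = 0 ∧
      ∫ ω, (∑ i ∈ Finset.range n, D.centredForm P r α i ω) ^ 2 ∂P ≤ n * K := by
  obtain ⟨K, hK0, hK⟩ := h.exists_moment_centredForm A
  refine ⟨K, hK0, fun α hα n => ?_⟩
  have hL := fun i => (hK α hα i).2.1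
  have hsumL : MemLp (fun ω => ∑ i ∈ Finset.range n, D.centredForm P r α i ω) 2 P :=
    memLp_finsetSum (Finset.range n) fun i _ => hL i
  have h0 : ∫ ω, ∑ i ∈ Finset.range n, D.centredForm P r α i ω ∂P = 0 := by
    rw [integral_finsetSum _ fun i _ => (hL i).integrable one_le_two]
    simp [h.integral_centredForm]
  refine ⟨hsumL, h0, ?_⟩
  rw [← variance_of_integral_eq_zero hsumL.aemeasurable h0]
  have h1 := IndepFun.variance_sum (s := Finset.range n) (fun i _ => hL i)
    fun i _ j _ hij => (h.iIndepFun_centredForm α).indepFun hij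
  have h2 : (∑ i ∈ Finset.range n, D.centredForm P r α i)
      = fun ω => ∑ i ∈ Finset.range n, D.centredForm P r α i ω := by
    funext ω; simp
  rw [h2] at h1
  rw [h1]
  refine (Finset.sum_le_sum fun i _ => ?_).trans 
    (le_of_eq (by simp : ∑ _i ∈ Finset.range n, K = n * K))
  rw [variance_of_integral_eq_zero (hL i).aemeasurable (h.integral_centredForm α i)]
  exact (hK α hα i).2.2

end CentredForm

end ErrorModel

end MixedDesign

/-! ### Replacing the errors by the residuals -/

namespace MixedDesign

variable {p d : ℕ} {D : MixedDesign p d}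

namespace IsResidualBound

variable {n : ℕ} {y r : D.Obs} {Q F : ℝ}

lemma abs_Upsilon_sub_le (h : IsResidualBound D n y r Q) (hF : 0 ≤ F)
    (hΦ : ∀ i k, ((D.Φ i k)ᵀ * D.Φ i k).trace ≤ F ^ 2) (k : Fin (d + 1)) :
    |D.Upsilon n (D.RHat n y) k - D.Upsilon n (D.outer r) k| ≤ (F + 2) * Q := by
  obtain ⟨g, hg, hQ1, hQ2⟩ := h
  have h1 : D.Upsilon n (D.RHat n y) k - D.Upsilon n (D.outer r) k
      = ∑ i : Fin n, g i ⬝ᵥ (D.Φ i k *ᵥ g i) - 2 * D.obsInner n g (D.applyΦ k r) := by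
    simp only [Upsilon, obsInner, applyΦ, Finset.mul_sum]
    rw [← Finset.sum_sub_distrib, ← Finset.sum_sub_distrib]
    exact Finset.sum_congr rfl fun i _ => D.trace_mul_RHat_sub n y r g i (hg i) k
  have h2 : |∑ i : Fin n, g i ⬝ᵥ (D.Φ i k *ᵥ g i)| ≤ F * Q := by
    refine (Finset.abs_sum_le_sum_abs _ _).trans ?_
    refine le_trans ?_ (mul_le_mul_of_nonneg_left hQ1 hF)
    rw [obsInner, Finset.mul_sum]
    exact Finset.sum_le_sum fun i _ => abs_dotProduct_mulVec_self_le hF (hΦ i k) _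
  rw [h1]
  refine (abs_sub _ _).trans ?_
  rw [abs_mul, abs_two]
  linarith [hQ2 k]

lemma abs_trace_RHat_le (h : IsResidualBound D n y r Q) (hF : 0 ≤ F)
    (hΦ : ∀ i k, ((D.Φ i k)ᵀ * D.Φ i k).trace ≤ F ^ 2) (k : Fin (d + 1)) (i : Fin n) :
    |(D.Φ i k * D.RHat n y i).trace| ≤ 2 * F * (r i ⬝ᵥ r i + Q) := by
  obtain ⟨g, hg, hQ1, -⟩ := h
  rw [RHat, trace_mul_outer]
  refine (abs_dotProduct_mulVec_self_le hF (hΦ i k) _).trans ?_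
  have h1 : g i ⬝ᵥ g i ≤ Q := (Finset.single_le_sum (f := fun i : Fin n => g i ⬝ᵥ g i)
    (fun i _ => dotProduct_self_nonneg_real _) (Finset.mem_univ i)).trans hQ1
  have h2 : D.residual n y i ⬝ᵥ D.residual n y i ≤ 2 * (r i ⬝ᵥ r i) + 2 * (g i ⬝ᵥ g i) := by
    have h3 := dotProduct_self_nonneg_real (r i + g i)
    rw [dotProduct_add, add_dotProduct, add_dotProduct] at h3
    rw [hg, dotProduct_sub, sub_dotProduct, sub_dotProduct]
    linarith
  calc F * (D.residual n y i ⬝ᵥ D.residual n y i) ≤ F * (2 * (r i ⬝ᵥ r i) + 2 * Q) :=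
        mul_le_mul_of_nonneg_left (by linarith) hF
    _ = _ := by ring

lemma sum_trace_sub_sq_le (h : IsResidualBound D n y r Q) (hF : 0 ≤ F)
    (hΦ : ∀ i k, ((D.Φ i k)ᵀ * D.Φ i k).trace ≤ F ^ 2) (k : Fin (d + 1)) (hn : 0 < n) {m : ℝ}
    (hm : ∀ i : Fin n, r i ⬝ᵥ r i ≤ m) :
    ∑ i : Fin n, ((D.Φ i k * D.RHat n y i).trace - (D.Φ i k * D.outer r i).trace) ^ 2
      ≤ 8 * F ^ 2 * (m * Q + Q ^ 2) := by
  obtain ⟨g, hg, hQ1, -⟩ := h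
  have hg0 : ∀ i, 0 ≤ g i ⬝ᵥ g i := fun i => dotProduct_self_nonneg_real _
  have hgQ : ∀ i : Fin n, g i ⬝ᵥ g i ≤ Q := fun i =>
    (Finset.single_le_sum (f := fun i : Fin n => g i ⬝ᵥ g i) (fun i _ => hg0 i)
      (Finset.mem_univ i)).trans hQ1
  have hterm : ∀ i : Fin n,
      ((D.Φ i k * D.RHat n y i).trace - (D.Φ i k * D.outer r i).trace) ^ 2
        ≤ 8 * F ^ 2 * (m + Q) * (g i ⬝ᵥ g i) := fun i => by
    rw [D.trace_mul_RHat_sub n y r g i (hg i) k]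
    set a := g i ⬝ᵥ (D.Φ i k *ᵥ g i)
    set b := g i ⬝ᵥ (D.Φ i k *ᵥ r i)
    have ha : a ^ 2 ≤ F ^ 2 * (Q * (g i ⬝ᵥ g i)) := by
      have h1 := abs_dotProduct_mulVec_self_le hF (hΦ i k) (g i)
      calc a ^ 2 = |a| ^ 2 := (sq_abs a).symm
        _ ≤ (F * (g i ⬝ᵥ g i)) ^ 2 := pow_le_pow_left₀ (abs_nonneg _) h1 2
        _ = F ^ 2 * ((g i ⬝ᵥ g i) * (g i ⬝ᵥ g i)) := by ring
        _ ≤ _ := mul_le_mul_of_nonneg_left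
          (mul_le_mul_of_nonneg_right (hgQ i) (hg0 i)) (sq_nonneg F)
    have hb : b ^ 2 ≤ F ^ 2 * (m * (g i ⬝ᵥ g i)) := by
      have h1 := abs_dotProduct_mulVec_le hF (hΦ i k) (g i) (r i)
      calc b ^ 2 = |b| ^ 2 := (sq_abs b).symm
        _ ≤ (F * (√(g i ⬝ᵥ g i) * √(r i ⬝ᵥ r i))) ^ 2 := pow_le_pow_left₀ (abs_nonneg _) h1 2
        _ = F ^ 2 * ((r i ⬝ᵥ r i) * (g i ⬝ᵥ g i)) := by
          rw [mul_pow, mul_pow, Real.sq_sqrt (hg0 i),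
            Real.sq_sqrt (dotProduct_self_nonneg_real (r i))]
          ring
        _ ≤ _ := mul_le_mul_of_nonneg_left
          (mul_le_mul_of_nonneg_right (hm i) (hg0 i)) (sq_nonneg F)
    have hQ0 : 0 ≤ F ^ 2 * (Q * (g i ⬝ᵥ g i)) := (sq_nonneg a).trans ha
    nlinarith [sq_nonneg (a + 2 * b)]
  refine (Finset.sum_le_sum fun i _ => hterm i).trans ?_
  rw [← Finset.mul_sum]
  have hQ0 : 0 ≤ Q := (hg0 0).trans (hgQ ⟨0, hn⟩)
  have hm0 : 0 ≤ m := (dotProduct_self_nonneg_real (r 0)).trans (hm ⟨0, hn⟩)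
  calc 8 * F ^ 2 * (m + Q) * ∑ i : Fin n, g i ⬝ᵥ g i ≤ 8 * F ^ 2 * (m + Q) * Q :=
        mul_le_mul_of_nonneg_left hQ1 (by positivity)
    _ = _ := by ring

end IsResidualBound

section NormalEquations

variable {n : ℕ} {c : ℝ}

lemma thetaHat_sub (hu : IsUnit (D.Xi n)) (R : D.SqMat) (θ : Fin (d + 1) → ℝ) (k : Fin (d + 1)) :
    D.thetaHat n R k - θ k = ∑ l, (D.Xi n)⁻¹ k l * (D.Upsilon n R l - (D.Xi n *ᵥ θ) l) := by
  have h1 : θ = (D.Xi n)⁻¹ *ᵥ (D.Xi n *ᵥ θ) := by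
    rw [Matrix.mulVec_mulVec, Matrix.nonsing_inv_mul _ ((Matrix.isUnit_iff_isUnit_det _).1 hu),
      Matrix.one_mulVec]
  have h2 : D.thetaHat n R k - θ k
      = ((D.Xi n)⁻¹ *ᵥ D.Upsilon n R) k - ((D.Xi n)⁻¹ *ᵥ (D.Xi n *ᵥ θ)) k := by
    rw [← h1, thetaHat]
  rw [h2, ← Pi.sub_apply, ← Matrix.mulVec_sub]
  rfl

/-- The coefficients of `∑ i, Z_i(θ₁)` as a linear form in the centred `Υ`. -/
noncomputable def scoreCoeff (D : MixedDesign p d) (n : ℕ) (k : Fin (d + 1)) : ℝ :=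
  D.Xi n 0 0 * (D.Xi n)⁻¹ 0 k

lemma normSum_eq (hu : IsUnit (D.Xi n)) (R : D.SqMat) (θ : Fin (d + 1) → ℝ) :
    D.normSum n R (θ 0)
      = (√(n : ℝ))⁻¹ * ∑ k, D.scoreCoeff n k * (D.Upsilon n R k - (D.Xi n *ᵥ θ) k) := by
  rw [normSum, D.sum_Z n hu, thetaHat_sub hu, Finset.mul_sum]
  simp only [scoreCoeff, mul_assoc]

lemma abs_scoreCoeff_le (hn : 0 < n) (hc : 0 < c)
    (hXi : ∀ x : Fin (d + 1) → ℝ, c * n * (x ⬝ᵥ x) ≤ x ⬝ᵥ (D.Xi n *ᵥ x)) {F : ℝ}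
    (hΦ : ∀ i k, ((D.Φ i k)ᵀ * D.Φ i k).trace ≤ F ^ 2) (k : Fin (d + 1)) :
    |D.scoreCoeff n k| ≤ F ^ 2 / c := by
  have hn0 : (0 : ℝ) < n := by exact_mod_cast hn
  rw [scoreCoeff, abs_mul]
  calc |D.Xi n 0 0| * |(D.Xi n)⁻¹ 0 k| ≤ (n * F ^ 2) * (c * n)⁻¹ :=
        mul_le_mul (abs_Xi_apply_le hΦ 0 0) (abs_Xi_inv_apply_le hn hc hXi 0 k) (abs_nonneg _)
          (by positivity)
    _ = F ^ 2 / c := by field_simp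

end NormalEquations

section CentredForm

variable {Ω : Type*} [MeasurableSpace Ω] {P : Measure Ω} {r : Ω → D.Obs}

lemma centredForm_single (k : Fin (d + 1)) (i : ℕ) (ω : Ω) :
    D.centredForm P r (Pi.single k 1) i ω = (D.Φ i k * D.outer (r ω) i).trace
      - ∫ ω, (D.Φ i k * D.outer (r ω) i).trace ∂P := by
  rw [centredForm, Finset.sum_eq_single k]
  · simp
  · intro l _ hl
    simp [hl]
  · simp

lemma sum_mul_centredForm (α : Fin (d + 1) → ℝ) (n : ℕ) (ω : Ω) :
    ∑ k, α k * ∑ i ∈ Finset.range n, D.centredForm P r (Pi.single k 1) i ω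
      = ∑ i ∈ Finset.range n, D.centredForm P r α i ω := by
  simp only [Finset.mul_sum]
  rw [Finset.sum_comm]
  refine Finset.sum_congr rfl fun i _ => ?_
  simp only [centredForm_single]
  rfl

end CentredForm

namespace ErrorModel

variable {Ω : Type*} [MeasurableSpace Ω] {P : Measure Ω} [IsProbabilityMeasure P]
  {r : Ω → D.Obs} {θ : Fin (d + 1) → ℝ} {δ C F : ℝ}

lemma Upsilon_outer_sub (h : ErrorModel D P r θ δ C F) (n : ℕ) (ω : Ω) (k : Fin (d + 1)) :
    D.Upsilon n (D.outer (r ω)) k - (D.Xi n *ᵥ θ) k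
      = ∑ i ∈ Finset.range n, D.centredForm P r (Pi.single k 1) i ω := by
  rw [← h.sum_integral_trace, Upsilon, ← Finset.sum_sub_distrib, Finset.sum_range]
  simp only [centredForm_single]

/-- The estimating functions at the true parameter: the centred quadratic form of the errors, the
effect of the residuals, and the effect of the estimated nuisance components. -/
lemma Z_RHat_eq (h : ErrorModel D P r θ δ C F) (n : ℕ) (y : D.Obs) (ω : Ω) (i : Fin n) :
    D.Z n (D.RHat n y) (θ 0) i = D.centredForm P r (Pi.single 0 1) i ω
      + ((D.Φ i 0 * D.RHat n y i).trace - (D.Φ i 0 * D.outer (r ω) i).trace)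
      - ∑ q : Fin d, (D.thetaHat n (D.RHat n y) q.succ - θ q.succ)
          * (D.Φ i 0 * D.Φ i q.succ).trace := by
  rw [Z_eq, centredForm_single, h.integral_trace, Fin.sum_univ_succ]
  simp only [sub_mul, Finset.sum_sub_distrib]
  have h2 : ∀ q : Fin d, (D.Φ i 0 * D.Φ i q.succ).trace * θ q.succ
      = θ q.succ * (D.Φ i 0 * D.Φ i q.succ).trace := fun q => mul_comm _ _
  simp only [h2]
  ring

end ErrorModel

end MixedDesign

/-! ### Asymptotics of the estimating functions -/

lemma tendsto_inv_sqrt_natCast : Tendsto (fun n : ℕ => (√(n : ℝ))⁻¹) atTop (𝓝 0) :=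
  tendsto_inv_atTop_zero.comp (Real.tendsto_sqrt_atTop.comp tendsto_natCast_atTop_atTop)

namespace MixedDesign

variable {p d : ℕ} {D : MixedDesign p d}

/-- The error model together with the observations `y`, the identifiability of the variance
components, and the `L²`-bounded control `Q n` of the effect of estimating the fixed effects. -/
structure FittedModel {Ω : Type*} [MeasurableSpace Ω] (D : MixedDesign p d) (P : Measure Ω)
    (y r : Ω → D.Obs) (θ : Fin (d + 1) → ℝ) (δ C F c K : ℝ) (Q : ℕ → Ω → ℝ) : Prop
    extends ErrorModel D P r θ δ C F where
  y_measurable : ∀ i, Measurable fun ω => y ω i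
  c_pos : 0 < c
  le_Xi : ∀ᶠ n : ℕ in atTop, ∀ x : Fin (d + 1) → ℝ, c * n * (x ⬝ᵥ x) ≤ x ⬝ᵥ (D.Xi n *ᵥ x)
  Q_nonneg : ∀ n ω, 0 ≤ Q n ω
  integral_Q_sq : ∀ᶠ n in atTop, Integrable (fun ω => Q n ω ^ 2) P ∧ ∫ ω, Q n ω ^ 2 ∂P ≤ K
  residual_bound : ∀ᶠ n in atTop, ∀ ω, IsResidualBound D n (y ω) (r ω) (Q n ω)

/-- The part `n^{-1/2} ∑ α_{nk} (Υ_k - E Υ_k)` of the normalized sum that comes from the true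
errors. -/
noncomputable def trueSum {Ω : Type*} [MeasurableSpace Ω] (D : MixedDesign p d) (P : Measure Ω)
    (r : Ω → D.Obs) (n : ℕ) (ω : Ω) : ℝ :=
  (√(n : ℝ))⁻¹ * ∑ i ∈ Finset.range n, D.centredForm P r (D.scoreCoeff n) i ω

namespace FittedModel

variable {Ω : Type*} [MeasurableSpace Ω] {P : Measure Ω}
  {y r : Ω → D.Obs} {θ : Fin (d + 1) → ℝ} {δ C F c K : ℝ} {Q : ℕ → Ω → ℝ}

lemma bddInProb_Q (h : FittedModel D P y r θ δ C F c K Q) : BddInProb P Q :=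
  BddInProb.of_sq (BddInProb.of_integral_le h.integral_Q_sq fun _ _ => sq_nonneg _)

lemma measurable_normSum (h : FittedModel D P y r θ δ C F c K Q) (n : ℕ) (θ₁ : ℝ) :
    Measurable fun ω => D.normSum n (D.RHat n (y ω)) θ₁ :=
  (Finset.measurable_sum _ fun i _ =>
    D.measurable_Z n (D.measurable_RHat n h.y_measurable) θ₁ i).const_mul _

lemma measurable_trueSum (h : FittedModel D P y r θ δ C F c K Q) (n : ℕ) :
    Measurable (D.trueSum P r n) :=
  (Finset.measurable_sum _ fun i _ => h.measurable_centredForm (D.scoreCoeff n) i).const_mul _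

/-- The largest of the squared error norms is `o_P(√n)`. -/
lemma nullInProb_iSup_sqNorm (h : FittedModel D P y r θ δ C F c K Q) :
    NullInProb P fun n ω => (√(n : ℝ))⁻¹ * ⨆ i : Fin n, r ω i ⬝ᵥ r ω i := by
  intro ε hε
  have hδ := h.δ_pos
  have hlim : Tendsto (fun n : ℕ => ENNReal.ofReal (C / ε ^ (2 + δ) * (n : ℝ) ^ (-(δ / 2)))) atTop
      (𝓝 0) := by
    have h1 : Tendsto (fun n : ℕ => (n : ℝ) ^ (-(δ / 2))) atTop (𝓝 0) :=
      (tendsto_rpow_neg_atTop (half_pos hδ)).comp tendsto_natCast_atTop_atTop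
    simpa using ENNReal.tendsto_ofReal (h1.const_mul (C / ε ^ (2 + δ)))
  refine tendsto_of_tendsto_of_tendsto_of_le_of_le' tendsto_const_nhds hlim
    (Eventually.of_forall fun _ => zero_le) ?_
  filter_upwards [eventually_gt_atTop 0] with n hn
  have hn0 : (0 : ℝ) < n := by exact_mod_cast hn
  have hs : 0 < √(n : ℝ) := Real.sqrt_pos.2 hn0
  have hne : Nonempty (Fin n) := ⟨⟨0, hn⟩⟩
  calc P {ω | ε ≤ |(√(n : ℝ))⁻¹ * ⨆ i : Fin n, r ω i ⬝ᵥ r ω i|}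
      ≤ P (⋃ i : Fin n, {ω | (ε * √(n : ℝ)) ^ (2 + δ) ≤ (r ω i ⬝ᵥ r ω i) ^ (2 + δ)}) := by
        refine measure_mono fun ω hω => ?_
        obtain ⟨i, hi⟩ := exists_eq_ciSup_of_finite (f := fun i : Fin n => r ω i ⬝ᵥ r ω i)
        simp only [Set.mem_ofPred_eq] at hω
        rw [← hi, abs_of_nonneg (mul_nonneg (inv_pos.2 hs).le (dotProduct_self_nonneg_real _)),
          le_inv_mul_iff₀ hs, mul_comm] at hω
        exact Set.mem_iUnion.2 ⟨i, Real.rpow_le_rpow (by positivity) hω (by linarith)⟩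
    _ ≤ ∑ i : Fin n, P {ω | (ε * √(n : ℝ)) ^ (2 + δ) ≤ (r ω i ⬝ᵥ r ω i) ^ (2 + δ)} :=
        measure_iUnion_fintype_le _ _
    _ ≤ ∑ _i : Fin n, ENNReal.ofReal (C / (ε * √(n : ℝ)) ^ (2 + δ)) :=
        Finset.sum_le_sum fun i _ => measure_le_of_integral_le (h.moment i).1
          (fun ω => Real.rpow_nonneg (dotProduct_self_nonneg_real _) _) (h.moment i).2
          (by positivity)
    _ = ENNReal.ofReal (C / ε ^ (2 + δ) * (n : ℝ) ^ (-(δ / 2))) := by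
        rw [Finset.sum_const, Finset.card_univ, Fintype.card_fin, ← ENNReal.ofReal_nsmul,
          nsmul_eq_mul]
        congr 1
        have h1 : √(n : ℝ) ^ (2 + δ) = n * (n : ℝ) ^ (δ / 2) := by
          rw [Real.sqrt_eq_rpow, ← Real.rpow_mul hn0.le,
            show 1 / 2 * (2 + δ) = 1 + δ / 2 by ring, Real.rpow_add hn0, Real.rpow_one]
        rw [Real.mul_rpow hε.le hs.le, h1, Real.rpow_neg hn0.le]
        field_simp

variable [IsProbabilityMeasure P]

lemma bddInProb_sum_centredForm (h : FittedModel D P y r θ δ C F c K Q) (k : Fin (d + 1)) :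
    BddInProb P fun n ω =>
      (√(n : ℝ))⁻¹ * ∑ i ∈ Finset.range n, D.centredForm P r (Pi.single k 1) i ω := by
  obtain ⟨B, hB0, hB⟩ := h.exists_integral_sum_centredForm_sq_le 1
  have hα : ∀ l, |(Pi.single k 1 : Fin (d + 1) → ℝ) l| ≤ 1 := fun l => by
    rcases eq_or_ne l k with rfl | hl
    · simp
    · simp [hl]
  refine BddInProb.of_sq (BddInProb.of_integral_le (K := B) ?_ fun _ _ => sq_nonneg _)
  filter_upwards [eventually_gt_atTop 0] with n hn
  have hn0 : (0 : ℝ) < n := by exact_mod_cast hn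
  obtain ⟨h1, -, h3⟩ := hB _ hα n
  simp only [mul_pow]
  refine ⟨h1.integrable_sq.const_mul _, ?_⟩
  rw [integral_const_mul, inv_pow, Real.sq_sqrt hn0.le, inv_mul_le_iff₀ hn0]
  exact h3

/-- Consistency of the estimators of the variance components. -/
lemma nullInProb_thetaHat_sub (h : FittedModel D P y r θ δ C F c K Q) (k : Fin (d + 1)) :
    NullInProb P fun n ω => D.thetaHat n (D.RHat n (y ω)) k - θ k := by
  have hbd : BddInProb P fun n ω => ∑ l : Fin (d + 1), c⁻¹ *
      (|(√(n : ℝ))⁻¹ * ∑ i ∈ Finset.range n, D.centredForm P r (Pi.single l 1) i ω|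
        + (F + 2) * Q n ω) := by
    refine BddInProb.sum _ fun l _ => (BddInProb.const c⁻¹).mul (BddInProb.add ?_ ?_)
    · exact (h.bddInProb_sum_centredForm l).of_abs_le
        (Eventually.of_forall fun n ω => (abs_abs _).le)
    · exact (BddInProb.const (F + 2)).mul h.bddInProb_Q
  refine ((NullInProb.of_tendsto tendsto_inv_sqrt_natCast).mul_bdd hbd).of_abs_le ?_
  filter_upwards [h.le_Xi, h.residual_bound, eventually_gt_atTop 0] with n hXi hres hn ω
  have hn0 : (0 : ℝ) < n := by exact_mod_cast hn
  have hs : 0 < √(n : ℝ) := Real.sqrt_pos.2 hn0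
  have hs1 : 1 ≤ √(n : ℝ) := Real.one_le_sqrt.2 (by exact_mod_cast hn)
  rw [thetaHat_sub (isUnit_Xi hn h.c_pos hXi), Finset.mul_sum]
  refine (Finset.abs_sum_le_sum_abs _ _).trans
    ((Finset.sum_le_sum fun l _ => ?_).trans (le_abs_self _))
  rw [abs_mul]
  have h1 : |D.Upsilon n (D.RHat n (y ω)) l - (D.Xi n *ᵥ θ) l|
      ≤ |∑ i ∈ Finset.range n, D.centredForm P r (Pi.single l 1) i ω| + (F + 2) * Q n ω := by
    have h2 := (hres ω).abs_Upsilon_sub_le h.F_nonneg h.trace_le l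
    have h3 := h.Upsilon_outer_sub n ω l
    rw [← h3]
    have h4 := abs_add_le (D.Upsilon n (D.RHat n (y ω)) l - D.Upsilon n (D.outer (r ω)) l)
      (D.Upsilon n (D.outer (r ω)) l - (D.Xi n *ᵥ θ) l)
    rw [sub_add_sub_cancel] at h4
    linarith
  have hFQ : 0 ≤ (F + 2) * Q n ω := mul_nonneg (by linarith [h.F_nonneg]) (h.Q_nonneg n ω)
  calc |(D.Xi n)⁻¹ k l| * |D.Upsilon n (D.RHat n (y ω)) l - (D.Xi n *ᵥ θ) l|
      ≤ (c * n)⁻¹ * (|∑ i ∈ Finset.range n, D.centredForm P r (Pi.single l 1) i ω|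
          + (F + 2) * Q n ω) :=
        mul_le_mul (abs_Xi_inv_apply_le hn h.c_pos hXi k l) h1 (abs_nonneg _)
          (inv_pos.2 (mul_pos h.c_pos hn0)).le
    _ = (√(n : ℝ))⁻¹ * (c⁻¹ * ((√(n : ℝ))⁻¹ *
          |∑ i ∈ Finset.range n, D.centredForm P r (Pi.single l 1) i ω|
          + (√(n : ℝ))⁻¹ * ((F + 2) * Q n ω))) := by
        rw [mul_inv, show (n : ℝ)⁻¹ = (√(n : ℝ))⁻¹ * (√(n : ℝ))⁻¹ by
          rw [← mul_inv, Real.mul_self_sqrt hn0.le]]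
        ring
    _ ≤ _ := by
        rw [abs_mul, abs_of_pos (inv_pos.2 hs)]
        have h5 : (√(n : ℝ))⁻¹ * ((F + 2) * Q n ω) ≤ (F + 2) * Q n ω :=
          mul_le_of_le_one_left hFQ (inv_le_one_of_one_le₀ hs1)
        have := (inv_pos.2 h.c_pos).le
        gcongr

/-- The normalized sum based on residuals differs from the one based on the true errors by
`O(n^{-1/2})` in `L²`. -/
lemma abs_normSum_sub_trueSum_le (h : FittedModel D P y r θ δ C F c K Q) :
    ∀ᶠ n : ℕ in atTop, ∀ ω, |D.normSum n (D.RHat n (y ω)) (θ 0) - D.trueSum P r n ω|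
      ≤ (√(n : ℝ))⁻¹ * ((d + 1) * (F ^ 2 / c) * (F + 2) * Q n ω) := by
  filter_upwards [h.le_Xi, h.residual_bound, eventually_gt_atTop 0] with n hXi hres hn ω
  have hn0 : (0 : ℝ) < n := by exact_mod_cast hn
  have h1 : D.normSum n (D.RHat n (y ω)) (θ 0) - D.trueSum P r n ω
      = (√(n : ℝ))⁻¹ * ∑ k, D.scoreCoeff n k
        * (D.Upsilon n (D.RHat n (y ω)) k - D.Upsilon n (D.outer (r ω)) k) := by
    rw [normSum_eq (isUnit_Xi hn h.c_pos hXi), trueSum, ← sum_mul_centredForm, ← mul_sub,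
      ← Finset.sum_sub_distrib]
    congr 1
    refine Finset.sum_congr rfl fun k _ => ?_
    rw [← h.Upsilon_outer_sub n ω k]
    ring
  rw [h1, abs_mul, abs_of_nonneg (inv_nonneg.2 (Real.sqrt_nonneg _))]
  refine mul_le_mul_of_nonneg_left ?_ (inv_nonneg.2 (Real.sqrt_nonneg _))
  have hterm : ∀ k, |D.scoreCoeff n k
      * (D.Upsilon n (D.RHat n (y ω)) k - D.Upsilon n (D.outer (r ω)) k)|
        ≤ F ^ 2 / c * ((F + 2) * Q n ω) := fun k => by
    rw [abs_mul]
    exact mul_le_mul (abs_scoreCoeff_le hn h.c_pos hXi h.trace_le k)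
      ((hres ω).abs_Upsilon_sub_le h.F_nonneg h.trace_le k) (abs_nonneg _)
      (div_nonneg (sq_nonneg _) h.c_pos.le)
  refine (Finset.abs_sum_le_sum_abs _ _).trans ((Finset.sum_le_sum fun k _ => hterm k).trans ?_)
  rw [Finset.sum_const, Finset.card_univ, Fintype.card_fin, nsmul_eq_mul]
  push_cast
  exact le_of_eq (by ring)

lemma exists_moment_trueSum (h : FittedModel D P y r θ δ C F c K Q) :
    ∃ B : ℝ, ∀ᶠ n : ℕ in atTop, MemLp (D.trueSum P r n) 2 P ∧
      ∫ ω, D.trueSum P r n ω ∂P = 0 ∧ ∫ ω, D.trueSum P r n ω ^ 2 ∂P ≤ B := by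
  obtain ⟨B, hB0, hB⟩ := h.exists_integral_sum_centredForm_sq_le (F ^ 2 / c)
  refine ⟨B, ?_⟩
  filter_upwards [h.le_Xi, eventually_gt_atTop 0] with n hXi hn
  have hn0 : (0 : ℝ) < n := by exact_mod_cast hn
  obtain ⟨h1, h2, h3⟩ := hB (D.scoreCoeff n) (abs_scoreCoeff_le hn h.c_pos hXi h.trace_le) n
  refine ⟨h1.const_mul _, ?_, ?_⟩
  · simp only [trueSum]
    rw [integral_const_mul, h2, mul_zero]
  · simp only [trueSum, mul_pow]
    rw [integral_const_mul, inv_pow, Real.sq_sqrt hn0.le, inv_mul_le_iff₀ hn0]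
    exact h3

lemma exists_integral_normSum_sub_sq_le (h : FittedModel D P y r θ δ C F c K Q) :
    ∃ B : ℝ, ∀ᶠ n : ℕ in atTop, MemLp (fun ω => D.normSum n (D.RHat n (y ω)) (θ 0)) 2 P ∧
      Integrable (fun ω => (D.normSum n (D.RHat n (y ω)) (θ 0) - D.trueSum P r n ω) ^ 2) P ∧
      ∫ ω, (D.normSum n (D.RHat n (y ω)) (θ 0) - D.trueSum P r n ω) ^ 2 ∂P ≤ B * (n : ℝ)⁻¹ := by
  set b := (d + 1) * (F ^ 2 / c) * (F + 2) with hb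
  obtain ⟨B, hB⟩ := h.exists_moment_trueSum
  refine ⟨b ^ 2 * K, ?_⟩
  filter_upwards [h.abs_normSum_sub_trueSum_le, h.integral_Q_sq, hB, eventually_gt_atTop 0]
    with n h1 h2 h3 hn
  have hn0 : (0 : ℝ) < n := by exact_mod_cast hn
  have hle : ∀ ω, (D.normSum n (D.RHat n (y ω)) (θ 0) - D.trueSum P r n ω) ^ 2
      ≤ b ^ 2 * (n : ℝ)⁻¹ * Q n ω ^ 2 := fun ω => by
    have h4 := pow_le_pow_left₀ (abs_nonneg _) (h1 ω) 2
    rw [sq_abs, mul_pow, inv_pow, Real.sq_sqrt hn0.le, mul_pow] at h4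
    refine h4.trans (le_of_eq ?_)
    rw [hb]
    ring
  have hm : Measurable fun ω => D.normSum n (D.RHat n (y ω)) (θ 0) - D.trueSum P r n ω :=
    (h.measurable_normSum n _).sub (h.measurable_trueSum n)
  have hi : Integrable (fun ω => (D.normSum n (D.RHat n (y ω)) (θ 0) - D.trueSum P r n ω) ^ 2) P :=
    (h2.1.const_mul (b ^ 2 * (n : ℝ)⁻¹)).mono' (hm.pow_const 2).aestronglyMeasurable
      (Eventually.of_forall fun ω => by
        rw [Real.norm_eq_abs, abs_of_nonneg (sq_nonneg _)]; exact hle ω)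
  refine ⟨?_, hi, ?_⟩
  · have h5 := ((memLp_two_iff_integrable_sq hm.aestronglyMeasurable).2 hi).add h3.1
    refine h5.ae_eq (Eventually.of_forall fun ω => ?_)
    simp
  · refine (integral_mono hi (h2.1.const_mul _) hle).trans ?_
    rw [integral_const_mul]
    calc b ^ 2 * (n : ℝ)⁻¹ * ∫ ω, Q n ω ^ 2 ∂P ≤ b ^ 2 * (n : ℝ)⁻¹ * K :=
          mul_le_mul_of_nonneg_left h2.2 (by positivity)
      _ = _ := by ring

lemma tendsto_variance_sub (h : FittedModel D P y r θ δ C F c K Q) :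
    Tendsto (fun n => Var[fun ω => D.normSum n (D.RHat n (y ω)) (θ 0); P] - Var[D.trueSum P r n; P])
      atTop (𝓝 0) := by
  obtain ⟨B, hB⟩ := h.exists_moment_trueSum
  obtain ⟨B', hB'⟩ := h.exists_integral_normSum_sub_sq_le
  have hlim : Tendsto (fun n : ℕ =>
      B * (√(n : ℝ))⁻¹ + B' * ((√(n : ℝ))⁻¹ * (√(n : ℝ))⁻¹ + (√(n : ℝ))⁻¹)) atTop (𝓝 0) := by
    have h1 := tendsto_inv_sqrt_natCast
    simpa using (h1.const_mul B).add (((h1.mul h1).add h1).const_mul B')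
  refine squeeze_zero_norm' ?_ hlim
  filter_upwards [hB, hB', eventually_gt_atTop 0] with n h1 h2 hn
  have hn0 : (0 : ℝ) < n := by exact_mod_cast hn
  have hs : 0 < √(n : ℝ) := Real.sqrt_pos.2 hn0
  refine (abs_variance_sub_le h1.1 h2.1 (inv_pos.2 hs)).trans ?_
  rw [variance_of_integral_eq_zero h1.1.aemeasurable h1.2.1]
  have h3 : (n : ℝ)⁻¹ = (√(n : ℝ))⁻¹ * (√(n : ℝ))⁻¹ := by
    rw [← mul_inv, Real.mul_self_sqrt hn0.le]
  have h4 := mul_le_mul_of_nonneg_left h1.2.2 (inv_pos.2 hs).le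
  have h5 := mul_le_mul_of_nonneg_left h2.2.2 (show 0 ≤ 1 + (√(n : ℝ))⁻¹⁻¹ by positivity)
  have h6 : (1 + (√(n : ℝ))⁻¹⁻¹) * (B' * (n : ℝ)⁻¹)
      = B' * ((√(n : ℝ))⁻¹ * (√(n : ℝ))⁻¹ + (√(n : ℝ))⁻¹) := by
    rw [h3]
    field_simp
  linarith

lemma nullInProb_normSum_sub (h : FittedModel D P y r θ δ C F c K Q) :
    NullInProb P fun n ω => D.normSum n (D.RHat n (y ω)) (θ 0) - D.trueSum P r n ω := by
  obtain ⟨B, hB⟩ := h.exists_integral_normSum_sub_sq_le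
  have h1 : Tendsto (fun n : ℕ => B * (n : ℝ)⁻¹) atTop (𝓝 0) := by
    simpa using (tendsto_inv_atTop_zero.comp (tendsto_natCast_atTop_atTop (R := ℝ))).const_mul B
  exact NullInProb.of_sq (NullInProb.of_integral_le h1 (hB.mono fun n hn => hn.2)
    fun _ _ => sq_nonneg _)

lemma bddInProb_normSum (h : FittedModel D P y r θ δ C F c K Q) :
    BddInProb P fun n ω => D.normSum n (D.RHat n (y ω)) (θ 0) := by
  obtain ⟨B, hB⟩ := h.exists_moment_trueSum
  have h1 : BddInProb P (D.trueSum P r) := BddInProb.of_sq (BddInProb.of_integral_le (K := B)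
    (hB.mono fun n hn => ⟨hn.1.integrable_sq, hn.2.2⟩) fun _ _ => sq_nonneg _)
  simpa using h.nullInProb_normSum_sub.bddInProb.add h1

/-- Asymptotic normality of the normalized sum of the estimating functions. -/
theorem tendstoInDistribution_normSum (h : FittedModel D P y r θ δ C F c K Q) {c' : ℝ}
    (hc' : 0 < c')
    (hv : ∀ᶠ n : ℕ in atTop, c' ≤ Var[fun ω => D.normSum n (D.RHat n (y ω)) (θ 0); P]) :
    TendstoInDistribution (fun n ω => D.normSum n (D.RHat n (y ω)) (θ 0)
      / √Var[fun ω => D.normSum n (D.RHat n (y ω)) (θ 0); P]) atTop (fun u : ℝ => u)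
      (fun _ => P) (gaussianReal 0 1) := by
  set v : ℕ → ℝ := fun n => Var[fun ω => D.normSum n (D.RHat n (y ω)) (θ 0); P] with hvdef
  have hδ := h.δ_pos
  obtain ⟨B, hB0, hB⟩ := h.exists_moment_centredForm (F ^ 2 / c)
  let X : ℕ → ℕ → Ω → ℝ := fun n i ω =>
    (√(n : ℝ) * √(v n))⁻¹ * D.centredForm P r (D.scoreCoeff n) i ω
  have hsum : ∀ n ω, ∑ i ∈ Finset.range n, X n i ω = D.trueSum P r n ω / √(v n) := fun n ω => by
    simp only [X, trueSum]
    rw [← Finset.mul_sum, mul_inv]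
    ring
  have hsc : ∀ᶠ n : ℕ in atTop, ∀ k, |D.scoreCoeff n k| ≤ F ^ 2 / c := by
    filter_upwards [h.le_Xi, eventually_gt_atTop 0] with n hXi hn
    exact abs_scoreCoeff_le hn h.c_pos hXi h.trace_le
  have hclt : TendstoInDistribution (fun n ω => ∑ i ∈ Finset.range n, X n i ω) atTop
      (fun u : ℝ => u) (fun _ => P) (gaussianReal 0 1) := by
    refine tendstoInDistribution_sum_of_lyapunov (δ := δ)
      (K := max (c' ^ (-(1 + δ / 2)) * B) (c'⁻¹ * B))
      hδ h.δ_le_one (fun n i => (h.measurable_centredForm _ i).const_mul _) ?_ ?_ ?_ ?_ ?_ ?_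
    · exact Eventually.of_forall fun n => (h.iIndepFun_centredForm (D.scoreCoeff n)).comp
        (fun _ x => (√(n : ℝ) * √(v n))⁻¹ * x) fun _ => by fun_prop
    · filter_upwards [hsc] with n hn i _
      exact (hB _ hn i).2.1.const_mul _
    · refine Eventually.of_forall fun n i _ => ?_
      simp only [X]
      rw [integral_const_mul, h.integral_centredForm, mul_zero]
    · filter_upwards [hsc, hv, eventually_gt_atTop 0] with n hn hvn hn1 i _
      have hn0 : (0 : ℝ) < n := by exact_mod_cast hn1
      have hv0 : 0 < v n := hc'.trans_le hvn
      have hs : 0 ≤ (√(n : ℝ) * √(v n))⁻¹ := by positivity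
      have he : (fun ω => |X n i ω| ^ (2 + δ)) = fun ω => ((√(n : ℝ) * √(v n))⁻¹) ^ (2 + δ)
          * |D.centredForm P r (D.scoreCoeff n) i ω| ^ (2 + δ) := by
        funext ω
        simp only [X]
        rw [abs_mul, abs_of_nonneg hs, Real.mul_rpow hs (abs_nonneg _)]
      obtain ⟨⟨h1, h2⟩, -⟩ := hB _ hn i
      rw [he]
      refine ⟨h1.const_mul _, ?_⟩
      rw [integral_const_mul]
      have hpow : ((√(n : ℝ) * √(v n))⁻¹) ^ (2 + δ)
          = (n : ℝ) ^ (-(1 + δ / 2)) * (v n) ^ (-(1 + δ / 2)) := by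
        rw [← Real.sqrt_mul hn0.le, Real.sqrt_eq_rpow, ← Real.rpow_neg (by positivity),
          ← Real.rpow_mul (by positivity), ← Real.mul_rpow hn0.le hv0.le]
        congr 1
        ring
      have hvc : (v n) ^ (-(1 + δ / 2)) ≤ c' ^ (-(1 + δ / 2)) :=
        Real.rpow_le_rpow_of_nonpos hc' hvn (by linarith)
      rw [hpow]
      calc (n : ℝ) ^ (-(1 + δ / 2)) * v n ^ (-(1 + δ / 2))
            * ∫ ω, |D.centredForm P r (D.scoreCoeff n) i ω| ^ (2 + δ) ∂P
          ≤ (n : ℝ) ^ (-(1 + δ / 2)) * c' ^ (-(1 + δ / 2)) * B := by gcongr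
        _ = (c' ^ (-(1 + δ / 2)) * B) * (n : ℝ) ^ (-(1 + δ / 2)) := by ring
        _ ≤ _ := mul_le_mul_of_nonneg_right (le_max_left _ _) (by positivity)
    · filter_upwards [hsc, hv, eventually_gt_atTop 0] with n hn hvn hn1 i _
      have hn0 : (0 : ℝ) < n := by exact_mod_cast hn1
      have hv0 : 0 < v n := hc'.trans_le hvn
      obtain ⟨-, h2, h3⟩ := hB _ hn i
      simp only [X]
      rw [variance_const_mul, variance_of_integral_eq_zero h2.aemeasurable
        (h.integral_centredForm _ i), inv_pow, mul_pow, Real.sq_sqrt hn0.le, Real.sq_sqrt hv0.le,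
        mul_inv]
      calc (n : ℝ)⁻¹ * (v n)⁻¹ * ∫ ω, D.centredForm P r (D.scoreCoeff n) i ω ^ 2 ∂P
          ≤ (n : ℝ)⁻¹ * c'⁻¹ * B := by gcongr
        _ = c'⁻¹ * B * (n : ℝ)⁻¹ := by ring
        _ ≤ _ := mul_le_mul_of_nonneg_right (le_max_right _ _) (by positivity)
    · have h1 : Tendsto (fun n => 1 - (v n - Var[D.trueSum P r n; P]) / v n) atTop (𝓝 1) := by
        have h2 : Tendsto (fun n => (v n - Var[D.trueSum P r n; P]) / v n) atTop (𝓝 0) := by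
          have h3 : Tendsto (fun n => |v n - Var[D.trueSum P r n; P]| / c') atTop (𝓝 0) := by
            simpa using (h.tendsto_variance_sub.abs).div_const c'
          refine squeeze_zero_norm' ?_ h3
          filter_upwards [hv] with n hvn
          rw [Real.norm_eq_abs, abs_div, abs_of_pos (hc'.trans_le hvn)]
          exact div_le_div_of_nonneg_left (abs_nonneg _) hc' hvn
        simpa using (tendsto_const_nhds (x := (1 : ℝ))).sub h2
      refine h1.congr' ?_
      filter_upwards [hsc, hv] with n hn hvn
      have hv0 : 0 < v n := hc'.trans_le hvn
      have hXL : ∀ i, MemLp (X n i) 2 P := fun i => (hB _ hn i).2.1.const_mul _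
      have hXi : iIndepFun (X n) P := (h.iIndepFun_centredForm (D.scoreCoeff n)).comp
        (fun _ x => (√(n : ℝ) * √(v n))⁻¹ * x) fun _ => by fun_prop
      have h2 := IndepFun.variance_sum (s := Finset.range n) (fun i _ => hXL i)
        fun i _ j _ hij => hXi.indepFun hij
      rw [← h2]
      have h3 : (∑ i ∈ Finset.range n, X n i) = fun ω => (√(v n))⁻¹ * D.trueSum P r n ω := by
        funext ω
        rw [Finset.sum_apply, hsum]
        ring
      rw [h3, variance_const_mul, inv_pow, Real.sq_sqrt hv0.le]
      field_simp
      ring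
  refine tendstoInDistribution_of_tendstoInMeasure_sub _ _ hclt (NullInProb.tendstoInMeasure ?_)
    fun n => ((h.measurable_normSum n _).div_const _).aemeasurable
  refine (h.nullInProb_normSum_sub.mul_bdd (BddInProb.const (√c')⁻¹)).of_abs_le ?_
  filter_upwards [hv] with n hvn ω
  simp only [Pi.sub_apply, hsum]
  rw [← sub_div, abs_div, abs_mul, div_eq_mul_inv]
  refine mul_le_mul_of_nonneg_left ?_ (abs_nonneg _)
  rw [abs_of_nonneg (Real.sqrt_nonneg _), abs_of_nonneg (inv_nonneg.2 (Real.sqrt_nonneg _))]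
  exact inv_anti₀ (Real.sqrt_pos.2 hc') (Real.sqrt_le_sqrt hvn)

end FittedModel

end MixedDesign

/-! ### The likelihood ratio as a quadratic function of the normalized sum -/

namespace MixedDesign

variable {p d : ℕ} {D : MixedDesign p d}

section LikelihoodRatio

variable {n : ℕ} {R : D.SqMat} {θ₁ M : ℝ}

lemma sum_trace_mul_self (n : ℕ) : ∑ i : Fin n, (D.Φ i 0 * D.Φ i 0).trace = D.Xi n 0 0 := rfl

lemma trace_Φ_mul_self_nonneg (i : ℕ) (k : Fin (d + 1)) : 0 ≤ (D.Φ i k * D.Φ i k).trace := by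
  have h : (D.Φ i k * D.Φ i k).trace = ((D.Φ i k)ᵀ * D.Φ i k).trace := by rw [Φ_transpose]
  rw [h, trace_transpose_mul_self_eq]
  positivity

lemma sum_Z_eq_sqrt_mul_normSum (hn : 0 < n) (R : D.SqMat) (θ₁ : ℝ) :
    ∑ i, D.Z n R θ₁ i = √(n : ℝ) * D.normSum n R θ₁ := by
  have : √(n : ℝ) ≠ 0 := (Real.sqrt_pos.2 (by exact_mod_cast hn)).ne'
  rw [normSum]
  field_simp

/-- If the unconstrained maximizer `θ₁ + √n S / Ξ₁₁` of the profile likelihood is admissible, the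
maximum is `n⁻ⁿ`. -/
lemma sSup_lik_of_nonneg (hn : 0 < n) (hXi : 0 < D.Xi n 0 0)
    (h : 0 ≤ θ₁ + √(n : ℝ) * D.normSum n R θ₁ / D.Xi n 0 0) :
    sSup (D.lik n R '' Set.Ici 0) = ((n : ℝ) ^ n)⁻¹ := by
  refine sSup_empLik_of_exists hn (z := D.Z n R) h ?_
  simp only [D.Z_eq_sub n R θ₁ (θ₁ + _), add_sub_cancel_left, Finset.sum_sub_distrib]
  rw [← Finset.mul_sum, sum_trace_mul_self, sum_Z_eq_sqrt_mul_normSum hn,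
    div_mul_cancel₀ _ hXi.ne', sub_self]

/-- The likelihood ratio at an interior point of the parameter space. -/
lemma elr_quadratic_bound (hn : 0 < n) (hXi : 0 < D.Xi n 0 0)
    (h : 0 ≤ θ₁ + √(n : ℝ) * D.normSum n R θ₁ / D.Xi n 0 0) (hV : 0 < D.nu2sq n R θ₁)
    (hM : ∀ i, |D.Z n R θ₁ i| ≤ M * √n) (hMS : M * |D.normSum n R θ₁| ≤ D.nu2sq n R θ₁ / 8) :
    0 < D.elr n R θ₁ ∧
      |-2 * Real.log (D.elr n R θ₁) - D.normSum n R θ₁ ^ 2 / D.nu2sq n R θ₁|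
        ≤ 16 * (M * |D.normSum n R θ₁| / D.nu2sq n R θ₁)
          * (D.normSum n R θ₁ ^ 2 / D.nu2sq n R θ₁) := by
  obtain ⟨h1, h2⟩ := empLik_quadratic_bound hn rfl rfl hV hM hMS
  rw [elr, sSup_lik_of_nonneg hn hXi h]
  exact ⟨div_pos h1 (by positivity), h2⟩

/-- The likelihood ratio at the boundary point `0`: if the sum of the estimating functions is
negative, then the maximum over the parameter space is attained at `0`. -/
lemma elr_zero_quadratic_bound (hn : 0 < n) (hXi : 0 < D.Xi n 0 0) (hV : 0 < D.nu2sq n R 0)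
    (hM : ∀ i, |D.Z n R 0 i| ≤ M * √n) (hMS : M * |D.normSum n R 0| ≤ D.nu2sq n R 0 / 8) :
    0 < D.elr n R 0 ∧
      |-2 * Real.log (D.elr n R 0) - (max (D.normSum n R 0) 0) ^ 2 / D.nu2sq n R 0|
        ≤ 16 * (M * |D.normSum n R 0| / D.nu2sq n R 0)
          * (D.normSum n R 0 ^ 2 / D.nu2sq n R 0) := by
  have hn0 : (0 : ℝ) < n := by exact_mod_cast hn
  rcases le_or_gt 0 (D.normSum n R 0) with hS | hS
  · rw [max_eq_left hS]
    exact elr_quadratic_bound hn hXi (by positivity) hV hM hMS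
  · have h1 := empLik_quadratic_bound hn rfl rfl hV hM hMS
    have hneg : ∑ i, D.Z n R 0 i < 0 := by
      rw [sum_Z_eq_sqrt_mul_normSum hn]
      exact mul_neg_of_pos_of_neg (Real.sqrt_pos.2 hn0) hS
    have hsup : sSup (D.lik n R '' Set.Ici 0) = empLik (D.Z n R 0) := by
      rw [← sSup_empLik_of_sum_neg hneg fun i : Fin n => trace_Φ_mul_self_nonneg (D := D) i 0]
      congr 2
      funext θ
      rw [lik]
      congr 1
      funext i
      rw [D.Z_eq_sub n R 0 θ i, sub_zero]
    have helr : D.elr n R 0 = 1 := by rw [elr, hsup, lik, div_self h1.1.ne']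
    have hM0 : 0 ≤ M := nonneg_of_mul_nonneg_left ((abs_nonneg _).trans (hM ⟨0, hn⟩))
      (Real.sqrt_pos.2 hn0)
    rw [helr, max_eq_right hS.le]
    simp only [Real.log_one, mul_zero, ne_eq, OfNat.ofNat_ne_zero, not_false_eq_true, zero_pow,
      zero_div, sub_zero, abs_zero]
    exact ⟨one_pos, by positivity⟩

end LikelihoodRatio

namespace FittedModel

variable {Ω : Type*} [MeasurableSpace Ω] {P : Measure Ω} {y r : Ω → D.Obs}
  {θ : Fin (d + 1) → ℝ} {δ C F c K : ℝ} {Q : ℕ → Ω → ℝ}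

lemma abs_sum_thetaHat_sub_mul_trace_le (h : FittedModel D P y r θ δ C F c K Q) (n i : ℕ) (ω : Ω) :
    |∑ q : Fin d, (D.thetaHat n (D.RHat n (y ω)) q.succ - θ q.succ)
        * (D.Φ i 0 * D.Φ i q.succ).trace|
      ≤ F ^ 2 * ∑ q : Fin d, |D.thetaHat n (D.RHat n (y ω)) q.succ - θ q.succ| := by
  rw [Finset.mul_sum]
  refine (Finset.abs_sum_le_sum_abs _ _).trans (Finset.sum_le_sum fun q _ => ?_)
  rw [abs_mul, mul_comm]
  exact mul_le_mul_of_nonneg_right (abs_trace_mul_le (h.trace_le i 0) (h.trace_le i _))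
    (abs_nonneg _)

lemma sqNorm_le_iSup (r : D.Obs) {n : ℕ} (i : Fin n) :
    r i ⬝ᵥ r i ≤ ⨆ i : Fin n, r i ⬝ᵥ r i :=
  le_ciSup (f := fun i : Fin n => r i ⬝ᵥ r i) (Set.finite_range _).bddAbove i

variable [IsProbabilityMeasure P]

/-- The total error of the estimators of the nuisance components. -/
lemma nullInProb_sum_abs_thetaHat_sub (h : FittedModel D P y r θ δ C F c K Q) :
    NullInProb P fun n ω => ∑ q : Fin d, |D.thetaHat n (D.RHat n (y ω)) q.succ - θ q.succ| :=
  NullInProb.sum _ fun q _ => (h.nullInProb_thetaHat_sub q.succ).of_abs_le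
    (Eventually.of_forall fun _ _ => (abs_abs _).le)

/-- The estimating functions are uniformly `o_P(√n)`. -/
lemma exists_abs_Z_le (h : FittedModel D P y r θ δ C F c K Q) :
    ∃ M : ℕ → Ω → ℝ, NullInProb P M ∧ ∀ᶠ n : ℕ in atTop, ∀ ω, ∀ i : Fin n,
      |D.Z n (D.RHat n (y ω)) (θ 0) i| ≤ M n ω * √n := by
  refine ⟨fun n ω => 2 * F * ((√(n : ℝ))⁻¹ * ⨆ i : Fin n, r ω i ⬝ᵥ r ω i)
    + (√(n : ℝ))⁻¹ * (2 * F * Q n ω + (|θ 0| * F ^ 2 + (∑ q : Fin d, |θ q.succ|) * F ^ 2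
      + F ^ 2 * ∑ q : Fin d, |D.thetaHat n (D.RHat n (y ω)) q.succ - θ q.succ|)), ?_, ?_⟩
  · refine (NullInProb.bdd_mul (BddInProb.const _) h.nullInProb_iSup_sqNorm).add
      ((NullInProb.of_tendsto tendsto_inv_sqrt_natCast).mul_bdd ?_)
    exact ((BddInProb.const _).mul h.bddInProb_Q).add ((BddInProb.const _).add
      ((BddInProb.const _).mul h.nullInProb_sum_abs_thetaHat_sub.bddInProb))
  · filter_upwards [h.residual_bound, eventually_gt_atTop 0] with n hres hn ω i
    have hs : √(n : ℝ) ≠ 0 := (Real.sqrt_pos.2 (by exact_mod_cast hn)).ne'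
    have hF := h.F_nonneg
    have h1 := (hres ω).abs_trace_RHat_le hF h.trace_le 0 i
    have h2 : |θ 0 * (D.Φ i 0 * D.Φ i 0).trace| ≤ |θ 0| * F ^ 2 := by
      rw [abs_mul]
      exact mul_le_mul_of_nonneg_left (abs_trace_mul_le (h.trace_le i 0) (h.trace_le i 0))
        (abs_nonneg _)
    have h3 : |∑ q : Fin d, θ q.succ * (D.Φ i 0 * D.Φ i q.succ).trace|
        ≤ (∑ q : Fin d, |θ q.succ|) * F ^ 2 := by
      rw [Finset.sum_mul]
      refine (Finset.abs_sum_le_sum_abs _ _).trans (Finset.sum_le_sum fun q _ => ?_)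
      rw [abs_mul]
      exact mul_le_mul_of_nonneg_left (abs_trace_mul_le (h.trace_le i 0) (h.trace_le i _))
        (abs_nonneg _)
    have h4 := h.abs_sum_thetaHat_sub_mul_trace_le n i ω
    have h5 : 2 * F * (r ω i ⬝ᵥ r ω i) ≤ 2 * F * ⨆ i : Fin n, r ω i ⬝ᵥ r ω i :=
      mul_le_mul_of_nonneg_left (sqNorm_le_iSup (r ω) i) (by positivity)
    have h6 : ∑ q : Fin d, D.thetaHat n (D.RHat n (y ω)) q.succ * (D.Φ i 0 * D.Φ i q.succ).trace
        = ∑ q : Fin d, θ q.succ * (D.Φ i 0 * D.Φ i q.succ).trace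
          + ∑ q : Fin d, (D.thetaHat n (D.RHat n (y ω)) q.succ - θ q.succ)
            * (D.Φ i 0 * D.Φ i q.succ).trace := by
      rw [← Finset.sum_add_distrib]
      exact Finset.sum_congr rfl fun q _ => by ring
    have h7 : ∀ a b e : ℝ, (a * ((√(n : ℝ))⁻¹ * b) + (√(n : ℝ))⁻¹ * e) * √n = a * b + e :=
      fun a b e => by field_simp
    rw [h7, Z_eq, h6]
    simp only [abs_le] at h1 h2 h3 h4 ⊢
    constructor <;> linarith

/-- The empirical second moment of the estimating functions is bounded away from zero. -/
lemma exists_pos_whp_le_nu2sq (h : FittedModel D P y r θ δ C F c K Q)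
    (hvar : ∃ c > 0, ∀ᶠ n : ℕ in atTop,
      c ≤ (n : ℝ)⁻¹ * ∑ i : Fin n, Var[fun ω => (D.Φ i 0 * D.outer (r ω) i).trace; P]) :
    ∃ c₁ > 0, WithHighProb P fun n => {ω | c₁ ≤ D.nu2sq n (D.RHat n (y ω)) (θ 0)} := by
  obtain ⟨c₂, hc₂, hvar⟩ := hvar
  have hδ := h.δ_pos
  set W : ℕ → Ω → ℝ := D.centredForm P r (Pi.single 0 1) with hW
  have hα : ∀ l, |(Pi.single 0 1 : Fin (d + 1) → ℝ) l| ≤ 1 := fun l => by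
    rcases eq_or_ne l 0 with rfl | hl
    · simp
    · simp [hl]
  obtain ⟨B, -, hB⟩ := h.exists_moment_centredForm 1
  have hU : WithHighProb P fun n =>
      {ω | c₂ / 2 ≤ (n : ℝ)⁻¹ * ∑ i ∈ Finset.range n, W i ω ^ 2} := by
    refine whp_le_average (δ := δ / 2) (K := B) (half_pos hδ) hc₂ (W := fun i ω => W i ω ^ 2)
      ((h.iIndepFun_centredForm _).comp (fun _ x => x ^ 2) fun _ => by fun_prop)
      (fun i => (h.measurable_centredForm _ i).pow_const 2) (fun i ω => sq_nonneg _) ?_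
      (fun i => (hB _ hα i).2.1.integrable_sq) ?_
    · intro i
      have he : ∀ ω, (W i ω ^ 2) ^ (1 + δ / 2) = |W i ω| ^ (2 + δ) := fun ω => by
        rw [← sq_abs, ← Real.rpow_natCast, ← Real.rpow_mul (abs_nonneg _)]
        congr 1
        push_cast
        ring
      simp only [he]
      exact (hB _ hα i).1
    · filter_upwards [hvar] with n hn
      rw [Finset.sum_range]
      refine hn.trans (le_of_eq ?_)
      congr 1
      refine Finset.sum_congr rfl fun i _ => ?_
      rw [variance_eq_integral (h.measurable_trace i 0).aemeasurable]
      simp only [hW, centredForm_single]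
  set m : ℕ → Ω → ℝ := fun n ω => ⨆ i : Fin n, r ω i ⬝ᵥ r ω i with hm
  set T : ℕ → Ω → ℝ := fun n ω =>
    ∑ q : Fin d, |D.thetaHat n (D.RHat n (y ω)) q.succ - θ q.succ| with hT
  set G : ℕ → Ω → ℝ := fun n ω => 16 * F ^ 2 * (((√(n : ℝ))⁻¹ * m n ω) * ((√(n : ℝ))⁻¹ * Q n ω)
    + ((√(n : ℝ))⁻¹ * Q n ω) * ((√(n : ℝ))⁻¹ * Q n ω)) + 2 * F ^ 4 * (T n ω * T n ω) with hG
  have hGnull : NullInProb P G := by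
    have hQ : NullInProb P fun n ω => (√(n : ℝ))⁻¹ * Q n ω :=
      (NullInProb.of_tendsto tendsto_inv_sqrt_natCast).mul_bdd h.bddInProb_Q
    have hTn := h.nullInProb_sum_abs_thetaHat_sub
    exact (NullInProb.bdd_mul (BddInProb.const _)
      ((h.nullInProb_iSup_sqNorm.mul_bdd hQ.bddInProb).add (hQ.mul_bdd hQ.bddInProb))).add
      (NullInProb.bdd_mul (BddInProb.const _) (hTn.mul_bdd hTn.bddInProb))
  -- `V ≥ U / 2 - G`, where `U ≥ c₂ / 2` is the second moment of the centred forms and `|G| < c₂ / 8`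
  refine ⟨c₂ / 8, by positivity, (hU.inter (hGnull.whp_lt (ε := c₂ / 8) (by positivity))).mono ?_⟩
  filter_upwards [h.residual_bound, eventually_gt_atTop 0] with n hres hn
  rintro ω ⟨hω1, hω2⟩
  simp only [Set.mem_ofPred_eq] at hω1 hω2 ⊢
  have hn0 : (0 : ℝ) < n := by exact_mod_cast hn
  have h1 := (hres ω).sum_trace_sub_sq_le h.F_nonneg h.trace_le 0 hn
    (fun i => sqNorm_le_iSup (r ω) i)
  have hpt : ∀ i : Fin n, W i ω ^ 2 ≤ 2 * D.Z n (D.RHat n (y ω)) (θ 0) i ^ 2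
      + 4 * ((D.Φ i 0 * D.RHat n (y ω) i).trace - (D.Φ i 0 * D.outer (r ω) i).trace) ^ 2
      + 4 * (F ^ 2 * T n ω) ^ 2 := fun i => by
    have h2 := h.Z_RHat_eq n (y ω) ω i
    have h3 := pow_le_pow_left₀ (abs_nonneg _) (h.abs_sum_thetaHat_sub_mul_trace_le n i ω) 2
    rw [sq_abs] at h3
    rw [← hW] at h2
    set a := (D.Φ i 0 * D.RHat n (y ω) i).trace - (D.Φ i 0 * D.outer (r ω) i).trace
    set b := ∑ q : Fin d, (D.thetaHat n (D.RHat n (y ω)) q.succ - θ q.succ)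
      * (D.Φ i 0 * D.Φ i q.succ).trace
    have h4 : W i ω = D.Z n (D.RHat n (y ω)) (θ 0) i - a + b := by rw [h2]; ring
    rw [h4]
    nlinarith [sq_nonneg (D.Z n (D.RHat n (y ω)) (θ 0) i + (a - b)), sq_nonneg (a + b)]
  have hsum : ∑ i ∈ Finset.range n, W i ω ^ 2
      ≤ 2 * ∑ i, D.Z n (D.RHat n (y ω)) (θ 0) i ^ 2
        + 4 * (8 * F ^ 2 * (m n ω * Q n ω + Q n ω ^ 2)) + n * (4 * (F ^ 2 * T n ω) ^ 2) := by
    rw [Finset.sum_range]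
    refine (Finset.sum_le_sum fun i _ => hpt i).trans ?_
    rw [Finset.sum_add_distrib, Finset.sum_add_distrib, ← Finset.mul_sum, ← Finset.mul_sum,
      Finset.sum_const, Finset.card_univ, Fintype.card_fin, nsmul_eq_mul]
    linarith
  have h5 := mul_le_mul_of_nonneg_left hsum (inv_pos.2 hn0).le
  have h6 : (n : ℝ)⁻¹ * (2 * ∑ i, D.Z n (D.RHat n (y ω)) (θ 0) i ^ 2
        + 4 * (8 * F ^ 2 * (m n ω * Q n ω + Q n ω ^ 2)) + n * (4 * (F ^ 2 * T n ω) ^ 2))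
      = 2 * D.nu2sq n (D.RHat n (y ω)) (θ 0) + 2 * G n ω := by
    have h7 : (n : ℝ)⁻¹ = (√(n : ℝ))⁻¹ * (√(n : ℝ))⁻¹ := by
      rw [← mul_inv, Real.mul_self_sqrt hn0.le]
    have h8 : (n : ℝ)⁻¹ * (n * (4 * (F ^ 2 * T n ω) ^ 2)) = 4 * (F ^ 2 * T n ω) ^ 2 := by
      field_simp
    rw [mul_add, h8, nu2sq, hG, h7]
    ring
  linarith [le_abs_self (G n ω)]

/-- The likelihood ratio is positive with high probability, and the standardized statistic converges
to `f U`, with `U` standard normal, if `f` is the function of the normalized sum that approximates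
it: `f x = x ^ 2` in the interior and `f x = (max x 0) ^ 2` on the boundary of the parameter space.
-/
lemma wilks_of_quadratic_approximation (h : FittedModel D P y r θ δ C F c K Q) {c' c₁ : ℝ}
    (hc' : 0 < c') (hc₁ : 0 < c₁)
    (hv : ∀ᶠ n : ℕ in atTop, c' ≤ Var[fun ω => D.normSum n (D.RHat n (y ω)) (θ 0); P])
    {ν : ℕ → Ω → ℝ} (hν_meas : ∀ n, Measurable (ν n))
    (hν : NullInProb P fun n ω =>
      ν n ω - Var[fun ω' => D.normSum n (D.RHat n (y ω')) (θ 0); P])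
    {f : ℝ → ℝ} (hf : Continuous f) (hf_smul : ∀ t, 0 ≤ t → ∀ x, f (t * x) = t ^ 2 * f x)
    (hf_le : ∀ x, |f x| ≤ x ^ 2) {M : ℕ → Ω → ℝ} (hM : NullInProb P M)
    {A : ℕ → Set Ω} (hA : WithHighProb P A)
    (hbound : ∀ᶠ n in atTop, ∀ ω ∈ A n, c₁ ≤ D.nu2sq n (D.RHat n (y ω)) (θ 0) ∧
      0 < D.elr n (D.RHat n (y ω)) (θ 0) ∧
      |-2 * Real.log (D.elr n (D.RHat n (y ω)) (θ 0))
          - f (D.normSum n (D.RHat n (y ω)) (θ 0)) / D.nu2sq n (D.RHat n (y ω)) (θ 0)|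
        ≤ 16 * (M n ω * |D.normSum n (D.RHat n (y ω)) (θ 0)|
            / D.nu2sq n (D.RHat n (y ω)) (θ 0))
          * (D.normSum n (D.RHat n (y ω)) (θ 0) ^ 2 / D.nu2sq n (D.RHat n (y ω)) (θ 0))) :
    WithHighProb P (fun n => {ω | 0 < D.elr n (D.RHat n (y ω)) (θ 0)}) ∧
      TendstoInDistribution (fun n ω => D.nu2sq n (D.RHat n (y ω)) (θ 0) / ν n ω
        * (-2 * Real.log (D.elr n (D.RHat n (y ω)) (θ 0))))
      atTop f (fun _ => P) (gaussianReal 0 1) := by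
  refine ⟨hA.mono (hbound.mono fun n hn ω hω => (hn ω hω).2.1), ?_⟩
  have hlim := (h.tendstoInDistribution_normSum hc' hv).continuous_comp hf
  have hmeas : ∀ n, Measurable fun ω => D.nu2sq n (D.RHat n (y ω)) (θ 0) / ν n ω
      * (-2 * Real.log (D.elr n (D.RHat n (y ω)) (θ 0))) := fun n => by
    have hR := D.measurable_RHat n h.y_measurable
    have h1 : Measurable fun ω => D.nu2sq n (D.RHat n (y ω)) (θ 0) :=
      (Finset.measurable_sum _ fun i _ => (D.measurable_Z n hR (θ 0) i).pow_const 2).const_mul _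
    exact (h1.div (hν_meas n)).mul
      ((Real.measurable_log.comp (D.measurable_elr n hR _)).const_mul _)
  refine tendstoInDistribution_of_tendstoInMeasure_sub _ _ hlim
    (NullInProb.tendstoInMeasure ?_) fun n => (hmeas n).aemeasurable
  have hS : BddInProb P fun n ω => |D.normSum n (D.RHat n (y ω)) (θ 0)| :=
    h.bddInProb_normSum.of_abs_le (Eventually.of_forall fun _ _ => (abs_abs _).le)
  have hbd : NullInProb P fun n ω =>
      M n ω * (16 / (c₁ * (c' / 2)) * (|D.normSum n (D.RHat n (y ω)) (θ 0)|
          * (|D.normSum n (D.RHat n (y ω)) (θ 0)| * |D.normSum n (D.RHat n (y ω)) (θ 0)|)))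
        + |ν n ω - Var[fun ω' => D.normSum n (D.RHat n (y ω')) (θ 0); P]|
          * (((c' / 2) * c')⁻¹ * (|D.normSum n (D.RHat n (y ω)) (θ 0)|
            * |D.normSum n (D.RHat n (y ω)) (θ 0)|)) :=
    (hM.mul_bdd ((BddInProb.const _).mul (hS.mul (hS.mul hS)))).add
      ((hν.of_abs_le (Eventually.of_forall fun _ _ => (abs_abs _).le)).mul_bdd
        ((BddInProb.const _).mul (hS.mul hS)))
  refine hbd.of_le (hA.inter (hν.whp_lt (half_pos hc'))) ?_
  filter_upwards [hbound, hv] with n hbn hvn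
  rintro ω ⟨hωA, hων⟩
  obtain ⟨hV, -, hℓ⟩ := hbn ω hωA
  simp only [Set.mem_ofPred_eq, Pi.sub_apply, Function.comp_apply] at hων ⊢
  generalize D.nu2sq n (D.RHat n (y ω)) (θ 0) = V at *
  generalize Var[fun ω' => D.normSum n (D.RHat n (y ω')) (θ 0); P] = v at *
  generalize D.normSum n (D.RHat n (y ω)) (θ 0) = S at *
  generalize -2 * Real.log (D.elr n (D.RHat n (y ω)) (θ 0)) = ℓ at *
  have hV0 : 0 < V := hc₁.trans_le hV
  have hv0 : 0 < v := hc'.trans_le hvn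
  have hνc : c' / 2 ≤ ν n ω := by linarith [(abs_lt.1 hων).1]
  have hν0 : 0 < ν n ω := (half_pos hc').trans_le hνc
  have hfS : f (S / √v) = f S / v := by
    rw [div_eq_inv_mul, hf_smul _ (by positivity), inv_pow, Real.sq_sqrt hv0.le]
    ring
  have hsplit : V / ν n ω * ℓ - f S / v
      = V / ν n ω * (ℓ - f S / V) + f S * (v - ν n ω) / (ν n ω * v) := by
    field_simp
    ring
  -- the sign of `M` is not assumed; it follows from the error bound
  have hM0 : 0 ≤ M n ω * |S| ^ 3 := by
    have h1 := (abs_nonneg _).trans hℓ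
    have h2 : 16 * (M n ω * |S| / V) * (S ^ 2 / V) = 16 / V ^ 2 * (M n ω * |S| ^ 3) := by
      rw [← sq_abs S]
      field_simp
    rw [h2] at h1
    exact nonneg_of_mul_nonneg_right h1 (by positivity)
  have hA1 : |V / ν n ω * (ℓ - f S / V)|
      ≤ M n ω * (16 / (c₁ * (c' / 2)) * (|S| * (|S| * |S|))) := by
    rw [abs_mul, abs_of_pos (div_pos hV0 hν0)]
    calc V / ν n ω * |ℓ - f S / V| ≤ V / ν n ω * (16 * (M n ω * |S| / V) * (S ^ 2 / V)) := by
          gcongr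
      _ = 16 * (M n ω * |S| ^ 3) / (V * ν n ω) := by
          rw [← sq_abs S]
          field_simp
      _ ≤ 16 * (M n ω * |S| ^ 3) / (c₁ * (c' / 2)) := by gcongr
      _ = _ := by ring
  have hA2 : |f S * (v - ν n ω) / (ν n ω * v)|
      ≤ |ν n ω - v| * (((c' / 2) * c')⁻¹ * (|S| * |S|)) := by
    rw [abs_div, abs_mul, abs_of_pos (mul_pos hν0 hv0), abs_sub_comm]
    calc |f S| * |ν n ω - v| / (ν n ω * v) ≤ S ^ 2 * |ν n ω - v| / (c' / 2 * c') := by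
          have := hf_le S
          gcongr
      _ = _ := by
          rw [abs_mul_abs_self]
          ring
  rw [hfS, hsplit]
  exact (abs_add_le _ _).trans ((add_le_add hA1 hA2).trans (le_abs_self _))

end FittedModel

end MixedDesign

/-! ### Wilks' theorem in the interior and on the boundary -/

namespace MixedDesign

variable {p d : ℕ} {D : MixedDesign p d}

namespace FittedModel

variable {Ω : Type*} [MeasurableSpace Ω] {P : Measure Ω} {y r : Ω → D.Obs}
  {θ : Fin (d + 1) → ℝ} {δ C F c K : ℝ} {Q : ℕ → Ω → ℝ}

lemma eventually_Xi_zero_zero_pos (h : FittedModel D P y r θ δ C F c K Q) :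
    ∀ᶠ n : ℕ in atTop, 0 < n ∧ 0 < c * n ∧ c * n ≤ D.Xi n 0 0 := by
  filter_upwards [h.le_Xi, eventually_gt_atTop 0] with n hXi hn
  exact ⟨hn, mul_pos h.c_pos (by exact_mod_cast hn), le_Xi_zero_zero hXi⟩

variable [IsProbabilityMeasure P]

/-- With high probability, the quadratic approximation of the empirical likelihood applies. -/
lemma exists_whp_quadratic_conditions (h : FittedModel D P y r θ δ C F c K Q)
    (hvar : ∃ c > 0, ∀ᶠ n : ℕ in atTop,
      c ≤ (n : ℝ)⁻¹ * ∑ i : Fin n, Var[fun ω => (D.Φ i 0 * D.outer (r ω) i).trace; P]) :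
    ∃ c₁ > 0, ∃ (M : ℕ → Ω → ℝ) (A : ℕ → Set Ω), NullInProb P M ∧ WithHighProb P A ∧
      ∀ᶠ n : ℕ in atTop, ∀ ω ∈ A n, c₁ ≤ D.nu2sq n (D.RHat n (y ω)) (θ 0) ∧
        (∀ i, |D.Z n (D.RHat n (y ω)) (θ 0) i| ≤ M n ω * √n) ∧
        M n ω * |D.normSum n (D.RHat n (y ω)) (θ 0)| ≤ D.nu2sq n (D.RHat n (y ω)) (θ 0) / 8 := by
  obtain ⟨c₁, hc₁, hV⟩ := h.exists_pos_whp_le_nu2sq hvar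
  obtain ⟨M, hM, hZ⟩ := h.exists_abs_Z_le
  refine ⟨c₁, hc₁, M, _, hM, hV.inter ((hM.mul_bdd h.bddInProb_normSum).whp_lt
    (ε := c₁ / 8) (by positivity)), ?_⟩
  filter_upwards [hZ] with n hn
  rintro ω ⟨hω1, hω2⟩
  simp only [Set.mem_ofPred_eq] at hω1 hω2
  refine ⟨hω1, hn ω, ?_⟩
  have h1 : M n ω * |D.normSum n (D.RHat n (y ω)) (θ 0)|
      ≤ |M n ω * D.normSum n (D.RHat n (y ω)) (θ 0)| := by
    rw [abs_mul]
    exact mul_le_mul_of_nonneg_right (le_abs_self _) (abs_nonneg _)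
  linarith

/-- With high probability, the unconstrained maximizer of the profile likelihood is admissible if
the true value is positive. -/
lemma whp_maximizer_nonneg (h : FittedModel D P y r θ δ C F c K Q) (hθ : 0 < θ 0) :
    WithHighProb P fun n => {ω | 0 ≤ θ 0 +
      √(n : ℝ) * D.normSum n (D.RHat n (y ω)) (θ 0) / D.Xi n 0 0} := by
  refine (((NullInProb.of_tendsto tendsto_inv_sqrt_natCast).mul_bdd h.bddInProb_normSum).whp_lt
    (ε := c * θ 0) (mul_pos h.c_pos hθ)).mono ?_
  filter_upwards [h.eventually_Xi_zero_zero_pos] with n hn ω hω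
  obtain ⟨hn, hcn, hXi⟩ := hn
  have hn0 : (0 : ℝ) < n := by exact_mod_cast hn
  have hs : 0 < √(n : ℝ) := Real.sqrt_pos.2 hn0
  simp only [Set.mem_ofPred_eq] at hω ⊢
  generalize D.normSum n (D.RHat n (y ω)) (θ 0) = S at *
  have h1 : |√(n : ℝ) * S / D.Xi n 0 0| ≤ θ 0 := by
    rw [abs_div, abs_of_pos (hcn.trans_le hXi), div_le_iff₀ (hcn.trans_le hXi)]
    have h2 : √(n : ℝ) * S = n * ((√(n : ℝ))⁻¹ * S) := by
      nth_rewrite 2 [← Real.mul_self_sqrt hn0.le]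
      field_simp
    rw [h2, abs_mul, abs_of_pos hn0]
    calc n * |(√(n : ℝ))⁻¹ * S| ≤ n * (c * θ 0) := by gcongr
      _ = θ 0 * (c * n) := by ring
      _ ≤ θ 0 * D.Xi n 0 0 := by gcongr
  linarith [(abs_le.1 h1).1]

/-- Wilks' theorem for a positive variance component. -/
theorem wilks_of_pos (h : FittedModel D P y r θ δ C F c K Q)
    (hvar : ∃ c > 0, ∀ᶠ n : ℕ in atTop,
      c ≤ (n : ℝ)⁻¹ * ∑ i : Fin n, Var[fun ω => (D.Φ i 0 * D.outer (r ω) i).trace; P])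
    {c' : ℝ} (hc' : 0 < c')
    (hv : ∀ᶠ n : ℕ in atTop, c' ≤ Var[fun ω => D.normSum n (D.RHat n (y ω)) (θ 0); P])
    {ν : ℕ → Ω → ℝ} (hν_meas : ∀ n, Measurable (ν n))
    (hν : NullInProb P fun n ω =>
      ν n ω - Var[fun ω' => D.normSum n (D.RHat n (y ω')) (θ 0); P]) (hθ : 0 < θ 0) :
    WithHighProb P (fun n => {ω | 0 < D.elr n (D.RHat n (y ω)) (θ 0)}) ∧
      TendstoInDistribution (fun n ω => D.nu2sq n (D.RHat n (y ω)) (θ 0) / ν n ω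
        * (-2 * Real.log (D.elr n (D.RHat n (y ω)) (θ 0))))
      atTop (fun u : ℝ => u ^ 2) (fun _ => P) (gaussianReal 0 1) := by
  obtain ⟨c₁, hc₁, M, A, hM, hA, hcond⟩ := h.exists_whp_quadratic_conditions hvar
  refine h.wilks_of_quadratic_approximation hc' hc₁ hv hν_meas hν (f := fun u => u ^ 2)
    (by fun_prop) (fun t _ x => mul_pow t x 2) (fun x => (abs_of_nonneg (sq_nonneg x)).le) hM
    (hA.inter (h.whp_maximizer_nonneg hθ)) ?_
  filter_upwards [hcond, h.eventually_Xi_zero_zero_pos] with n h1 h2 ω hω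
  obtain ⟨h3, h4, h5⟩ := h1 ω hω.1
  exact ⟨h3, elr_quadratic_bound h2.1 (h2.2.1.trans_le h2.2.2) hω.2 (hc₁.trans_le h3) h4 h5⟩

/-- Wilks' theorem for a variance component at the boundary of the parameter space. -/
theorem wilks_of_eq_zero (h : FittedModel D P y r θ δ C F c K Q)
    (hvar : ∃ c > 0, ∀ᶠ n : ℕ in atTop,
      c ≤ (n : ℝ)⁻¹ * ∑ i : Fin n, Var[fun ω => (D.Φ i 0 * D.outer (r ω) i).trace; P])
    {c' : ℝ} (hc' : 0 < c')
    (hv : ∀ᶠ n : ℕ in atTop, c' ≤ Var[fun ω => D.normSum n (D.RHat n (y ω)) (θ 0); P])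
    {ν : ℕ → Ω → ℝ} (hν_meas : ∀ n, Measurable (ν n))
    (hν : NullInProb P fun n ω =>
      ν n ω - Var[fun ω' => D.normSum n (D.RHat n (y ω')) (θ 0); P]) (hθ : θ 0 = 0) :
    WithHighProb P (fun n => {ω | 0 < D.elr n (D.RHat n (y ω)) (θ 0)}) ∧
      TendstoInDistribution (fun n ω => D.nu2sq n (D.RHat n (y ω)) (θ 0) / ν n ω
        * (-2 * Real.log (D.elr n (D.RHat n (y ω)) (θ 0))))
      atTop (fun u : ℝ => (max u 0) ^ 2) (fun _ => P) (gaussianReal 0 1) := by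
  obtain ⟨c₁, hc₁, M, A, hM, hA, hcond⟩ := h.exists_whp_quadratic_conditions hvar
  have hf_smul : ∀ t : ℝ, 0 ≤ t → ∀ x : ℝ, (max (t * x) 0) ^ 2 = t ^ 2 * (max x 0) ^ 2 :=
    fun t ht x => by rw [← mul_pow, mul_max_of_nonneg _ _ ht, mul_zero]
  have hf_le : ∀ x : ℝ, |(max x 0) ^ 2| ≤ x ^ 2 := fun x => by
    rw [abs_of_nonneg (sq_nonneg _), ← sq_abs x]
    exact pow_le_pow_left₀ (le_max_right _ _) (max_le (le_abs_self x) (abs_nonneg x)) 2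
  refine h.wilks_of_quadratic_approximation hc' hc₁ hv hν_meas hν (f := fun u => (max u 0) ^ 2)
    (by fun_prop) hf_smul hf_le hM hA ?_
  filter_upwards [hcond, h.eventually_Xi_zero_zero_pos] with n h1 h2 ω hω
  obtain ⟨h3, h4, h5⟩ := h1 ω hω
  rw [hθ] at h3 h4 h5 ⊢
  exact ⟨h3, elr_zero_quadratic_bound h2.1 (h2.2.1.trans_le h2.2.2) (hc₁.trans_le h3) h4 h5⟩

end FittedModel

end MixedDesign

/-- The moments of order `4 + γ` of the norms bound moments of order `2 + δ ≤ 2 + γ / 2` of the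
squared norms. -/
lemma integral_dotProduct_rpow_le {Ω : Type*} [MeasurableSpace Ω] {P : Measure Ω}
    [IsProbabilityMeasure P] {m : ℕ} {v : Ω → Fin m → ℝ} (hv : Measurable v) {γ δ C : ℝ}
    (hδ : 0 ≤ δ) (hδγ : δ ≤ γ / 2)
    (hi : Integrable (fun ω => ‖WithLp.toLp 2 (v ω)‖ ^ (4 + γ : ℝ)) P)
    (hC : ∫ ω, ‖WithLp.toLp 2 (v ω)‖ ^ (4 + γ : ℝ) ∂P ≤ C) :
    Integrable (fun ω => (v ω ⬝ᵥ v ω) ^ (2 + δ)) P ∧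
      ∫ ω, (v ω ⬝ᵥ v ω) ^ (2 + δ) ∂P ≤ 1 + C := by
  have hnorm : ∀ ω, ‖WithLp.toLp 2 (v ω)‖ ^ (4 + γ : ℝ) = (v ω ⬝ᵥ v ω) ^ (2 + γ / 2) := fun ω => by
    have h1 : v ω ⬝ᵥ v ω = ‖WithLp.toLp 2 (v ω)‖ ^ (2 : ℝ) := by
      rw [Real.rpow_two, EuclideanSpace.norm_sq_eq]
      simp only [Real.norm_eq_abs, sq_abs, dotProduct, ← pow_two]
    rw [h1, ← Real.rpow_mul (norm_nonneg _)]
    congr 1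
    ring
  simp only [hnorm] at hi hC
  have h0 : ∀ ω, 0 ≤ v ω ⬝ᵥ v ω := fun ω => dotProduct_self_nonneg_real _
  have hle : ∀ ω, (v ω ⬝ᵥ v ω) ^ (2 + δ) ≤ 1 + (v ω ⬝ᵥ v ω) ^ (2 + γ / 2) := fun ω =>
    rpow_le_one_add_rpow (h0 ω) (by linarith) (by linarith)
  have hm : Measurable fun ω => v ω ⬝ᵥ v ω := by
    simp only [dotProduct]
    fun_prop
  have hi' : Integrable (fun ω => (v ω ⬝ᵥ v ω) ^ (2 + δ)) P :=
    ((integrable_const (1 : ℝ)).add hi).mono' (hm.pow_const _).aestronglyMeasurable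
      (Eventually.of_forall fun ω => by
        rw [Real.norm_eq_abs, abs_of_nonneg (Real.rpow_nonneg (h0 ω) _)]
        exact hle ω)
  refine ⟨hi', (integral_mono hi' ((integrable_const (1 : ℝ)).add hi) hle).trans ?_⟩
  simp only [Pi.add_apply]
  rw [integral_add (integrable_const _) hi]
  simpa using hC

theorem theorem2 {p d : ℕ} (D : MixedDesign p d)
    {Ω : Type*} [MeasurableSpace Ω] (P : Measure Ω) [IsProbabilityMeasure P]
    -- the model: independent subjects, `y_i = X_i β* + r_i`, `E r_i = 0`, `var r_i = H_i(θ*)`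
    (β : Fin p → ℝ) (θ : Fin (d + 1) → ℝ)
    (y r : Ω → D.Obs)
    (hmodel : ∀ ω i, y ω i = D.X i *ᵥ β + r ω i)
    (hmeas : ∀ i, Measurable fun ω => r ω i)
    (hindep : iIndepFun (fun i ω => r ω i) P)
    (hmean : ∀ i j, ∫ ω, r ω i j ∂P = 0)
    (hcov : ∀ i j k, cov[fun ω => r ω i j, fun ω => r ω i k; P] = D.H θ i j k)
    -- the null hypothesis, and strictly positive nuisance components
    (θ₁ : ℝ) (hnull : θ 0 = θ₁) (hθ₁ : 0 ≤ θ₁) (hnuis : ∀ q : Fin d, 0 < θ q.succ)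
    -- uniformly bounded moments of order `4 + γ`
    (hmom : ∃ γ > 0, ∃ C : ℝ, ∀ i,
      Integrable (fun ω => ‖WithLp.toLp 2 (r ω i)‖ ^ (4 + γ : ℝ)) P ∧
        ∫ ω, ‖WithLp.toLp 2 (r ω i)‖ ^ (4 + γ : ℝ) ∂P ≤ C)
    -- the convex hull condition, for the true errors
    (hhull : Tendsto
      (fun n => P {ω | (0 : ℝ) ∈ convexHull ℝ (Set.range (D.Z n (D.outer (r ω)) θ₁))})
      atTop (𝓝 1))
    -- regularity of the design: the least-squares estimator exists, the `Φ_{iq}` are bounded, and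
    -- the variance components are identified at the rate of the sample size
    (hX : ∀ᶠ n in atTop, IsUnit ((D.stackX n)ᵀ * D.stackX n))
    (hΦ : ∃ C : ℝ, ∀ i q, ((D.Φ i q)ᵀ * D.Φ i q).trace ≤ C)
    (hXi : ∃ c > 0, ∀ᶠ n : ℕ in atTop, ∀ x : Fin (d + 1) → ℝ,
      c * n * (x ⬝ᵥ x) ≤ x ⬝ᵥ (D.Xi n *ᵥ x))
    -- the average variance of `tr(Φ_{i1} R_i)` does not degenerate
    (hvar : ∃ c > 0, ∀ᶠ n : ℕ in atTop,
      c ≤ (n : ℝ)⁻¹ * ∑ i : Fin n, Var[fun ω => (D.Φ i 0 * D.outer (r ω) i).trace; P])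
    -- the variance of `n^{-1/2} ∑ Ẑ_i` does not degenerate
    (havar : ∃ c > 0, ∀ᶠ n : ℕ in atTop,
      c ≤ Var[fun ω => D.normSum n (D.RHat n (y ω)) θ₁; P])
    -- a consistent estimator of that variance
    (ν₁sq : ℕ → Ω → ℝ) (hν_meas : ∀ n, Measurable (ν₁sq n))
    (hν : TendstoInMeasure P
      (fun n ω => ν₁sq n ω - Var[fun ω' => D.normSum n (D.RHat n (y ω')) θ₁; P])
      atTop (fun _ => 0)) :
    -- the likelihood ratio is positive (so that its logarithm makes sense) with probability
    -- tending to one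
    Tendsto (fun n => P {ω | 0 < D.elr n (D.RHat n (y ω)) θ₁}) atTop (𝓝 1) ∧
    -- `χ²_1` is the law of the square of a standard normal variable
    (0 < θ₁ → TendstoInDistribution
      (fun n ω => D.nu2sq n (D.RHat n (y ω)) θ₁ / ν₁sq n ω *
        (-2 * Real.log (D.elr n (D.RHat n (y ω)) θ₁)))
      atTop (fun u : ℝ => u ^ 2) (fun _ => P) (gaussianReal 0 1)) ∧
    (θ₁ = 0 → TendstoInDistribution
      (fun n ω => D.nu2sq n (D.RHat n (y ω)) θ₁ / ν₁sq n ω *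
        (-2 * Real.log (D.elr n (D.RHat n (y ω)) θ₁)))
      atTop (fun u : ℝ => (max u 0) ^ 2) (fun _ => P) (gaussianReal 0 1)) := by
  obtain ⟨γ, hγ, C, hC⟩ := hmom
  obtain ⟨CΦ, hCΦ⟩ := hΦ
  obtain ⟨c, hc, hXi⟩ := hXi
  obtain ⟨c', hc', hv⟩ := havar
  subst hnull
  have hδ : 0 < min (γ / 2) 1 := lt_min (half_pos hγ) one_pos
  have hE : MixedDesign.ErrorModel D P r θ (min (γ / 2) 1) (1 + C) (√(max CΦ 0)) :=
    { measurable := hmeas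
      indep := hindep
      mean := hmean
      cov := hcov
      δ_pos := hδ
      δ_le_one := min_le_right _ _
      moment := fun i => integral_dotProduct_rpow_le (hmeas i) hδ.le (min_le_left _ _)
        (hC i).1 (hC i).2
      F_nonneg := Real.sqrt_nonneg _
      trace_le := fun i k => by
        rw [Real.sq_sqrt (le_max_right _ _)]
        exact (hCΦ i k).trans (le_max_left _ _) }
  obtain ⟨Q, K, hQ0, hQ⟩ := hE.exists_residual_bound hX
  have hF : MixedDesign.FittedModel D P y r θ (min (γ / 2) 1) (1 + C) (√(max CΦ 0)) c K Q :=
    { hE with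
      y_measurable := fun i => by
        simp only [hmodel]
        exact (hmeas i).const_add _
      c_pos := hc
      le_Xi := hXi
      Q_nonneg := hQ0
      integral_Q_sq := hQ.mono fun n hn => hn.1
      residual_bound := hQ.mono fun n hn ω => hn.2 β (y ω) ω (hmodel ω) }
  have hν' := NullInProb.of_tendstoInMeasure hν
  refine ⟨?_, fun hpos => (hF.wilks_of_pos hvar hc' hv hν_meas hν' hpos).2,
    fun h0 => (hF.wilks_of_eq_zero hvar hc' hv hν_meas hν' h0).2⟩
  rcases hθ₁.lt_or_eq with hpos | h0
  · exact (hF.wilks_of_pos hvar hc' hv hν_meas hν' hpos).1.tendsto_one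
  · exact (hF.wilks_of_eq_zero hvar hc' hv hν_meas hν' h0.symm).1.tendsto_one
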